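/- Let $R$ be a non-zero commutative noetherian ring with identity, and let $\mathcal D(R)$ be the derived category of (unbounded) complexes of $R$-modules; $\simeq$ denotes isomorphism in $\mathcal D(R)$. An $R$-complex $X$ is homologically bounded if $\operatorname{H}_i(X)=0$ for all but finitely many $i$, and homologically finite if moreover every $\operatorname{H}_i(X)$ is a finitely generated $R$-module. For $R$-complexes $A$ and $N$: - $A$ is semidualizing over $R$ if $A$ is homologically finite and the natural homothety morphism $R\to\mathbf{R}\mathrm{Hom}_R(A,A)$ is an isomorphism in $\mathcal D(R)$; - $N$ is derived $A$-reflexive if $N$ and $\mathbf{R}\mathrm{Hom}_R(N,A)$ are homologically finite and the natural biduality morphism $N\to\mathbf{R}\mathrm{Hom}_R(\mathbf{R}\mathrm{Hom}_R(N,A),A)$ is an isomorphism in $\mathcal D(R)$; - $N$ is in the Bass class $\mathcal B_A(R)$ if $N$ and $\mathbf{R}\mathrm{Hom}_R(A,N)$ are homologically bounded and the natural evaluation morphism $A\otimes^{\mathbf L}_R\mathbf{R}\mathrm{Hom}_R(A,N)\to N$ is an isomorphism in $\mathcal D(R)$. Theorem. Let $A$ be a homologically finite $R$-complex. The following conditions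 are equivalent: (i) there are non-zero commutative noetherian rings $R_1,R_2$ with identity and a ring isomorphism $R\cong R_1\times R_2$, and there is a semidualizing $R_1$-complex $A_1$, such that $A\simeq A_1\times 0$ in $\mathcal D(R)$, where $A_1\times 0$ is regarded as an $R$-complex via $R\cong R_1\times R_2$; (ii) $A$ is derived $A$-reflexive, $A$ is not semidualizing over $R$, and $A\not\simeq 0$; (iii) $\mathbf{R}\mathrm{Hom}_R(A,A)$ is derived $A$-reflexive, $A$ is not semidualizing over $R$, and $A\not\simeq 0$; (iv) $A\not\simeq 0$, $A\in\mathcal B_A(R)$, and $A$ is not semidualizing over $R$. Moreover, when these conditions hold, $\operatorname{Spec}(R)$ is disconnected. -/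

import Mathlib

/-!
Complexes of modules over a commutative ring `R` are `ℤ`-indexed cochain complexes: the module
written `X_i` in homological notation is `X.X (-i)`.  None of the notions below depends on which
of the two indexings is used.
-/

open CategoryTheory ZeroObject

universe u

noncomputable section

namespace RComplex

/-- Complexes of `R`-modules (unbounded in both directions). -/
abbrev Cpx (R : Type u) [CommRing R] := CochainComplex (ModuleCat.{u} R) ℤ

section Finiteness

variable {R : Type u} [CommRing R]

/-- `H_i(X) = 0` for all but finitely many `i`. -/
def HomologicallyBounded (X : Cpx R) : Prop :=
  {i : ℤ | ¬ Limits.IsZero (X.homology i)}.Finite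

/-- `X` is homologically bounded and every `H_i(X)` is finitely generated. -/
def HomologicallyFinite (X : Cpx R) : Prop :=
  HomologicallyBounded X ∧ ∀ i : ℤ, Module.Finite R (X.homology i)

end Finiteness

section HomComplex

open CochainComplex CochainComplex.HomComplex

variable {R : Type u} [CommRing R]

/-- The complex of `R`-modules `Hom_R(F, G)`: in degree `n` it is the module of families of
`R`-linear maps `F.X p → G.X (p + n)`, with differential `f ↦ d ∘ f - (-1) ^ n f ∘ d`. -/
def homCpx (F G : Cpx R) : Cpx R where
  X n := ModuleCat.of R (Cochain F G n)
  d i j := ModuleCat.ofHom (δ_hom R F G i j)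
  shape i j hij := ModuleCat.hom_ext (LinearMap.ext fun z => δ_shape i j hij z)
  d_comp_d' i j k _ _ := ModuleCat.hom_ext (LinearMap.ext fun z => δ_δ i j k z)

/-- The chain map `Hom_R(F, G) → Hom_R(F', G)` induced by a chain map `F' → F`. -/
def homCpxPrecomp {F' F : Cpx R} (φ : F' ⟶ F) (G : Cpx R) : homCpx F G ⟶ homCpx F' G where
  f n := ModuleCat.ofHom
    { toFun := fun z : Cochain F G n => (Cochain.ofHom φ).comp z (zero_add n)
      map_add' := fun z w => Cochain.comp_add _ z w _
      map_smul' := fun r z => Cochain.comp_smul _ r z _ }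
  comm' i j hij := ModuleCat.hom_ext (LinearMap.ext fun (z : Cochain F G i) =>
    show δ i j ((Cochain.ofHom φ).comp z (zero_add i)) =
        (Cochain.ofHom φ).comp (δ i j z) (zero_add j) by
      rw [δ_zero_cochain_comp _ _ _ hij]
      simp)

/-- The linear map `R → Hom_R(F, G)^0` given by `r ↦ r φ`, for a chain map `φ : F → G`. -/
def scalarMapZero {F G : Cpx R} (φ : F ⟶ G) : ModuleCat.of R R ⟶ (homCpx F G).X 0 :=
  ModuleCat.ofHom (LinearMap.toSpanSingleton R (Cochain F G 0) (Cochain.ofHom φ))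

/-- The chain map `R → Hom_R(F, G)` given by `r ↦ r φ`, for a chain map `φ : F → G`; the ring
`R` is viewed as a complex concentrated in degree `0`. -/
def scalarMap {F G : Cpx R} (φ : F ⟶ G) :
    (HomologicalComplex.single (ModuleCat.{u} R) (ComplexShape.up ℤ) 0).obj (ModuleCat.of R R) ⟶
      homCpx F G :=
  HomologicalComplex.mkHomFromSingle (scalarMapZero φ)
    (fun k _ => ModuleCat.hom_ext (LinearMap.ext fun (r : R) =>
      show δ 0 k (r • Cochain.ofHom φ) = 0 by rw [δ_smul, δ_ofHom, smul_zero]))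

/-- The bilinear map `(x, f) ↦ (-1) ^ (i j) f(x)` for `x` of degree `i` and `f` of degree `j`. -/
def signedEval (F G : Cpx R) (i j k : ℤ) (h : i + j = k) :
    F.X i →ₗ[R] Cochain F G j →ₗ[R] G.X k :=
  LinearMap.mk₂ R (fun x f => (i * j).negOnePow • (f.v i k h).hom x)
    (fun x y f => by simp)
    (fun r x f => by simp [smul_comm r])
    (fun x f g => by simp)
    (fun r x f => by simp [smul_comm r])

lemma signedEval_apply (F G : Cpx R) (i j k : ℤ) (h : i + j = k) (x : F.X i)
    (f : Cochain F G j) :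
    signedEval F G i j k h x f = (i * j).negOnePow • (f.v i k h).hom x := rfl

/-- The Leibniz rule for evaluation. -/
lemma d_signedEval (F G : Cpx R) (i j k i' j' k' : ℤ) (h : i + j = k) (hi : i + 1 = i')
    (hj : j + 1 = j') (hk : k + 1 = k') (x : F.X i) (f : Cochain F G j) :
    (G.d k k').hom (signedEval F G i j k h x f) =
      signedEval F G i' j k' (by lia) ((F.d i i').hom x) f +
        i.negOnePow • signedEval F G i j' k' (by lia) x (δ j j' f) := by
  have e := δ_v j j' hj f i k' (by lia) k i' (by lia) hi
  subst hi hj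
  rw [signedEval_apply, signedEval_apply, signedEval_apply, e]
  have h1 : ((i + 1) * j).negOnePow = (i * j).negOnePow * j.negOnePow := by
    rw [add_mul, one_mul, Int.negOnePow_add]
  have h2 : (i * (j + 1)).negOnePow = (i * j).negOnePow * i.negOnePow := by
    rw [mul_add, mul_one, Int.negOnePow_add]
  rw [h1, h2, Int.negOnePow_succ]
  rcases Int.units_eq_one_or (i * j).negOnePow with e1 | e1 <;>
    rcases Int.units_eq_one_or i.negOnePow with e2 | e2 <;>
    rcases Int.units_eq_one_or j.negOnePow with e3 | e3 <;>
    simp [e1, e2, e3, Units.smul_def]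

/-- The biduality chain map `F → Hom_R(Hom_R(F, G), G)`, which sends `x` to
`f ↦ (-1) ^ (|x| |f|) f(x)`. -/
def bidualityMap (F G : Cpx R) : F ⟶ homCpx (homCpx F G) G where
  f i := ModuleCat.ofHom
    { toFun := fun x => (Cochain.mk fun j k (h : j + i = k) =>
        ModuleCat.ofHom (signedEval F G i j k (by lia) x) : Cochain (homCpx F G) G i)
      map_add' := fun x y => Cochain.ext _ _ fun j k h =>
        ModuleCat.hom_ext (map_add (signedEval F G i j k (by lia)) x y)
      map_smul' := fun r x => Cochain.ext _ _ fun j k h =>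
        ModuleCat.hom_ext (map_smul (signedEval F G i j k (by lia)) r x) }
  comm' i i' hi := by
    refine ModuleCat.hom_ext (LinearMap.ext fun x => Cochain.ext _ _ fun j k h =>
      ModuleCat.hom_ext (LinearMap.ext fun (f : Cochain F G j) => ?_))
    have hi' : i + 1 = i' := hi
    have key := d_signedEval F G i j (k - 1) i' (j + 1) k (by lia) hi' rfl (by lia) x f
    let z : Cochain (homCpx F G) G i := Cochain.mk fun j k (h : j + i = k) =>
        ModuleCat.ofHom (signedEval F G i j k (by lia) x)
    have e := δ_v i i' hi' z j k h (k - 1) (j + 1) rfl rfl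
    change ((δ i i' z).v j k h).hom f = signedEval F G i' j k (by lia) ((F.d i i').hom x) f
    rw [e]
    change (G.d (k - 1) k).hom (signedEval F G i j (k - 1) (by lia) x f) +
      i'.negOnePow • (signedEval F G i (j + 1) k (by lia) x (δ j (j + 1) f)) = _
    rw [key, show i'.negOnePow = -i.negOnePow by rw [← hi', Int.negOnePow_succ]]
    simp

/-- The evaluation chain map `F ⊗_R Hom_R(F, G) → G`, which sends `x ⊗ f` to
`(-1) ^ (|x| |f|) f(x)`. -/
def evaluationMap (F G : Cpx R) : HomologicalComplex.tensorObj F (homCpx F G) ⟶ G where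
  f n := HomologicalComplex.mapBifunctorDesc fun p q (h : p + q = n) =>
    ModuleCat.ofHom (TensorProduct.lift (signedEval F G p q n h))
  comm' n n' hn := by
    apply HomologicalComplex.mapBifunctor.hom_ext
    intro p q h
    rw [HomologicalComplex.mapBifunctor.d_eq]
    simp only [Preadditive.comp_add, Preadditive.add_comp,
      HomologicalComplex.ι_mapBifunctorDesc_assoc, HomologicalComplex.mapBifunctor.ι_D₁_assoc,
      HomologicalComplex.mapBifunctor.ι_D₂_assoc]
    have hn' : n + 1 = n' := hn
    have h' : p + q = n := h
    rw [HomologicalComplex.mapBifunctor.d₁_eq F (homCpx F G) _ _ (i₁ := p) (i₁' := p + 1) rfl q n'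
        (show p + 1 + q = n' by lia),
      HomologicalComplex.mapBifunctor.d₂_eq F (homCpx F G) _ _ p (i₂ := q) (i₂' := q + 1) rfl n'
        (show p + (q + 1) = n' by lia)]
    simp only [Linear.units_smul_comp, Category.assoc, HomologicalComplex.ι_mapBifunctorDesc]
    refine ModuleCat.MonoidalCategory.tensor_ext fun x f => ?_
    have key := d_signedEval F G p q n (p + 1) (q + 1) n' h' rfl rfl hn' x f
    change (G.d n n').hom (signedEval F G p q n h' x f) = (1 : ℤˣ) •
      signedEval F G (p + 1) q n' (by lia) ((F.d p (p + 1)).hom x) f +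
        p.negOnePow • signedEval F G p (q + 1) n' (by lia) x (δ q (q + 1) f)
    rw [key, one_smul]

end HomComplex

section Derived

open DerivedCategory

variable {R : Type u} [CommRing R]

/- The derived category `D(R)`: the localization of the category of complexes at the
quasi-isomorphisms, with localization functor `DerivedCategory.Q`. -/
attribute [local instance] HasDerivedCategory.standard

/-- `X ≃ Y`, that is, `X` and `Y` are isomorphic in `D(R)`. -/
def DerivedIso (X Y : Cpx R) : Prop :=
  Nonempty (Q.obj X ≅ Q.obj Y)

/-- `X ≃ 0` in `D(R)`. -/
def DerivedZero (X : Cpx R) : Prop :=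
  Limits.IsZero (Q.obj X)

/-- A K-projective resolution of the complex `X`. -/
structure Resolution (X : Cpx R) where
  /-- the resolving complex -/
  P : Cpx R
  /-- the augmentation -/
  π : P ⟶ X
  isKProjective : P.IsKProjective
  quasiIso : QuasiIso π

namespace Resolution

variable {X : Cpx R}

instance (P : Resolution X) : QuasiIso P.π := P.quasiIso

/-- `RHom_R(X, Y)`, computed with the K-projective resolution `P` of `X`. -/
def rHom (P : Resolution X) (Y : Cpx R) : Cpx R :=
  homCpx P.P Y

/-- `X ⊗ᴸ_R Y`, computed with the K-projective (hence K-flat) resolution `P` of `X`. -/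
def lTensor (P : Resolution X) (Y : Cpx R) : Cpx R :=
  HomologicalComplex.tensorObj P.P Y

/-- The homothety morphism `χ : R → RHom_R(A, A)` in `D(R)`.  In terms of a resolution
`π : P → A`, where `RHom_R(A, A)` is `Hom_R(P, A)`, it is `r ↦ r π`. -/
def homothety {A : Cpx R} (P : Resolution A) :
    Q.obj ((HomologicalComplex.single (ModuleCat.{u} R) (ComplexShape.up ℤ) 0).obj
      (ModuleCat.of R R)) ⟶ Q.obj (P.rHom A) :=
  Q.map (scalarMap P.π)

/-- The biduality morphism `δ : N → RHom_R(RHom_R(N, A), A)` in `D(R)`.  In terms of resolutions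
`π : P → N` and `ρ : S → Hom_R(P, A)`, it is the composition of the inverse of `π` in `D(R)`
with `P → Hom_R(Hom_R(P, A), A) → Hom_R(S, A)`, where the second map is induced by `ρ`. -/
def biduality {N : Cpx R} (P : Resolution N) (A : Cpx R) (S : Resolution (P.rHom A)) :
    Q.obj N ⟶ Q.obj (S.rHom A) :=
  inv (Q.map P.π) ≫ Q.map (bidualityMap P.P A ≫ homCpxPrecomp S.π A)

/-- The evaluation morphism `ξ : A ⊗ᴸ_R RHom_R(A, N) → N` in `D(R)`. -/
def evaluation {A : Cpx R} (P : Resolution A) (N : Cpx R) :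
    Q.obj (P.lTensor (P.rHom N)) ⟶ Q.obj N :=
  Q.map (evaluationMap P.P N)

end Resolution

/- In the next definitions the resolutions may be chosen freely: every complex has a K-projective
resolution, any two of them are homotopy equivalent over the complex, and so none of the
conditions depends on the choice. -/

/-- `A` is a semidualizing `R`-complex: it is homologically finite and the homothety morphism
`R → RHom_R(A, A)` is an isomorphism in `D(R)`. -/
def IsSemidualizing (A : Cpx R) : Prop :=
  HomologicallyFinite A ∧ ∃ P : Resolution A, IsIso P.homothety

/-- `N` is derived `A`-reflexive: `N` and `RHom_R(N, A)` are homologically finite and the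
biduality morphism `N → RHom_R(RHom_R(N, A), A)` is an isomorphism in `D(R)`. -/
def IsDerivedReflexive (A N : Cpx R) : Prop :=
  HomologicallyFinite N ∧ ∃ P : Resolution N, HomologicallyFinite (P.rHom A) ∧
    ∃ S : Resolution (P.rHom A), IsIso (P.biduality A S)

/-- `N` is in the Bass class `B_A(R)`: `N` and `RHom_R(A, N)` are homologically bounded and the
evaluation morphism `A ⊗ᴸ_R RHom_R(A, N) → N` is an isomorphism in `D(R)`. -/
def InBassClass (A N : Cpx R) : Prop :=
  HomologicallyBounded N ∧ ∃ P : Resolution A, HomologicallyBounded (P.rHom N) ∧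
    IsIso (P.evaluation N)

end Derived

section Product

variable {R R₁ R₂ : Type u} [CommRing R] [CommRing R₁] [CommRing R₂]

/-- The `R`-complex obtained from an `S`-complex by restriction of scalars along `R → S`. -/
def restrictCpx {S : Type u} [CommRing S] (φ : R →+* S) (X : Cpx S) : Cpx R :=
  ((ModuleCat.restrictScalars.{u} φ).mapHomologicalComplex (ComplexShape.up ℤ)).obj X

/-- The `R`-complex `X₁ × X₂`, for an `R₁`-complex `X₁`, an `R₂`-complex `X₂` and a ring
isomorphism `R ≅ R₁ × R₂`: the direct product of `X₁` and `X₂`, on which `R` acts on each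
factor through the corresponding projection. -/
def prodCpx (e : R ≃+* R₁ × R₂) (X₁ : Cpx R₁) (X₂ : Cpx R₂) : Cpx R :=
  restrictCpx ((RingHom.fst R₁ R₂).comp e.toRingHom) X₁ ⊞
    restrictCpx ((RingHom.snd R₁ R₂).comp e.toRingHom) X₂

end Product

end RComplex

end

/-!
The four conditions are equivalent to a single one, `RComplex.IsDualizingOn`, which lives in `D(R)`:
there is an idempotent `ε` of `R`, different from `0` and `1`, such that `1 - ε` acts as zero on `A`,
every endomorphism of `A` in `D(R)` is a homothety, only multiples of `1 - ε` act as zero, and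
`Hom(A, A⟦n⟧) = 0` for `n ≠ 0`. In other words, `RHom_R(A, A)` is the factor `R ε` of the ring. For
`ε = 1` this is the condition that `A` is semidualizing, and `ε = 0` means that `A ≃ 0`.

The idempotent comes from an orthogonality argument. Let `C` be the cone of the homothety morphism
`R → RHom_R(A, A)`. If `A` is derived `A`-reflexive, then `RHom_R(-, A)` turns the homothety morphism
into an isomorphism, so that `RHom_R(C, A) = 0`
(`RComplex.IsDerivedReflexive.exists_isDualizingOn`). If `A` is in its own Bass class, then
`RHom_R(-, RHom_R(A, A))` does the same by the adjunction of tensor product and Hom, so that `C` is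
orthogonal to `RHom_R(A, A)` (`RComplex.InBassClass.exists_isDualizingOn`). Two homologically finite
complexes with `RHom_R(X, Y) = 0` have disjoint supports (`RComplex.Orthogonal.annCoh_sup_eq_top`):
at a common maximal ideal, Koszul cones would produce a non-zero morphism `X' → Y'⟦n⟧` from a map
between extremal cohomology modules. Since an element which annihilates the cohomology of a bounded
complex acts nilpotently on it, there are `a` and `b` with `a + b = 1` such that `a` annihilates the
cohomology of `C` and `b` acts as zero on `A`. Then `a` is the idempotent
(`RComplex.isDualizingOn_of_distTriang`).

Conversely, if `RHom_R(A, A)` is the factor `R ε`, then this ideal is a projective resolution of it,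
which gives derived reflexivity (`RComplex.IsDualizingOn.isDerivedReflexive`), and the homothety
morphism is a split epimorphism, which makes the evaluation morphism invertible
(`RComplex.IsDualizingOn.inBassClass`). The conditions on `A` and on `RHom_R(A, A)` are compared by
exchanging the arguments of the Hom complex, an involution relating the two biduality morphisms
(`RComplex.IsDerivedReflexive.rHom`, `RComplex.isDerivedReflexive_of_rHom`).

Finally, `ε` splits `R` as `R₁ × R₂`, and the summand of a K-projective resolution of `A` on which
`R₁` acts is a semidualizing `R₁`-complex (`RComplex.IsDualizingOn.exists_isSemidualizing`,
`RComplex.IsSemidualizing.isDualizingOn_fstIdem`). The same idempotent disconnects the spectrum.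
-/

noncomputable section

namespace RComplex

/-! ### Homology in terms of cocycles and coboundaries -/

section Homology

variable {R : Type u} [CommRing R]

/-- The class in `H^n(X)` of a cocycle, as a linear map. -/
def homologyClass (X : Cpx R) (n : ℤ) :
    LinearMap.ker (X.d n (n + 1)).hom →ₗ[R] X.homology n :=
  (X.liftCycles (ModuleCat.ofHom (LinearMap.ker (X.d n (n + 1)).hom).subtype) (n + 1)
    (by simp) (by ext x; exact x.2) ≫ X.homologyπ n).hom

lemma homologyClass_surjective (X : Cpx R) (n : ℤ) :
    Function.Surjective (homologyClass X n) := by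
  intro h
  obtain ⟨c, rfl⟩ := (ModuleCat.epi_iff_surjective (X.homologyπ n)).1 inferInstance h
  have hc : (X.d n (n + 1)).hom (X.iCycles n c) = 0 :=
    congr($(X.iCycles_d n (n + 1)) c)
  refine ⟨⟨X.iCycles n c, hc⟩, ?_⟩
  have : X.liftCycles (ModuleCat.ofHom (LinearMap.ker (X.d n (n + 1)).hom).subtype) (n + 1)
    (by simp) (by ext x; exact x.2) ⟨X.iCycles n c, hc⟩ = c := by
    apply (ModuleCat.mono_iff_injective (X.iCycles n)).1 inferInstance
    rw [← ModuleCat.comp_apply, X.liftCycles_i]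
    rfl
  simp [homologyClass, this]

lemma homologyClass_eq_zero_iff (X : Cpx R) (n : ℤ) (x : LinearMap.ker (X.d n (n + 1)).hom) :
    homologyClass X n x = 0 ↔ ∃ y, (X.d (n - 1) n).hom y = x.1 := by
  have e : homologyClass X n x = 0 ↔ X.homologyι n (homologyClass X n x) = 0 :=
    ⟨fun h => by rw [h, map_zero], fun h =>
      (ModuleCat.mono_iff_injective (X.homologyι n)).1 inferInstance (by rw [h, map_zero])⟩
  have e2 : X.homologyι n (homologyClass X n x) = X.pOpcycles n x.1 := by
    simp only [homologyClass]
    rw [← ModuleCat.comp_apply]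
    simp only [Category.assoc, HomologicalComplex.homology_π_ι,
      HomologicalComplex.liftCycles_i_assoc]
    rfl
  rw [e, e2]
  have hp : (ComplexShape.up ℤ).prev n = n - 1 := by simp
  have := (X.sc n).moduleCat_pOpcycles_eq_zero_iff x.1
  rw [← hp]
  exact this

lemma homologyMap_homologyClass {X Y : Cpx R} (f : X ⟶ Y) (n : ℤ)
    (x : LinearMap.ker (X.d n (n + 1)).hom)
    (hx : (Y.d n (n + 1)).hom ((f.f n).hom x.1) = 0) :
    HomologicalComplex.homologyMap f n (homologyClass X n x) =
      homologyClass Y n ⟨(f.f n).hom x.1, hx⟩ := by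
  apply (ModuleCat.mono_iff_injective (Y.homologyι n)).1 inferInstance
  simp only [homologyClass]
  rw [← ModuleCat.comp_apply, ← ModuleCat.comp_apply, ← ModuleCat.comp_apply]
  simp only [Category.assoc, HomologicalComplex.homology_π_ι,
    HomologicalComplex.liftCycles_i_assoc, HomologicalComplex.homologyι_naturality,
    HomologicalComplex.homology_π_ι_assoc, HomologicalComplex.p_opcyclesMap]
  rfl

lemma d_map_eq_zero {X Y : Cpx R} (f : X ⟶ Y) {n m : ℤ} {x : X.X n}
    (hx : (X.d n m).hom x = 0) : (Y.d n m).hom ((f.f n).hom x) = 0 := by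
  have := congr($(f.comm n m) x)
  simp only [ModuleCat.comp_apply] at this
  erw [this, hx, map_zero]

lemma isZero_homology_iff_forall (X : Cpx R) (n : ℤ) :
    Limits.IsZero (X.homology n) ↔ ∀ x : X.X n, (X.d n (n + 1)).hom x = 0 →
      ∃ w, (X.d (n - 1) n).hom w = x := by
  rw [ModuleCat.isZero_iff_subsingleton]
  constructor
  · intro h x hx
    rw [← homologyClass_eq_zero_iff X n ⟨x, hx⟩]
    exact Subsingleton.elim _ _
  · intro h
    refine ⟨fun a b => ?_⟩
    obtain ⟨x, hx⟩ := homologyClass_surjective X n (a - b)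
    rw [← sub_eq_zero, ← hx, homologyClass_eq_zero_iff]
    exact h x.1 x.2

lemma acyclic_iff_forall (X : Cpx R) :
    X.Acyclic ↔ ∀ n, ∀ x : X.X n, (X.d n (n + 1)).hom x = 0 →
      ∃ w, (X.d (n - 1) n).hom w = x := by
  rw [HomologicalComplex.acyclic_iff]
  refine forall_congr' fun n => ?_
  rw [HomologicalComplex.exactAt_iff_isZero_homology, isZero_homology_iff_forall]

/-- A surjective linear map on cocycles that vanishes exactly on the coboundaries identifies the
homology with its target. -/
def homologyEquivOfCocycles (X : Cpx R) (n : ℤ) {M : Type*} [AddCommGroup M] [Module R M]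
    (θ : LinearMap.ker (X.d n (n + 1)).hom →ₗ[R] M) (hθ : Function.Surjective θ)
    (h0 : ∀ x, θ x = 0 ↔ ∃ y, (X.d (n - 1) n).hom y = x.1) : X.homology n ≃ₗ[R] M :=
  ((homologyClass X n).quotKerEquivOfSurjective (homologyClass_surjective X n)).symm ≪≫ₗ
    Submodule.quotEquivOfEq _ _ (by
      ext x
      rw [LinearMap.mem_ker, LinearMap.mem_ker, homologyClass_eq_zero_iff, h0]) ≪≫ₗ
    θ.quotKerEquivOfSurjective hθ

lemma homologyEquivOfCocycles_homologyClass (X : Cpx R) (n : ℤ) {M : Type*} [AddCommGroup M]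
    [Module R M] (θ : LinearMap.ker (X.d n (n + 1)).hom →ₗ[R] M) (hθ : Function.Surjective θ)
    (h0 : ∀ x, θ x = 0 ↔ ∃ y, (X.d (n - 1) n).hom y = x.1) (x) :
    homologyEquivOfCocycles X n θ hθ h0 (homologyClass X n x) = θ x := by
  have : ((homologyClass X n).quotKerEquivOfSurjective (homologyClass_surjective X n)).symm
      (homologyClass X n x) = Submodule.Quotient.mk x := by
    rw [LinearEquiv.symm_apply_eq]; rfl
  simp only [homologyEquivOfCocycles, LinearEquiv.trans_apply, this]
  rfl

end Homology

section InducedMaps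

variable {R : Type u} [CommRing R]

lemma homologyMap_eq_of_forall {X Y : Cpx R} (f g : X ⟶ Y) (n : ℤ)
    (h : ∀ x : X.X n, (X.d n (n + 1)).hom x = 0 →
      ∃ w, (Y.d (n - 1) n).hom w = (f.f n).hom x - (g.f n).hom x) :
    HomologicalComplex.homologyMap f n = HomologicalComplex.homologyMap g n := by
  ext a
  obtain ⟨x, rfl⟩ := homologyClass_surjective X n a
  rw [homologyMap_homologyClass f n x (d_map_eq_zero f x.2),
    homologyMap_homologyClass g n x (d_map_eq_zero g x.2), ← sub_eq_zero, ← map_sub,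
    homologyClass_eq_zero_iff]
  exact h x.1 x.2

/-- Chain maps that differ by coboundaries on cocycles are simultaneously quasi-isomorphisms. -/
lemma quasiIso_congr {X Y : Cpx R} (f g : X ⟶ Y)
    (h : ∀ (n : ℤ) (x : X.X n), (X.d n (n + 1)).hom x = 0 →
      ∃ w, (Y.d (n - 1) n).hom w = (f.f n).hom x - (g.f n).hom x) :
    QuasiIso f ↔ QuasiIso g := by
  simp only [quasiIso_iff, quasiIsoAt_iff_isIso_homologyMap,
    fun n => homologyMap_eq_of_forall f g n (h n)]

/-- If the homology of `X` and of `Y` in degree `n` is identified with `M` and `N` on the level of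
cocycles, then a chain map which corresponds to `γ : M → N` is a quasi-isomorphism in degree `n` if
and only if `γ` is bijective. -/
lemma quasiIsoAt_iff_bijective {X Y : Cpx R} (f : X ⟶ Y) (n : ℤ) {M N : Type*} [AddCommGroup M]
    [Module R M] [AddCommGroup N] [Module R N]
    (θ : LinearMap.ker (X.d n (n + 1)).hom →ₗ[R] M) (hθ : Function.Surjective θ)
    (h0 : ∀ x, θ x = 0 ↔ ∃ y, (X.d (n - 1) n).hom y = x.1)
    (θ' : LinearMap.ker (Y.d n (n + 1)).hom →ₗ[R] N) (hθ' : Function.Surjective θ')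
    (h0' : ∀ x, θ' x = 0 ↔ ∃ y, (Y.d (n - 1) n).hom y = x.1)
    (γ : M → N) (hγ : ∀ x, γ (θ x) = θ' ⟨(f.f n).hom x.1, d_map_eq_zero f x.2⟩) :
    QuasiIsoAt f n ↔ Function.Bijective γ := by
  rw [quasiIsoAt_iff_isIso_homologyMap, ConcreteCategory.isIso_iff_bijective]
  let e := homologyEquivOfCocycles X n θ hθ h0
  let e' := homologyEquivOfCocycles Y n θ' hθ' h0'
  have key : γ ∘ e = e' ∘ (HomologicalComplex.homologyMap f n) := by
    ext a
    obtain ⟨x, rfl⟩ := homologyClass_surjective X n a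
    simp only [Function.comp_apply, e, e', homologyEquivOfCocycles_homologyClass, hγ,
      homologyMap_homologyClass f n x (d_map_eq_zero f x.2)]
  rw [← Function.Bijective.of_comp_iff' e'.bijective, ← Function.Bijective.of_comp_iff γ e.bijective]
  exact Iff.of_eq (congrArg _ key.symm)

end InducedMaps

/-! ### The Hom complex and the exchange of its arguments -/

section HomComplex

open CochainComplex CochainComplex.HomComplex

variable {R : Type u} [CommRing R]

/-- The chain map `Hom_R(F, G) → Hom_R(F, G')` induced by a chain map `G → G'`. -/
def homCpxPostcomp (F : Cpx R) {G G' : Cpx R} (ψ : G ⟶ G') : homCpx F G ⟶ homCpx F G' where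
  f n := ModuleCat.ofHom
    { toFun := fun z : Cochain F G n => z.comp (Cochain.ofHom ψ) (add_zero n)
      map_add' := fun z w => Cochain.add_comp z w _ _
      map_smul' := fun r z => Cochain.smul_comp r z _ _ }
  comm' i j hij := ModuleCat.hom_ext (LinearMap.ext fun (z : Cochain F G i) =>
    show δ i j (z.comp (Cochain.ofHom ψ) (add_zero i)) =
        (δ i j z).comp (Cochain.ofHom ψ) (add_zero j) by
      have hij' : i + 1 = j := hij
      rw [δ_comp_zero_cochain _ _ _ hij', δ_ofHom, Cochain.comp_zero, zero_add])

lemma homCpxPrecomp_apply {F' F : Cpx R} (φ : F' ⟶ F) (G : Cpx R) (n : ℤ) (z : Cochain F G n) :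
    ((homCpxPrecomp φ G).f n).hom z = (Cochain.ofHom φ).comp z (zero_add n) := rfl

lemma homCpxPrecomp_comp {F'' F' F : Cpx R} (φ : F'' ⟶ F') (ψ : F' ⟶ F) (G : Cpx R) :
    homCpxPrecomp (φ ≫ ψ) G = homCpxPrecomp ψ G ≫ homCpxPrecomp φ G := by
  refine HomologicalComplex.hom_ext _ _ fun n => ModuleCat.hom_ext (LinearMap.ext
    fun (z : Cochain F G n) => ?_)
  change (Cochain.ofHom (φ ≫ ψ)).comp z (zero_add n) =
    (Cochain.ofHom φ).comp ((Cochain.ofHom ψ).comp z (zero_add n)) (zero_add n)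
  rw [Cochain.ofHom_comp, Cochain.comp_assoc_of_first_is_zero_cochain]

/-- Homotopic chain maps induce maps on `Hom_R(-, G)` that agree on cocycles up to
coboundaries. -/
lemma exists_δ_eq_precomp_sub {F' F : Cpx R} {φ ψ : F' ⟶ F} (h : Homotopy φ ψ) {G : Cpx R}
    (n : ℤ) (z : Cochain F G n) (hz : δ n (n + 1) z = 0) :
    ∃ w : Cochain F' G (n - 1), δ (n - 1) n w =
      (Cochain.ofHom φ).comp z (zero_add n) - (Cochain.ofHom ψ).comp z (zero_add n) := by
  obtain ⟨h, hh⟩ := Cochain.equivHomotopy _ _ h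
  refine ⟨n.negOnePow • h.comp z (by lia), ?_⟩
  rw [δ_units_smul, δ_comp h z (by lia) 0 (n + 1) n (by lia) (by lia) (by lia), hz, hh,
    Cochain.add_comp, Cochain.comp_zero, zero_add, smul_smul, Int.units_mul_self, one_smul,
    add_sub_cancel_right]

/-- The chain map `P → Hom_R(T, A)` obtained from `g : T → Hom_R(P, A)` by exchanging the two
arguments (with a sign). With `g` a resolution of `Hom_R(P, A)` this is the biduality morphism of `P`;
all statements on biduality are reduced to the fact that the exchange is an involution. -/
def homSwap {T P A : Cpx R} (g : T ⟶ homCpx P A) : P ⟶ homCpx T A :=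
  bidualityMap P A ≫ homCpxPrecomp g A

lemma homSwap_v {T P A : Cpx R} (g : T ⟶ homCpx P A) (i j k : ℤ) (h : j + i = k) (x : P.X i)
    (t : T.X j) :
    (Cochain.v (((homSwap g).f i).hom x : Cochain T A i) j k h).hom t =
      (i * j).negOnePow • (Cochain.v ((g.f j).hom t : Cochain P A j) i k (by lia)).hom x := by
  let z : Cochain (homCpx P A) A i := ((bidualityMap P A).f i).hom x
  change (Cochain.v ((Cochain.ofHom g).comp z (zero_add i)) j k h).hom t = _
  rw [Cochain.zero_cochain_comp_v, Cochain.ofHom_v]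
  rfl

lemma homSwap_homSwap {T P A : Cpx R} (g : T ⟶ homCpx P A) : homSwap (homSwap g) = g := by
  ext j t
  refine Cochain.ext _ _ fun i k h => ModuleCat.hom_ext (LinearMap.ext fun x => ?_)
  rw [homSwap_v (homSwap g), homSwap_v g, smul_smul, mul_comm j i, Int.units_mul_self, one_smul]

lemma homSwap_comp {T' T P A : Cpx R} (l : T' ⟶ T) (g : T ⟶ homCpx P A) :
    homSwap (l ≫ g) = homSwap g ≫ homCpxPrecomp l A := by
  simp [homSwap, homCpxPrecomp_comp]

lemma quasiIso_homSwap_congr {T P A : Cpx R} {g g' : T ⟶ homCpx P A} (h : Homotopy g g') :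
    QuasiIso (homSwap g) ↔ QuasiIso (homSwap g') := by
  refine quasiIso_congr _ _ fun n x hx => ?_
  exact exists_δ_eq_precomp_sub h n (((bidualityMap P A).f n).hom x)
    (d_map_eq_zero (bidualityMap P A) hx)

end HomComplex

/-! ### The complex `R` and its chain maps -/

section Scalar

open CochainComplex CochainComplex.HomComplex

variable (R : Type u) [CommRing R]

/-- The ring `R` as a complex concentrated in degree `0`. -/
abbrev unitCpx : Cpx R :=
  (HomologicalComplex.single (ModuleCat.{u} R) (ComplexShape.up ℤ) 0).obj (ModuleCat.of R R)

/-- The element `1` of `R`, in degree `0` of the complex `R`. -/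
def unitOne : (unitCpx R).X 0 :=
  (HomologicalComplex.singleObjXSelf (ComplexShape.up ℤ) 0 (ModuleCat.of R R)).inv.hom (1 : R)

variable {R}

lemma exists_smul_unitOne (x : (unitCpx R).X 0) : ∃ r : R, x = r • unitOne R := by
  let e := (HomologicalComplex.singleObjXSelf (ComplexShape.up ℤ) 0 (ModuleCat.of R R))
  refine ⟨e.hom.hom x, ?_⟩
  have h : e.inv.hom (e.hom.hom x) = x := congr($(e.hom_inv_id) x)
  rw [unitOne, ← map_smul, smul_eq_mul, mul_one]
  exact h.symm

lemma scalarMap_smul_unitOne {F G : Cpx R} (φ : F ⟶ G) (r : R) :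
    ((scalarMap φ).f 0).hom (r • unitOne R) = (r • Cochain.ofHom φ : Cochain F G 0) := by
  rw [map_smul]
  congr 1
  have : (scalarMap φ).f 0 =
    (HomologicalComplex.singleObjXSelf (ComplexShape.up ℤ) 0 (ModuleCat.of R R)).hom ≫
      scalarMapZero φ := HomologicalComplex.mkHomFromSingle_f _ _
  rw [this, unitOne, ModuleCat.comp_apply]
  let e := HomologicalComplex.singleObjXSelf (ComplexShape.up ℤ) 0 (ModuleCat.of R R)
  have h : e.hom.hom (e.inv.hom (1 : R)) = (1 : R) :=
    congr(ModuleCat.Hom.hom $(e.inv_hom_id) (1 : R))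
  exact (congrArg (scalarMapZero φ).hom h).trans (one_smul R (Cochain.ofHom φ))

lemma scalarMap_unitOne {F G : Cpx R} (φ : F ⟶ G) :
    ((scalarMap φ).f 0).hom (unitOne R) = (Cochain.ofHom φ : Cochain F G 0) := by
  simpa using scalarMap_smul_unitOne φ 1

lemma isZero_unitCpx_X {n : ℤ} (hn : n ≠ 0) : Limits.IsZero ((unitCpx R).X n) :=
  HomologicalComplex.isZero_single_obj_X _ _ _ _ hn

/-- Chain maps out of the complex `R` are determined by the image of `1`. -/
lemma unitCpx_hom_ext {X : Cpx R} {f g : unitCpx R ⟶ X}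
    (h : (f.f 0).hom (unitOne R) = (g.f 0).hom (unitOne R)) : f = g := by
  refine HomologicalComplex.hom_ext _ _ fun n => ?_
  by_cases hn : n = 0
  · subst hn
    refine ModuleCat.hom_ext (LinearMap.ext fun x => ?_)
    obtain ⟨r, rfl⟩ := exists_smul_unitOne x
    rw [map_smul, map_smul, h]
  · rw [(isZero_unitCpx_X hn).eq_of_src (f.f n) (g.f n)]

/-- Exchanging the arguments of the homothety map `R → Hom_R(P, A)` of `φ` gives `φ` itself, followed by
the isomorphism `A ≅ Hom_R(R, A)`. -/
lemma homSwap_scalarMap {P A : Cpx R} (φ : P ⟶ A) :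
    homSwap (scalarMap φ) = φ ≫ homSwap (scalarMap (𝟙 A)) := by
  ext i x
  refine Cochain.ext _ _ fun j k h => ModuleCat.hom_ext (LinearMap.ext fun t => ?_)
  rw [homSwap_v, HomologicalComplex.comp_f, ModuleCat.comp_apply, homSwap_v]
  congr 1
  by_cases hj : j = 0
  · subst hj
    obtain rfl : i = k := by lia
    obtain ⟨r, rfl⟩ := exists_smul_unitOne t
    rw [scalarMap_smul_unitOne, scalarMap_smul_unitOne]
    simp
  · rw [(ModuleCat.isZero_iff_subsingleton.1 (isZero_unitCpx_X hj)).elim t 0, map_zero, map_zero]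
    rfl

instance isIso_homSwap_scalarMap_id (A : Cpx R) : IsIso (homSwap (scalarMap (𝟙 A))) := by
  have (i : ℤ) : IsIso ((homSwap (scalarMap (𝟙 A))).f i) := by
    have key (x : A.X i) : (Cochain.v (((homSwap (scalarMap (𝟙 A))).f i).hom x :
        Cochain (unitCpx R) A i) 0 i (zero_add i)).hom (unitOne R) = x := by
      rw [homSwap_v, scalarMap_unitOne]
      simp
    rw [ConcreteCategory.isIso_iff_bijective]
    constructor
    · intro x y hxy
      rw [← key x, ← key y]
      exact congr((Cochain.v ($hxy : Cochain (unitCpx R) A i) 0 i (zero_add i)).hom (unitOne R))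
    · intro (z : Cochain (unitCpx R) A i)
      refine ⟨(z.v 0 i (zero_add i)).hom (unitOne R), ?_⟩
      refine Cochain.ext _ _ fun j k h => ModuleCat.hom_ext (LinearMap.ext fun t => ?_)
      by_cases hj : j = 0
      · subst hj
        obtain rfl : i = k := by lia
        obtain ⟨r, rfl⟩ := exists_smul_unitOne t
        rw [map_smul, map_smul]
        congr 1
        exact key _
      · rw [(ModuleCat.isZero_iff_subsingleton.1 (isZero_unitCpx_X hj)).elim t 0]
        simp
  exact HomologicalComplex.Hom.isIso_of_components _

lemma quasiIso_homSwap_scalarMap {P A : Cpx R} (φ : P ⟶ A) [QuasiIso φ] :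
    QuasiIso (homSwap (scalarMap φ)) := by
  rw [homSwap_scalarMap]
  infer_instance

end Scalar

/-! ### Morphisms in the derived category from chain maps -/

section DerivedHom

open CochainComplex CochainComplex.HomComplex DerivedCategory

attribute [local instance] HasDerivedCategory.standard

variable {R : Type u} [CommRing R]

lemma Q_map_eq_iff_of_isKProjective {K L : Cpx R} [K.IsKProjective] (f g : K ⟶ L) :
    Q.map f = Q.map g ↔ Nonempty (Homotopy f g) := by
  constructor
  · intro h
    refine ⟨HomotopyCategory.homotopyOfEq _ _ ((IsKProjective.Qh_map_bijective K _).injective ?_)⟩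
    have h1 := quotientCompQhIso_hom_naturality f
    have h2 := quotientCompQhIso_hom_naturality g
    rw [h, ← h2, cancel_mono] at h1
    exact h1
  · rintro ⟨h⟩
    exact Q_map_eq_of_homotopy _ h

lemma Q_map_surjective_of_isKProjective {K L : Cpx R} [K.IsKProjective]
    (f : Q.obj K ⟶ Q.obj L) : ∃ g : K ⟶ L, Q.map g = f := by
  obtain ⟨g', hg'⟩ := (IsKProjective.Qh_map_bijective K
    ((HomotopyCategory.quotient _ _).obj L)).surjective
      ((quotientCompQhIso _).hom.app K ≫ f ≫ (quotientCompQhIso _).inv.app L)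
  obtain ⟨g, rfl⟩ := (HomotopyCategory.quotient _ _).map_surjective g'
  refine ⟨g, ?_⟩
  have h1 := quotientCompQhIso_hom_naturality g
  rw [hg'] at h1
  simpa using h1.symm

lemma Q_map_eq_iff_of_isKInjective {K L : Cpx R} [L.IsKInjective] (f g : K ⟶ L) :
    Q.map f = Q.map g ↔ Nonempty (Homotopy f g) := by
  constructor
  · intro h
    refine ⟨HomotopyCategory.homotopyOfEq _ _ ((IsKInjective.Qh_map_bijective _ L).injective ?_)⟩
    have h1 := quotientCompQhIso_hom_naturality f
    have h2 := quotientCompQhIso_hom_naturality g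
    rw [h, ← h2, cancel_mono] at h1
    exact h1
  · rintro ⟨h⟩
    exact Q_map_eq_of_homotopy _ h

lemma Q_map_surjective_of_isKInjective {K L : Cpx R} [L.IsKInjective]
    (f : Q.obj K ⟶ Q.obj L) : ∃ g : K ⟶ L, Q.map g = f := by
  obtain ⟨g', hg'⟩ := (IsKInjective.Qh_map_bijective
    ((HomotopyCategory.quotient _ _).obj K) L).surjective
      ((quotientCompQhIso _).hom.app K ≫ f ≫ (quotientCompQhIso _).inv.app L)
  obtain ⟨g, rfl⟩ := (HomotopyCategory.quotient _ _).map_surjective g'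
  refine ⟨g, ?_⟩
  have h1 := quotientCompQhIso_hom_naturality g
  rw [hg'] at h1
  simpa using h1.symm

/-- A cocycle of degree `n` of `Hom_R(F, G)`, as a morphism `F → G⟦n⟧` in `D(R)`. -/
def cocycleToDerived (F G : Cpx R) (n : ℤ) :
    LinearMap.ker ((homCpx F G).d n (n + 1)).hom →ₗ[R] (Q.obj F ⟶ Q.obj (G⟦n⟧)) where
  toFun z := Q.map (Cocycle.equivHomShift.symm (Cocycle.mk z.1 (n + 1) rfl z.2))
  map_add' z w := by
    rw [← Functor.map_add, ← map_add]
    rfl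
  map_smul' r z := by
    rw [RingHom.id_apply, ← Functor.map_smul]
    congr 1

lemma cocycleToDerived_surjective (F G : Cpx R) [F.IsKProjective] (n : ℤ) :
    Function.Surjective (cocycleToDerived F G n) := by
  intro f
  obtain ⟨g, rfl⟩ := Q_map_surjective_of_isKProjective f
  let z := Cocycle.equivHomShift g
  refine ⟨⟨z.1, z.δ_eq_zero (n + 1)⟩, ?_⟩
  change Q.map (Cocycle.equivHomShift.symm z) = _
  simp [z]

lemma cocycleToDerived_eq_zero_iff (F G : Cpx R) [F.IsKProjective] (n : ℤ)
    (z : LinearMap.ker ((homCpx F G).d n (n + 1)).hom) :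
    cocycleToDerived F G n z = 0 ↔ ∃ y, ((homCpx F G).d (n - 1) n).hom y = z.1 := by
  let z' : Cocycle F G n := Cocycle.mk z.1 (n + 1) rfl z.2
  have h := CohomologyClass.toHom_mk_eq_zero_iff z'
  rw [CohomologyClass.toHom_mk, HomotopyCategory.quotient_map_eq_zero_iff,
    ← Q_map_eq_iff_of_isKProjective, Functor.map_zero,
    mem_coboundaries_iff _ (n - 1) (by lia)] at h
  exact h

lemma cocycleToDerived_precomp {F' F : Cpx R} (φ : F' ⟶ F) (G : Cpx R) (n : ℤ)
    (z : LinearMap.ker ((homCpx F G).d n (n + 1)).hom) :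
    cocycleToDerived F' G n ⟨((homCpxPrecomp φ G).f n).hom z.1, d_map_eq_zero _ z.2⟩ =
      Q.map φ ≫ cocycleToDerived F G n z := by
  have h := Cocycle.equivHomShift_symm_precomp
    (Cocycle.mk (z.1 : Cochain F G n) (n + 1) rfl z.2) φ
  exact (congrArg Q.map h).trans (Functor.map_comp _ _ _)

lemma cocycleToDerived_postcomp (F : Cpx R) {G G' : Cpx R} (ψ : G ⟶ G') (n : ℤ)
    (z : LinearMap.ker ((homCpx F G).d n (n + 1)).hom) :
    cocycleToDerived F G' n ⟨((homCpxPostcomp F ψ).f n).hom z.1, d_map_eq_zero _ z.2⟩ =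
      cocycleToDerived F G n z ≫ Q.map (ψ⟦n⟧') := by
  have h := Cocycle.equivHomShift_symm_postcomp
    (Cocycle.mk (z.1 : Cochain F G n) (n + 1) rfl z.2) ψ
  exact (congrArg Q.map h).trans (Functor.map_comp _ _ _)

/-- For a K-projective complex `F`, the homology of `Hom_R(F, G)` is given by the morphisms
`F → G⟦n⟧` in `D(R)`. -/
def homCpxHomologyEquiv (F G : Cpx R) [F.IsKProjective] (n : ℤ) :
    (homCpx F G).homology n ≃ₗ[R] (Q.obj F ⟶ Q.obj (G⟦n⟧)) :=
  homologyEquivOfCocycles _ n _ (cocycleToDerived_surjective F G n)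
    (cocycleToDerived_eq_zero_iff F G n)

/-- For K-projective complexes, `Hom_R(φ, G)` is a quasi-isomorphism if and only if `φ` becomes
invertible after applying the functors `Hom(-, G⟦n⟧)` of `D(R)`. -/
lemma quasiIso_homCpxPrecomp_iff {F' F : Cpx R} [F'.IsKProjective] [F.IsKProjective]
    (φ : F' ⟶ F) (G : Cpx R) :
    QuasiIso (homCpxPrecomp φ G) ↔ ∀ n : ℤ,
      Function.Bijective fun f : Q.obj F ⟶ Q.obj (G⟦n⟧) => Q.map φ ≫ f := by
  rw [quasiIso_iff]
  refine forall_congr' fun n => ?_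
  exact quasiIsoAt_iff_bijective _ n _ (cocycleToDerived_surjective F G n)
    (cocycleToDerived_eq_zero_iff F G n) _ (cocycleToDerived_surjective F' G n)
    (cocycleToDerived_eq_zero_iff F' G n) _ fun z => (cocycleToDerived_precomp φ G n z).symm

lemma quasiIso_homCpxPostcomp (F : Cpx R) [F.IsKProjective] {G G' : Cpx R} (ψ : G ⟶ G')
    [QuasiIso ψ] : QuasiIso (homCpxPostcomp F ψ) := by
  rw [quasiIso_iff]
  intro n
  refine (quasiIsoAt_iff_bijective _ n _ (cocycleToDerived_surjective F G n)
    (cocycleToDerived_eq_zero_iff F G n) _ (cocycleToDerived_surjective F G' n)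
    (cocycleToDerived_eq_zero_iff F G' n) (fun f => f ≫ Q.map (ψ⟦n⟧'))
    fun z => (cocycleToDerived_postcomp F ψ n z).symm).2 ?_
  have : IsIso (Q.map (ψ⟦n⟧')) := by
    have e := (Q.commShiftIso n).hom.naturality ψ
    have : IsIso (Q.map (ψ⟦n⟧') ≫ (Q.commShiftIso n).hom.app G') := by
      erw [e]
      dsimp
      infer_instance
    exact IsIso.of_isIso_comp_right _ ((Q.commShiftIso n).hom.app G')
  exact ⟨fun f g h => (cancel_mono _).1 h, fun f => ⟨f ≫ inv (Q.map (ψ⟦n⟧')), by simp⟩⟩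

instance isKProjective_unitCpx : (unitCpx R).IsKProjective :=
  have (n : ℤ) : Projective ((unitCpx R).X n) := by
    by_cases hn : n = 0
    · subst hn
      have : Projective (ModuleCat.of R R) := inferInstance
      exact Projective.of_iso (HomologicalComplex.singleObjXSelf _ _ _).symm this
    · exact (isZero_unitCpx_X hn).projective
  have : (unitCpx R).IsStrictlyLE 0 := by
    rw [isStrictlyLE_iff]
    intro i hi
    exact isZero_unitCpx_X (by lia)
  isKProjective_of_projective _ 0

end DerivedHom

/-! ### Cohomology modules, triangles and orthogonality in `D(R)` -/

section Orthogonality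

open DerivedCategory Pretriangulated

attribute [local instance] HasDerivedCategory.standard

variable {R : Type u} [CommRing R]

/-- The derived category of `R`-modules. -/
abbrev Der (R : Type u) [CommRing R] := DerivedCategory (ModuleCat.{u} R)

/-- The `i`-th cohomology module of an object of `D(R)`. -/
abbrev coh (i : ℤ) (X : Der R) : ModuleCat.{u} R := (homologyFunctor (ModuleCat.{u} R) i).obj X

lemma coh_map_smul_id (i : ℤ) (X : Der R) (r : R) (h : coh i X) :
    (homologyFunctor (ModuleCat.{u} R) i).map (r • 𝟙 X) h = r • h := by
  have key (K : Cpx R) : (homologyFunctor (ModuleCat.{u} R) i).map (r • 𝟙 (Q.obj K)) = r • 𝟙 _ := by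
    have e := (homologyFunctorFactors (ModuleCat.{u} R) i).hom.naturality (r • 𝟙 K)
    have e1 : (HomologicalComplex.homologyFunctor (ModuleCat R) (ComplexShape.up ℤ) i).map
        (r • 𝟙 K) = r • 𝟙 _ := by
      ext a
      obtain ⟨x, rfl⟩ := homologyClass_surjective K i a
      refine (homologyMap_homologyClass (r • 𝟙 K) i x (d_map_eq_zero _ x.2)).trans ?_
      exact map_smul (homologyClass K i) r x
    dsimp only [Functor.comp_obj, Functor.comp_map] at e
    rw [e1, Functor.map_smul, CategoryTheory.Functor.map_id, Linear.comp_smul, Category.comp_id] at e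
    refine (Iso.cancel_iso_hom_right _ _ ((homologyFunctorFactors (ModuleCat.{u} R) i).app K)).1
      (e.trans ?_)
    rw [Linear.smul_comp, Category.id_comp]
    rfl
  have : (homologyFunctor (ModuleCat.{u} R) i).map (r • 𝟙 X) = r • 𝟙 _ := by
    let φ := Q.objObjPreimageIso X
    have e2 : r • 𝟙 X = φ.inv ≫ (r • 𝟙 _) ≫ φ.hom := by simp
    rw [e2, Functor.map_comp, Functor.map_comp, key]
    simp [← Functor.map_comp]
  rw [this]
  rfl

/-- The ideal of all `r` that annihilate the whole cohomology of `X`. -/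
def annCoh (X : Der R) : Ideal R := ⨅ i, Module.annihilator R (coh i X)

lemma mem_annCoh {X : Der R} {r : R} : r ∈ annCoh X ↔ ∀ i, ∀ h : coh i X, r • h = 0 := by
  simp only [annCoh, Submodule.mem_iInf, Module.mem_annihilator]

/-- `X` has bounded and degreewise finitely generated cohomology. -/
structure FiniteCoh (X : Der R) : Prop where
  ge : ∃ a, X.IsGE a
  le : ∃ b, X.IsLE b
  finite : ∀ i, Module.Finite R (coh i X)

/-- All morphisms from `X` to the shifts of `Y` vanish, that is, `RHom_R(X, Y) = 0`. -/
def Orthogonal (X Y : Der R) : Prop := ∀ (n : ℤ) (f : X ⟶ Y⟦n⟧), f = 0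

section Triangle

variable {T : Triangle (Der R)} (hT : T ∈ distTriang _)

include hT

lemma coh_exact₂ (i : ℤ) (h : coh i T.obj₂)
    (hh : (homologyFunctor _ i).map T.mor₂ h = 0) :
    ∃ k, (homologyFunctor _ i).map T.mor₁ k = h :=
  ((ShortComplex.moduleCat_exact_iff _).1 (HomologySequence.exact₂ T hT i)) h hh

lemma coh_exact₃ (i : ℤ) (h : coh i T.obj₃)
    (hh : HomologySequence.δ T i (i + 1) rfl h = 0) :
    ∃ k, (homologyFunctor _ i).map T.mor₂ k = h :=
  ((ShortComplex.moduleCat_exact_iff _).1 (HomologySequence.exact₃ T hT i (i + 1) rfl)) h hh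

lemma coh_exact₁ (i : ℤ) (h : coh (i + 1) T.obj₁)
    (hh : (homologyFunctor _ (i + 1)).map T.mor₁ h = 0) :
    ∃ k, HomologySequence.δ T i (i + 1) rfl k = h :=
  ((ShortComplex.moduleCat_exact_iff _).1 (HomologySequence.exact₁ T hT i (i + 1) rfl)) h hh

lemma coh_δ_comp (i : ℤ) (h : coh i T.obj₃) :
    (homologyFunctor _ (i + 1)).map T.mor₁ (HomologySequence.δ T i (i + 1) rfl h) = 0 :=
  congr($(HomologySequence.δ_comp T hT i (i + 1) rfl) h)

lemma coh_map_comp (i : ℤ) (h : coh i T.obj₁) :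
    (homologyFunctor _ i).map T.mor₂ ((homologyFunctor _ i).map T.mor₁ h) = 0 := by
  rw [← ModuleCat.comp_apply, ← Functor.map_comp, comp_distTriang_mor_zero₁₂ _ hT,
    Functor.map_zero]
  rfl

lemma coh_obj₃_subsingleton (i : ℤ) (h₂ : Limits.IsZero (coh i T.obj₂))
    (h₁ : Limits.IsZero (coh (i + 1) T.obj₁)) : Limits.IsZero (coh i T.obj₃) := by
  rw [ModuleCat.isZero_iff_subsingleton] at *
  refine ⟨fun a b => ?_⟩
  rw [← sub_eq_zero]
  obtain ⟨k, hk⟩ := coh_exact₃ hT i (a - b) (Subsingleton.elim _ _)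
  rw [← hk, Subsingleton.elim k 0, map_zero]

lemma FiniteCoh.obj₃ [IsNoetherianRing R] (h₁ : FiniteCoh T.obj₁) (h₂ : FiniteCoh T.obj₂) :
    FiniteCoh T.obj₃ := by
  obtain ⟨⟨a₁, ha₁⟩, ⟨b₁, hb₁⟩, hf₁⟩ := h₁
  obtain ⟨⟨a₂, ha₂⟩, ⟨b₂, hb₂⟩, hf₂⟩ := h₂
  refine ⟨⟨min (a₁ - 1) a₂, ?_⟩, ⟨max b₁ b₂, ?_⟩, fun i => ?_⟩
  · rw [isGE_iff]
    intro i hi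
    exact coh_obj₃_subsingleton hT i (isZero_of_isGE _ a₂ i (by lia))
      (isZero_of_isGE _ a₁ (i + 1) (by lia))
  · rw [isLE_iff]
    intro i hi
    exact coh_obj₃_subsingleton hT i (isZero_of_isLE _ b₂ i (by lia))
      (isZero_of_isLE _ b₁ (i + 1) (by lia))
  · have := hf₂ i
    have := hf₁ (i + 1)
    have : IsNoetherian R (coh i T.obj₃) := isNoetherian_of_range_eq_ker
      ((homologyFunctor _ i).map T.mor₂).hom (HomologySequence.δ T i (i + 1) rfl).hom
      (HomologySequence.exact₃ T hT i (i + 1) rfl).moduleCat_range_eq_ker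
    infer_instance

/-- The third object of a triangle is annihilated by the product of annihilators of the other two. -/
lemma mul_mem_annCoh_obj₃ {r s : R} (hr : r ∈ annCoh T.obj₁) (hs : s ∈ annCoh T.obj₂) :
    r * s ∈ annCoh T.obj₃ := by
  rw [mem_annCoh] at *
  intro i h
  obtain ⟨k, hk⟩ := coh_exact₃ hT i (r • h) (by rw [map_smul, hr])
  rw [mul_comm, mul_smul, ← hk, ← map_smul, hs, map_zero]

end Triangle

/-- Orthogonality may be tested on arbitrary shifts of both objects. -/
lemma Orthogonal.eq_zero {X Y : Der R} (h : Orthogonal X Y) (m n : ℤ) (f : X⟦m⟧ ⟶ Y⟦n⟧) :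
    f = 0 := by
  apply (shiftFunctor (Der R) (-m)).map_injective
  rw [Functor.map_zero]
  let e₁ : X⟦m⟧⟦-m⟧ ≅ X := (shiftEquiv (Der R) m).unitIso.symm.app X
  let e₂ : Y⟦n⟧⟦-m⟧ ≅ Y⟦n + -m⟧ := (shiftFunctorAdd (Der R) n (-m)).symm.app Y
  rw [← cancel_epi e₁.inv, ← cancel_mono e₂.hom]
  simpa using h _ (e₁.inv ≫ f⟦-m⟧' ≫ e₂.hom)

lemma Orthogonal.eq_zero_of_shift {X Y : Der R} (h : Orthogonal X Y) (n k : ℤ) (f : X ⟶ Y⟦n⟧⟦k⟧) :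
    f = 0 := by
  rw [← cancel_mono ((shiftFunctorAdd (Der R) n k).symm.app Y).hom, Limits.zero_comp]
  exact h _ _

lemma orthogonal_obj₃_left {T : Triangle (Der R)} (hT : T ∈ distTriang _) {Y : Der R}
    (h₁ : Orthogonal T.obj₁ Y) (h₂ : Orthogonal T.obj₂ Y) : Orthogonal T.obj₃ Y := by
  intro n f
  obtain ⟨g, rfl⟩ := Triangle.yoneda_exact₃ T hT f (h₂ n _)
  rw [h₁.eq_zero 1 n g, Limits.comp_zero]

lemma orthogonal_obj₃_right {T : Triangle (Der R)} (hT : T ∈ distTriang _) {X : Der R}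
    (h₁ : Orthogonal X T.obj₁) (h₂ : Orthogonal X T.obj₂) : Orthogonal X T.obj₃ := by
  intro n f
  obtain ⟨g, hg⟩ := Triangle.coyoneda_exact₃ _ (Triangle.shift_distinguished _ hT n) f
    (h₁.eq_zero_of_shift _ _ _)
  rw [hg, h₂ n g]
  exact Limits.zero_comp

/-- If precomposition with the first morphism of a triangle is bijective on morphisms into all
shifts of `Y`, then the third object is orthogonal to `Y`. -/
lemma orthogonal_obj₃_of_bijective {T : Triangle (Der R)} (hT : T ∈ distTriang _) {Y : Der R}
    (h : ∀ n : ℤ, Function.Bijective fun f : T.obj₂ ⟶ Y⟦n⟧ => T.mor₁ ≫ f) :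
    Orthogonal T.obj₃ Y := by
  intro n f
  obtain ⟨g, rfl⟩ := Triangle.yoneda_exact₃ T hT f ((h n).1 (by
    simp [← Category.assoc, comp_distTriang_mor_zero₁₂ _ hT]))
  -- `g : T.obj₁⟦1⟧ ⟶ Y⟦n⟧` extends over `T.mor₁⟦1⟧'`, so that `T.mor₃ ≫ g = 0`
  obtain ⟨g', hg'⟩ : ∃ g' : T.obj₂⟦(1 : ℤ)⟧ ⟶ Y⟦n⟧, T.mor₁⟦1⟧' ≫ g' = g := by
    let e := (shiftFunctorAdd' (Der R) (n - 1) 1 n (by lia)).app Y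
    obtain ⟨k, hk⟩ := (shiftFunctor (Der R) (1 : ℤ)).map_surjective (g ≫ e.hom)
    obtain ⟨k', hk'⟩ := (h (n - 1)).2 k
    refine ⟨k'⟦1⟧' ≫ e.inv, ?_⟩
    dsimp only at hk'
    rw [← Category.assoc, ← Functor.map_comp, hk', hk]
    simp
  rw [← hg', ← Category.assoc]
  have := comp_distTriang_mor_zero₃₁ _ hT
  rw [this, Limits.zero_comp]

end Orthogonality

/-! ### Dévissage: nilpotent action and finiteness of Hom modules -/

section Devissage

open DerivedCategory Pretriangulated

attribute [local instance] HasDerivedCategory.standard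

variable {R : Type u} [CommRing R]

/-- Dévissage along the truncations: a property of objects of `D(R)` that is stable under
isomorphisms and extensions and holds for shifted modules of a given kind holds for all
cohomologically bounded objects whose cohomology modules are of that kind. -/
theorem devissage (p : Der R → Prop) (q : ModuleCat.{u} R → Prop)
    (p_iso : ∀ {X Y : Der R}, (X ≅ Y) → p X → p Y)
    (p_ext : ∀ T : Triangle (Der R), T ∈ distTriang _ → p T.obj₁ → p T.obj₃ → p T.obj₂)
    (q_iso : ∀ {M N : ModuleCat.{u} R}, (M ≅ N) → q M → q N)
    (q_zero : ∀ M : ModuleCat.{u} R, Limits.IsZero M → q M)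
    (h : ∀ (M : ModuleCat.{u} R) (n : ℤ), q M → p ((singleFunctor _ n).obj M))
    (X : Der R) (a b : ℤ) (ha : X.IsGE a) (hb : X.IsLE b) (hX : ∀ i, q (coh i X)) : p X := by
  have single (Y : Der R) (c : ℤ) (h₁ : Y.IsGE c) (h₂ : Y.IsLE c) (hY : q (coh c Y)) : p Y := by
    obtain ⟨M, ⟨e⟩⟩ := exists_iso_singleFunctor_obj_of_isGE_of_isLE Y c
    refine p_iso e.symm (h M c (q_iso ?_ hY))
    exact (homologyFunctor _ c).mapIso e ≪≫ (singleFunctorCompHomologyFunctorIso _ c).app M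
  -- Induction on the length `n` of an interval `[a, a + n]` containing all non-zero cohomology: the
  -- truncation triangle splits off the cohomology in the top degree.
  obtain ⟨n, hn⟩ : ∃ n : ℕ, b ≤ a + n := ⟨(b - a).toNat, by lia⟩
  replace hb : X.IsLE (a + n) := TStructure.t.isLE_of_le X b _ hn
  clear hn
  induction n generalizing X with
  | zero => exact single X a ha (by simpa using hb) (hX a)
  | succ n ih =>
    obtain ⟨Y, Z, hY, hZ, f, g, k, hT⟩ := TStructure.t.exists_triangle X (a + n) (a + n + 1) rfl
    have hY : Y.IsLE (a + n) := ⟨hY⟩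
    have hZ : Z.IsGE (a + n + 1) := ⟨hZ⟩
    have iso₁ (i : ℤ) (hi : i ≤ a + n) : IsIso ((homologyFunctor (ModuleCat R) i).map f) := by
      have : Mono ((homologyFunctor (ModuleCat R) i).map f) :=
        (HomologySequence.mono_homologyMap_mor₁_iff _ hT (i - 1) i (by lia)).2
          ((isZero_of_isGE Z (a + n + 1) (i - 1) (by lia)).eq_of_src _ _)
      have : Epi ((homologyFunctor (ModuleCat R) i).map f) :=
        (HomologySequence.epi_homologyMap_mor₁_iff _ hT i).2
          ((isZero_of_isGE Z (a + n + 1) i (by lia)).eq_of_tgt _ _)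
      exact isIso_of_mono_of_epi _
    have iso₂ (i : ℤ) (hi : a + n < i) : IsIso ((homologyFunctor (ModuleCat R) i).map g) := by
      have : Mono ((homologyFunctor (ModuleCat R) i).map g) :=
        (HomologySequence.mono_homologyMap_mor₂_iff _ hT i).2
          ((isZero_of_isLE Y (a + n) i (by lia)).eq_of_src _ _)
      have : Epi ((homologyFunctor (ModuleCat R) i).map g) :=
        (HomologySequence.epi_homologyMap_mor₂_iff _ hT i (i + 1)).2
          ((isZero_of_isLE Y (a + n) (i + 1) (by lia)).eq_of_tgt _ _)
      exact isIso_of_mono_of_epi _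
    refine p_ext _ hT (ih Y ?_ (fun i => ?_) hY) (single Z (a + n + 1) hZ ?_ ?_)
    · rw [isGE_iff]
      intro i hi
      have := iso₁ i (by lia)
      exact (isZero_of_isGE X a i hi).of_iso (asIso ((homologyFunctor (ModuleCat R) i).map f))
    · by_cases hi : i ≤ a + n
      · have := iso₁ i hi
        exact q_iso (asIso ((homologyFunctor (ModuleCat R) i).map f)).symm (hX i)
      · exact q_zero _ (isZero_of_isLE Y (a + n) i (by lia))
    · rw [isLE_iff]
      intro i hi
      have := iso₂ i (by lia)
      exact (isZero_of_isLE X (a + (n + 1 : ℕ)) i (by push_cast; lia)).of_iso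
        (asIso ((homologyFunctor (ModuleCat R) i).map g)).symm
    · have := iso₂ (a + n + 1) (by lia)
      exact q_iso (asIso ((homologyFunctor (ModuleCat R) (a + n + 1)).map g)) (hX _)

lemma mul_smul_id_obj₂_eq_zero {T : Triangle (Der R)} (hT : T ∈ distTriang _) {r s : R}
    (hr : r • 𝟙 T.obj₁ = 0) (hs : s • 𝟙 T.obj₃ = 0) : (r * s) • 𝟙 T.obj₂ = 0 := by
  obtain ⟨g, hg⟩ := Triangle.coyoneda_exact₂ T hT (s • 𝟙 T.obj₂) (by
    rw [Linear.smul_comp, Category.id_comp, ← Category.comp_id T.mor₂, ← Linear.comp_smul, hs,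
      Limits.comp_zero])
  rw [mul_smul, hg, ← Linear.comp_smul, ← Category.id_comp T.mor₁, ← Linear.smul_comp, hr,
    Limits.zero_comp, Limits.comp_zero]

lemma smul_id_eq_zero_of_iso {X Y : Der R}
    (e : X ≅ Y) {r : R} (h : r • 𝟙 X = 0) : r • 𝟙 Y = 0 := by
  have : r • 𝟙 Y = e.inv ≫ (r • 𝟙 X) ≫ e.hom := by simp
  rw [this, h, Limits.zero_comp, Limits.comp_zero]

/-- An element that annihilates the cohomology of a bounded object acts nilpotently on it. -/
theorem exists_pow_smul_id_eq_zero {X : Der R} (ha : ∃ a, X.IsGE a) (hb : ∃ b, X.IsLE b) {r : R}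
    (hr : r ∈ annCoh X) : ∃ n : ℕ, r ^ n • 𝟙 X = 0 := by
  obtain ⟨a, ha⟩ := ha
  obtain ⟨b, hb⟩ := hb
  refine devissage (fun X => ∃ n : ℕ, r ^ n • 𝟙 X = 0) (fun M => r • 𝟙 M = 0) ?_ ?_ ?_ ?_ ?_ X a b
    ha hb ?_
  · rintro X Y e ⟨n, hn⟩
    exact ⟨n, smul_id_eq_zero_of_iso e hn⟩
  · rintro T hT ⟨m, hm⟩ ⟨n, hn⟩
    exact ⟨m + n, by rw [pow_add, mul_smul_id_obj₂_eq_zero hT hm hn]⟩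
  · intro M N e h
    have : r • 𝟙 N = e.inv ≫ (r • 𝟙 M) ≫ e.hom := by simp
    rw [this, h, Limits.zero_comp, Limits.comp_zero]
  · intro M hM
    exact hM.eq_of_src _ _
  · intro M n hM
    refine ⟨1, ?_⟩
    rw [pow_one, ← CategoryTheory.Functor.map_id, ← Functor.map_smul, hM, Functor.map_zero]
  · intro i
    ext h
    exact mem_annCoh.1 hr i h

/-- All modules of morphisms between shifts of `X` and `Y` are finitely generated. -/
def FiniteHoms (X Y : Der R) : Prop := ∀ m n : ℤ, Module.Finite R (X⟦m⟧ ⟶ Y⟦n⟧)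

section

variable [IsNoetherianRing R]

lemma finite_hom_of_iso {X X' Y Y' : Der R} (e : X ≅ X') (e' : Y ≅ Y')
    (h : Module.Finite R (X ⟶ Y)) : Module.Finite R (X' ⟶ Y') := by
  refine Module.Finite.of_injective
    ((Linear.leftComp R Y e.hom).comp (Linear.rightComp R X' e'.inv)) fun f g h => ?_
  simpa using h

lemma FiniteHoms.of_iso {X X' Y Y' : Der R} (e : X ≅ X') (e' : Y ≅ Y') (h : FiniteHoms X Y) :
    FiniteHoms X' Y' := fun m n =>
  finite_hom_of_iso ((shiftFunctor _ m).mapIso e) ((shiftFunctor _ n).mapIso e') (h m n)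

lemma FiniteHoms.shift {X Y : Der R} (h : FiniteHoms X Y) (k l : ℤ) :
    FiniteHoms (X⟦k⟧) (Y⟦l⟧) := fun m n =>
  finite_hom_of_iso ((shiftFunctorAdd _ k m).app X) ((shiftFunctorAdd _ l n).app Y)
    (h (k + m) (l + n))

lemma FiniteHoms.of_forall {X Y : Der R} (h : ∀ n : ℤ, Module.Finite R (X ⟶ Y⟦n⟧)) :
    FiniteHoms X Y := by
  intro m n
  have : Module.Finite R (X⟦m⟧⟦-m⟧ ⟶ Y⟦n⟧⟦-m⟧) :=
    finite_hom_of_iso ((shiftEquiv (Der R) m).unitIso.app X)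
      ((shiftFunctorAdd (Der R) n (-m)).app Y) (h (n + -m))
  exact Module.Finite.of_injective (Functor.mapLinearMap R (shiftFunctor (Der R) (-m)))
    (shiftFunctor (Der R) (-m)).map_injective

lemma finite_hom_obj₂_left {T : Triangle (Der R)} (hT : T ∈ distTriang _) {Z : Der R}
    (h₁ : Module.Finite R (T.obj₁ ⟶ Z)) (h₃ : Module.Finite R (T.obj₃ ⟶ Z)) :
    Module.Finite R (T.obj₂ ⟶ Z) := by
  have : IsNoetherian R (T.obj₂ ⟶ Z) := isNoetherian_of_range_eq_ker
    (Linear.leftComp R Z T.mor₂) (Linear.leftComp R Z T.mor₁) (by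
      ext f
      constructor
      · rintro ⟨g, rfl⟩
        change T.mor₁ ≫ T.mor₂ ≫ g = 0
        rw [← Category.assoc, comp_distTriang_mor_zero₁₂ _ hT, Limits.zero_comp]
      · intro hf
        obtain ⟨g, hg⟩ := Triangle.yoneda_exact₂ _ hT f hf
        exact ⟨g, hg.symm⟩)
  infer_instance

lemma finite_hom_obj₂_right {T : Triangle (Der R)} (hT : T ∈ distTriang _) {Z : Der R}
    (h₁ : Module.Finite R (Z ⟶ T.obj₁)) (h₃ : Module.Finite R (Z ⟶ T.obj₃)) :
    Module.Finite R (Z ⟶ T.obj₂) := by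
  have : IsNoetherian R (Z ⟶ T.obj₂) := isNoetherian_of_range_eq_ker
    (Linear.rightComp R Z T.mor₁) (Linear.rightComp R Z T.mor₂) (by
      ext f
      constructor
      · rintro ⟨g, rfl⟩
        change (g ≫ T.mor₁) ≫ T.mor₂ = 0
        rw [Category.assoc, comp_distTriang_mor_zero₁₂ _ hT, Limits.comp_zero]
      · intro hf
        obtain ⟨g, hg⟩ := Triangle.coyoneda_exact₂ _ hT f hf
        exact ⟨g, hg.symm⟩)
  infer_instance

lemma FiniteHoms.obj₂_left {T : Triangle (Der R)} (hT : T ∈ distTriang _) {Y : Der R}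
    (h₁ : FiniteHoms T.obj₁ Y) (h₃ : FiniteHoms T.obj₃ Y) : FiniteHoms T.obj₂ Y := fun m n =>
  finite_hom_obj₂_left (Triangle.shift_distinguished _ hT m) (h₁ m n) (h₃ m n)

lemma FiniteHoms.obj₂_right {T : Triangle (Der R)} (hT : T ∈ distTriang _) {X : Der R}
    (h₁ : FiniteHoms X T.obj₁) (h₃ : FiniteHoms X T.obj₃) : FiniteHoms X T.obj₂ := fun m n =>
  finite_hom_obj₂_right (Triangle.shift_distinguished _ hT n) (h₁ m n) (h₃ m n)

lemma finiteHoms_single (M N : ModuleCat.{u} R) (hM : Module.Finite R M) (hN : Module.Finite R N)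
    (k l : ℤ) : FiniteHoms ((singleFunctor _ k).obj M) ((singleFunctor _ l).obj N) := by
  -- In non-negative degrees the morphisms form `Ext` modules, in negative degrees they vanish by the
  -- `t`-structure.
  have h0 : FiniteHoms ((singleFunctor _ 0).obj M) ((singleFunctor _ 0).obj N) := by
    refine .of_forall fun n => ?_
    obtain ⟨i, rfl⟩ | hn : (∃ i : ℕ, n = i) ∨ n < 0 := by
      by_cases h : n < 0
      · exact .inr h
      · exact .inl ⟨n.toNat, by lia⟩
    · exact Module.Finite.equiv (Abelian.Ext.homLinearEquiv (R := R) (X := M) (Y := N) (n := i))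
    · have : Subsingleton
          ((singleFunctor _ 0).obj M ⟶ ((singleFunctor (ModuleCat R) 0).obj N)⟦n⟧) := by
        refine ⟨fun f g => ?_⟩
        have := TStructure.t.isGE_shift ((singleFunctor (ModuleCat R) 0).obj N) 0 n (-n)
        rw [TStructure.t.zero f 0 (-n), TStructure.t.zero g 0 (-n)]
      infer_instance
  exact (h0.shift (-k) (-l)).of_iso
    (((singleFunctors (ModuleCat R)).shiftIso (-k) k 0 (by lia)).app M)
    (((singleFunctors (ModuleCat R)).shiftIso (-l) l 0 (by lia)).app N)

/-- `RHom_R(X, Y)` has degreewise finitely generated homology if `X` and `Y` are homologically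
finite. -/
theorem FiniteCoh.finiteHoms {X Y : Der R} (hX : FiniteCoh X) (hY : FiniteCoh Y) :
    FiniteHoms X Y := by
  have q_zero (M : ModuleCat.{u} R) (hM : Limits.IsZero M) : Module.Finite R M :=
    have := ModuleCat.isZero_iff_subsingleton.1 hM
    inferInstance
  obtain ⟨⟨a, ha⟩, ⟨b, hb⟩, hX⟩ := hX
  obtain ⟨⟨c, hc⟩, ⟨d, hd⟩, hY⟩ := hY
  refine devissage (fun X => FiniteHoms X Y) (fun M => Module.Finite R M)
    (fun e h => h.of_iso e (Iso.refl _)) (fun T hT h₁ h₃ => .obj₂_left hT h₁ h₃)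
    (fun e h => .equiv e.toLinearEquiv) q_zero (fun M m hM => ?_) X a b ha hb hX
  exact devissage (fun Y => FiniteHoms _ Y) (fun M => Module.Finite R M)
    (fun e h => h.of_iso (Iso.refl _) e) (fun T hT h₁ h₃ => .obj₂_right hT h₁ h₃)
    (fun e h => .equiv e.toLinearEquiv) q_zero (fun N n hN => finiteHoms_single M N hM hN m n)
    Y c d hc hd hY

end

end Devissage

/-! ### Orthogonal homologically finite objects have disjoint supports -/

section Koszul

open DerivedCategory Pretriangulated

attribute [local instance] HasDerivedCategory.standard

variable {R : Type u} [CommRing R]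

/-- Nakayama's lemma at a maximal ideal: if `u M ⊆ x M` with `u ∉ m` and `x ∈ m`, then `M`
vanishes at `m`. -/
lemma exists_notMem_smul_eq_zero {M : Type*} [AddCommGroup M] [Module R M] [Module.Finite R M]
    {m : Ideal R} [hm : m.IsMaximal] {u x : R} (hu : u ∉ m) (hx : x ∈ m)
    (h : ∀ k : M, ∃ k' : M, x • k' = u • k) : ∃ r ∉ m, ∀ k : M, r • k = 0 := by
  obtain ⟨v, hv⟩ := hm.exists_inv hu
  obtain ⟨y, hy, e⟩ := hv
  obtain ⟨r, hr, hrk⟩ := Submodule.exists_sub_one_mem_and_smul_eq_zero_of_fg_of_le_smul m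
    (⊤ : Submodule R M) Module.Finite.fg_top (by
      intro k _
      obtain ⟨k', hk'⟩ := h k
      have : k = x • (v • k') + y • k := by
        rw [smul_comm, hk', smul_smul, ← add_smul, e, one_smul]
      rw [this]
      exact add_mem (Submodule.smul_mem_smul hx trivial) (Submodule.smul_mem_smul hy trivial))
  refine ⟨r, fun h => ?_, fun k => hrk k trivial⟩
  exact hm.ne_top ((Ideal.eq_top_iff_one _).2 (by simpa using sub_mem h hr))

/-- For a maximal ideal `m` in the support of `X` there is an iterated cone of
`X` (the derived tensor product with a Koszul complex) which still has `m` in its support, but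
whose cohomology is annihilated by powers of the given elements of `m`. -/
lemma exists_koszul [IsNoetherianRing R] (m : Ideal R) [m.IsMaximal] (s : Finset R) :
    (∀ x ∈ s, x ∈ m) → ∀ X : Der R, FiniteCoh X → annCoh X ≤ m → ∃ X' : Der R, FiniteCoh X' ∧
      annCoh X' ≤ m ∧ (∀ x ∈ s, x ∈ (annCoh X').radical) ∧
      (∀ Y, Orthogonal X Y → Orthogonal X' Y) ∧ ∀ Y, Orthogonal Y X → Orthogonal Y X' := by
  classical
  induction s using Finset.induction_on with
  | empty => exact fun _ X h₁ h₂ => ⟨X, h₁, h₂, by simp, fun _ h => h, fun _ h => h⟩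
  | insert x s _ ih =>
    intro hs X h₁ h₂
    obtain ⟨X₁, h₁, h₂, h₃, h₄, h₅⟩ := ih (fun y hy => hs y (Finset.mem_insert_of_mem hy)) X h₁ h₂
    obtain ⟨X₂, f, g, hT⟩ := distinguished_cocone_triangle (x • 𝟙 X₁)
    have hx : x ∈ m := hs x (Finset.mem_insert_self _ _)
    refine ⟨X₂, h₁.obj₃ hT h₁, ?_, ?_, fun Y hY => orthogonal_obj₃_left hT (h₄ Y hY) (h₄ Y hY),
      fun Y hY => orthogonal_obj₃_right hT (h₅ Y hY) (h₅ Y hY)⟩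
    -- If `u` outside of `m` annihilates the cohomology of the cone, then `u H^i(X₁) ⊆ x H^i(X₁)`, so
    -- that by Nakayama's lemma each of the finitely many modules `H^i(X₁)` vanishes at `m`.
    · intro u hu
      by_contra hum
      rw [mem_annCoh] at hu
      have key (i : ℤ) : ∃ r ∉ m, ∀ k : coh i X₁, r • k = 0 := by
        have := h₁.finite i
        refine exists_notMem_smul_eq_zero hum hx fun k => ?_
        obtain ⟨k', hk'⟩ := coh_exact₂ hT i (u • k)
          ((map_smul ((homologyFunctor _ i).map f).hom u k).trans (hu i _))
        exact ⟨k', (coh_map_smul_id i X₁ x k').symm.trans hk'⟩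
      choose r hr hrk using key
      obtain ⟨a, ha⟩ := h₁.ge
      obtain ⟨b, hb⟩ := h₁.le
      have hprod : ∏ i ∈ Finset.Icc a b, r i ∈ annCoh X₁ := by
        rw [mem_annCoh]
        intro i k
        by_cases hi : i ∈ Finset.Icc a b
        · rw [← Finset.prod_erase_mul _ _ hi, mul_smul, hrk, smul_zero]
        · have : Subsingleton (coh i X₁) := by
            rw [← ModuleCat.isZero_iff_subsingleton]
            rw [Finset.mem_Icc, not_and_or, not_le, not_le] at hi
            rcases hi with hi | hi
            · exact isZero_of_isGE _ a i hi
            · exact isZero_of_isLE _ b i hi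
          exact Subsingleton.elim _ _
      obtain ⟨i, _, hi⟩ := (Ideal.IsMaximal.isPrime ‹_›).prod_mem_iff.1 (h₂ hprod)
      exact hr i hi
    · intro y hy
      rw [Finset.mem_insert] at hy
      rcases hy with rfl | hy
      · -- `y` annihilates both the kernel and the cokernel of multiplication by `y`
        refine ⟨2, ?_⟩
        rw [mem_annCoh]
        intro i h
        let δ := HomologySequence.δ (Triangle.mk (y • 𝟙 X₁) f g) i (i + 1) rfl
        obtain ⟨k, hk⟩ := coh_exact₃ hT i (y • h)
          ((map_smul δ.hom y h).trans ((coh_map_smul_id (i + 1) X₁ y (δ h)).symm.trans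
            (coh_δ_comp hT i h)))
        rw [pow_two, mul_smul, ← hk]
        exact (map_smul ((homologyFunctor _ i).map f).hom y k).symm.trans
          ((congrArg _ (coh_map_smul_id i X₁ y k).symm).trans (coh_map_comp hT i k))
      · obtain ⟨n, hn⟩ := h₃ y hy
        exact ⟨n + n, by rw [pow_add]; exact mul_mem_annCoh_obj₃ hT hn hn⟩

/-- A map between the highest cohomology of `X` and the lowest cohomology of `Y`, if these live
in the same degree, is induced by a morphism in `D(R)`. -/
lemma exists_hom_map_eq {X Y : Der R} (n : ℤ) [X.IsLE n] [Y.IsGE n] (g : coh n X ⟶ coh n Y) :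
    ∃ f : X ⟶ Y, (homologyFunctor _ n).map f = g := by
  obtain ⟨K, _, ⟨e⟩⟩ := exists_iso_Q_obj_of_isLE X n
  obtain ⟨L, _, ⟨e'⟩⟩ := exists_iso_Q_obj_of_isGE Y n
  let H := homologyFunctor (ModuleCat.{u} R) n
  let φ := homologyFunctorFactors (ModuleCat.{u} R) n
  let α : coh n X ≅ K.homology n := H.mapIso e ≪≫ φ.app K
  let β : coh n Y ≅ L.homology n := H.mapIso e' ≪≫ φ.app L
  let g' : K.homology n ⟶ L.homology n := α.inv ≫ g ≫ β.hom
  have hKd (j : ℤ) (hj : n + 1 = j) : K.d n j = 0 :=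
    (K.isZero_of_isStrictlyLE n j (by lia)).eq_of_tgt _ _
  have hLd (j : ℤ) (hj : j + 1 = n) : L.d j n = 0 :=
    (L.isZero_of_isStrictlyGE n j (by lia)).eq_of_src _ _
  have i₁ : IsIso (K.homologyι n) := K.isIso_homologyι n (n + 1) (by simp) (hKd _ rfl)
  have i₂ : IsIso (L.homologyπ n) := L.isIso_homologyπ (n - 1) n (by simp) (hLd _ (by lia))
  -- For representatives with `K` concentrated in degrees `≤ n` and `L` in degrees `≥ n`, the map `g`
  -- lifts to a chain map which is non-zero only in degree `n`.
  let f₀ : K.X n ⟶ L.X n :=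
    K.pOpcycles n ≫ inv (K.homologyι n) ≫ g' ≫ inv (L.homologyπ n) ≫ L.iCycles n
  let F : K ⟶ L :=
    { f i := if h : i = n then eqToHom (by rw [h]) ≫ f₀ ≫ eqToHom (by rw [h]) else 0
      comm' i j hij := by
        have hij : i + 1 = j := hij
        by_cases hi : i = n
        · subst hi
          rw [dif_pos rfl, dif_neg (by lia), Limits.comp_zero]
          simp [f₀]
        · by_cases hj : j = n
          · subst hj
            rw [dif_neg hi, dif_pos rfl, Limits.zero_comp]
            simp [f₀]
          · rw [dif_neg hi, dif_neg hj, Limits.zero_comp, Limits.comp_zero] }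
  have hF : F.f n = f₀ := by simp [F]
  have hc : HomologicalComplex.cyclesMap F n = K.homologyπ n ≫ g' ≫ inv (L.homologyπ n) := by
    rw [← cancel_mono (L.iCycles n), HomologicalComplex.cyclesMap_i, hF]
    simp only [f₀, Category.assoc]
    rw [← HomologicalComplex.homology_π_ι_assoc, IsIso.hom_inv_id_assoc]
  have hH : HomologicalComplex.homologyMap F n = g' := by
    rw [← cancel_epi (K.homologyπ n), HomologicalComplex.homologyπ_naturality, hc]
    simp
  refine ⟨e.hom ≫ Q.map F ≫ e'.inv, ?_⟩
  have hnat : H.map (e.hom ≫ Q.map F ≫ e'.inv) ≫ β.hom =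
      α.hom ≫ HomologicalComplex.homologyMap F n := by
    have h₁ : H.map (e.hom ≫ Q.map F ≫ e'.inv) ≫ H.map e'.hom =
        H.map e.hom ≫ H.map (Q.map F) := by
      simp [← Functor.map_comp]
    exact (Category.assoc _ _ _).symm.trans ((congrArg (· ≫ (φ.app L).hom) h₁).trans
      ((Category.assoc _ _ _).trans ((congrArg (H.map e.hom ≫ ·) (φ.hom.naturality F)).trans
        (Category.assoc _ _ _).symm)))
  rw [← cancel_mono β.hom]
  refine hnat.trans ?_
  rw [hH]
  exact Iso.hom_inv_id_assoc _ _

/-- Modules over a noetherian ring, the first of them finitely generated, both non-zero and both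
supported only at the maximal ideal `m`, admit a non-zero map, which factors through `R ⧸ m`. -/
lemma exists_hom_ne_zero [IsNoetherianRing R] {m : Ideal R} {M N : Type u}
    [AddCommGroup M] [Module R M] [AddCommGroup N] [Module R N] [Module.Finite R M]
    [Nontrivial M] [Nontrivial N] [hm : m.IsMaximal]
    (hM : m ≤ (Module.annihilator R M).radical) (hN : m ≤ (Module.annihilator R N).radical) :
    ∃ f : M →ₗ[R] N, f ≠ 0 := by
  -- A simple quotient of `M` and a simple submodule of `N` are both isomorphic to `R ⧸ m`.
  obtain ⟨M', hM'⟩ : ∃ M' : Submodule R M, IsCoatom M' := by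
    obtain ⟨M', h, -⟩ := (eq_top_or_exists_le_coatom (⊥ : Submodule R M)).resolve_left bot_ne_top
    exact ⟨M', h⟩
  have hs : IsSimpleModule R (M ⧸ M') := isSimpleModule_iff_isCoatom.2 hM'
  obtain ⟨I, hI, ⟨e⟩⟩ := isSimpleModule_iff_quot_maximal.1 hs
  have hIm : m = I := by
    refine hm.eq_of_le hI.ne_top (hM.trans (hI.isPrime.radical_le_iff.2 fun r hr => ?_))
    rw [← Ideal.Quotient.eq_zero_iff_mem]
    obtain ⟨x, hx⟩ := e.surjective (Ideal.Quotient.mk I 1)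
    obtain ⟨x, rfl⟩ := M'.mkQ_surjective x
    have : e (M'.mkQ (r • x)) = Ideal.Quotient.mk I r := by
      rw [map_smul, map_smul, hx]
      change Ideal.Quotient.mk I (r * 1) = _
      rw [mul_one]
    rw [← this, Module.mem_annihilator.1 hr, map_zero, map_zero]
  subst hIm
  obtain ⟨p, hp⟩ := associatedPrimes.nonempty R N
  obtain ⟨hp, y, hy⟩ := (isAssociatedPrime_iff).1 hp
  have hpm : m ≤ p := hN.trans (hp.radical_le_iff.2 fun r hr => by
    rw [hy]
    simp [Module.mem_annihilator.1 hr])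
  have hpm := hm.eq_of_le hp.ne_top hpm
  have hy' (r : R) : r ∈ m ↔ r • y = 0 := by
    rw [hpm, hy]
    simp
  refine ⟨(Submodule.liftQ m (LinearMap.toSpanSingleton R N y) fun r hr => ?_) ∘ₗ
    e.toLinearMap ∘ₗ M'.mkQ, fun h => ?_⟩
  · exact (hy' r).1 hr
  · obtain ⟨x, hx⟩ := e.surjective (Ideal.Quotient.mk m 1)
    obtain ⟨x, rfl⟩ := M'.mkQ_surjective x
    have := LinearMap.congr_fun h x
    simp only [LinearMap.comp_apply, LinearEquiv.coe_coe, hx, LinearMap.zero_apply] at this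
    have h1 : (1 : R) • y = 0 := this
    rw [← hy'] at h1
    exact hm.ne_top ((Ideal.eq_top_iff_one _).2 h1)

/-- Two homologically finite objects with `RHom_R(X, Y) = 0` have disjoint supports: their
annihilators are comaximal. At a common maximal ideal `m` of the supports, `X` and `Y` may be replaced
by Koszul cones with cohomology supported at `m` only; then a non-zero map from the highest
cohomology of `X` to the lowest cohomology of `Y` comes from a non-zero morphism of `D(R)`. -/
theorem Orthogonal.annCoh_sup_eq_top [IsNoetherianRing R] {X Y : Der R} (h : Orthogonal X Y)
    (hX : FiniteCoh X) (hY : FiniteCoh Y) : annCoh X ⊔ annCoh Y = ⊤ := by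
  by_contra hne
  obtain ⟨m, hm, hle⟩ := Ideal.exists_le_maximal _ hne
  obtain ⟨s, hs⟩ := IsNoetherian.noetherian m
  have hsm : ∀ x ∈ s, x ∈ m := fun x hx => hs ▸ Submodule.subset_span hx
  have radical_le (Z : Der R) (hZ : ∀ x ∈ s, x ∈ (annCoh Z).radical) (i : ℤ) :
      m ≤ (Module.annihilator R (coh i Z)).radical := by
    rw [← hs, Submodule.span_le]
    exact fun x hx => Ideal.radical_mono (iInf_le _ i) (hZ x hx)
  obtain ⟨X', hX', hXm, hXs, hX₁, -⟩ := exists_koszul m s hsm X hX (le_sup_left.trans hle)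
  obtain ⟨Y', hY', hYm, hYs, -, hY₂⟩ := exists_koszul m s hsm Y hY (le_sup_right.trans hle)
  have h' : Orthogonal X' Y' := hY₂ _ (hX₁ _ h)
  obtain ⟨a, ha⟩ := hX'.le
  obtain ⟨b, hb⟩ := hY'.ge
  have top_notin (Z : Der R) (hZ : annCoh Z ≤ m) : ∃ i, ¬ Limits.IsZero (coh i Z) := by
    by_contra! h0
    refine hm.ne_top (top_le_iff.1 (le_trans (fun r _ => mem_annCoh.2 fun i x => ?_) hZ))
    have := ModuleCat.isZero_iff_subsingleton.1 (h0 i)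
    exact Subsingleton.elim _ _
  obtain ⟨s, hs₀, hs₁⟩ := Int.exists_greatest_of_bdd (P := fun i => ¬ Limits.IsZero (coh i X'))
    ⟨a, fun i hi => by
      by_contra hia
      exact hi (isZero_of_isLE X' a i (by lia))⟩ (top_notin X' hXm)
  obtain ⟨t, ht₀, ht₁⟩ := Int.exists_least_of_bdd (P := fun i => ¬ Limits.IsZero (coh i Y'))
    ⟨b, fun i hi => by
      by_contra hia
      exact hi (isZero_of_isGE Y' b i (by lia))⟩ (top_notin Y' hYm)
  have : X'.IsLE s := by
    rw [isLE_iff]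
    intro i hi
    by_contra h0
    exact absurd (hs₁ i h0) (by lia)
  have hYt : Y'.IsGE t := by
    rw [isGE_iff]
    intro i hi
    by_contra h0
    exact absurd (ht₁ i h0) (by lia)
  have : (Y'⟦t - s⟧).IsGE s := TStructure.t.isGE_shift Y' t (t - s) s
  let e : coh s (Y'⟦t - s⟧) ≅ coh t Y' :=
    ((homologyFunctor (ModuleCat.{u} R) 0).shiftIso (t - s) s t (by lia)).app Y'
  have := hX'.finite s
  have : Nontrivial (coh s X') := not_subsingleton_iff_nontrivial.1
    fun h => hs₀ (ModuleCat.isZero_iff_subsingleton.2 h)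
  have : Nontrivial (coh t Y') := not_subsingleton_iff_nontrivial.1
    fun h => ht₀ (ModuleCat.isZero_iff_subsingleton.2 h)
  obtain ⟨g, hg⟩ := exists_hom_ne_zero (m := m) (radical_le X' hXs s) (radical_le Y' hYs t)
  obtain ⟨f, hf⟩ := exists_hom_map_eq s (ModuleCat.ofHom g ≫ e.inv)
  rw [h' _ f, Functor.map_zero] at hf
  have h0 := congrArg (· ≫ e.hom) hf
  simp only [Limits.zero_comp, Category.assoc, Iso.inv_hom_id, Category.comp_id] at h0
  exact hg (congrArg ModuleCat.Hom.hom h0.symm)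

end Koszul

/-! ### The cohomology of `RHom_R(A, B)` and the homothety morphism -/

section CohomologyOfComplexes

open CochainComplex CochainComplex.HomComplex DerivedCategory Pretriangulated

attribute [local instance] HasDerivedCategory.standard

variable {R : Type u} [CommRing R]

/-- The cohomology of a complex, viewed in the derived category, is its homology. -/
def cohQEquiv (K : Cpx R) (i : ℤ) : coh i (Q.obj K) ≃ₗ[R] K.homology i :=
  ((homologyFunctorFactors (ModuleCat.{u} R) i).app K).toLinearEquiv

lemma cohQEquiv_map {K L : Cpx R} (f : K ⟶ L) (i : ℤ) (h : coh i (Q.obj K)) :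
    cohQEquiv L i ((homologyFunctor _ i).map (Q.map f) h) =
      HomologicalComplex.homologyMap f i (cohQEquiv K i h) :=
  congr($((homologyFunctorFactors (ModuleCat.{u} R) i).hom.naturality f) h)

lemma HomologicallyBounded.isGE {K : Cpx R} (h : HomologicallyBounded K) :
    ∃ a, (Q.obj K).IsGE a := by
  obtain ⟨a, ha⟩ := h.bddBelow
  refine ⟨a, (DerivedCategory.isGE_iff _ _).2 fun i hi => ?_⟩
  by_contra h0
  refine absurd (ha (show i ∈ {i | ¬ Limits.IsZero (K.homology i)} from fun h1 => h0 ?_)) (by lia)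
  exact h1.of_iso ((homologyFunctorFactors (ModuleCat.{u} R) i).app K)

lemma HomologicallyBounded.isLE {K : Cpx R} (h : HomologicallyBounded K) :
    ∃ a, (Q.obj K).IsLE a := by
  obtain ⟨a, ha⟩ := h.bddAbove
  refine ⟨a, (DerivedCategory.isLE_iff _ _).2 fun i hi => ?_⟩
  by_contra h0
  refine absurd (ha (show i ∈ {i | ¬ Limits.IsZero (K.homology i)} from fun h1 => h0 ?_)) (by lia)
  exact h1.of_iso ((homologyFunctorFactors (ModuleCat.{u} R) i).app K)

lemma homologicallyFinite_iff (K : Cpx R) : HomologicallyFinite K ↔ FiniteCoh (Q.obj K) := by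
  constructor
  · rintro ⟨h₁, h₂⟩
    exact ⟨h₁.isGE, h₁.isLE, fun i => have := h₂ i; .equiv (cohQEquiv K i).symm⟩
  · rintro ⟨⟨a, ha⟩, ⟨b, hb⟩, h⟩
    refine ⟨(Set.finite_Icc a b).subset fun i hi => ?_,
      fun i => have := h i; .equiv (cohQEquiv K i)⟩
    by_contra h0
    refine hi (Limits.IsZero.of_iso ?_ ((homologyFunctorFactors (ModuleCat.{u} R) i).app K).symm)
    rw [Set.mem_Icc, not_and_or, not_le, not_le] at h0
    rcases h0 with h0 | h0
    · exact isZero_of_isGE _ a i h0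
    · exact isZero_of_isLE _ b i h0

lemma FiniteCoh.of_iso {X Y : Der R} (e : X ≅ Y) (h : FiniteCoh X) : FiniteCoh Y := by
  obtain ⟨⟨a, ha⟩, ⟨b, hb⟩, h⟩ := h
  exact ⟨⟨a, TStructure.t.isGE_of_iso e a⟩, ⟨b, TStructure.t.isLE_of_iso e b⟩,
    fun i => have := h i; .equiv ((homologyFunctor _ i).mapIso e).toLinearEquiv⟩

lemma annCoh_le_of_iso {X Y : Der R} (e : X ≅ Y) : annCoh X ≤ annCoh Y := by
  intro r hr
  rw [mem_annCoh] at *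
  intro i h
  let e' := ((homologyFunctor _ i).mapIso e).toLinearEquiv
  rw [← e'.apply_symm_apply h, ← map_smul, hr, map_zero]

lemma mem_annCoh_of_smul_id_eq_zero {X : Der R} {r : R} (h : r • 𝟙 X = 0) : r ∈ annCoh X := by
  rw [mem_annCoh]
  intro i x
  rw [← coh_map_smul_id, h, Functor.map_zero]
  rfl

lemma isIso_iff_coh_bijective {X Y : Der R} (f : X ⟶ Y) :
    IsIso f ↔ ∀ i, Function.Bijective ((homologyFunctor (ModuleCat.{u} R) i).map f) := by
  rw [DerivedCategory.isIso_iff]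
  exact forall_congr' fun i => ConcreteCategory.isIso_iff_bijective _

/-- The cohomology of `RHom_R(A, B)` in degree `n` is `Hom(A, B⟦n⟧)` in `D(R)`. -/
def cohRHomEquiv {A : Cpx R} (P : Resolution A) (B : Cpx R) (n : ℤ) :
    coh n (Q.obj (P.rHom B)) ≃ₗ[R] (Q.obj A ⟶ (Q.obj B)⟦n⟧) :=
  have := P.isKProjective
  cohQEquiv _ n ≪≫ₗ homCpxHomologyEquiv P.P B n ≪≫ₗ
    Linear.homCongr R (asIso (Q.map P.π)) ((Q.commShiftIso n).app B)

lemma cohRHomEquiv_apply {A : Cpx R} (P : Resolution A) (B : Cpx R) (n : ℤ)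
    [P.P.IsKProjective] (x : coh n (Q.obj (P.rHom B))) :
    cohRHomEquiv P B n x = inv (Q.map P.π) ≫
      homCpxHomologyEquiv P.P B n (cohQEquiv (homCpx P.P B) n x) ≫ (Q.commShiftIso n).hom.app B :=
  (Linear.homCongr_apply R (asIso (Q.map P.π)) ((Q.commShiftIso n).app B)
    (homCpxHomologyEquiv P.P B n (cohQEquiv (homCpx P.P B) n x))).trans (Category.assoc _ _ _)

lemma homCpxHomologyEquiv_homologyClass (F G : Cpx R) [F.IsKProjective] (n : ℤ)
    (z : LinearMap.ker ((homCpx F G).d n (n + 1)).hom) :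
    homCpxHomologyEquiv F G n (homologyClass _ n z) = cocycleToDerived F G n z :=
  homologyEquivOfCocycles_homologyClass _ _ _ _ _ _

/-- The identity of `A` represents the isomorphism `A ≅ A⟦0⟧`. -/
lemma isIso_cocycleToDerived_id (A : Cpx R) (h) :
    IsIso (cocycleToDerived A A 0 ⟨Cochain.ofHom (𝟙 A), h⟩) := by
  have e : Cocycle.equivHomShift.symm (Cocycle.mk (Cochain.ofHom (𝟙 A)) (0 + 1) rfl h) =
      (shiftFunctorZero (Cpx R) ℤ).inv.app A := by
    apply Cocycle.equivHomShift.injective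
    rw [AddEquiv.apply_symm_apply]
    ext p : 2
    simp [Cocycle.equivHomShift_apply, Cochain.rightUnshift_v _ _ _ _ _ _ _ (add_zero p),
      shiftFunctorZero_inv_app_f, shiftFunctorObjXIso]
  change IsIso (Q.map (Cocycle.equivHomShift.symm _))
  rw [e]
  infer_instance

lemma d_unitOne (j : ℤ) : ((unitCpx R).d 0 j).hom (unitOne R) = 0 := by
  have h : (unitCpx R).d 0 j = 0 := HomologicalComplex.single_obj_d _ _ _ _ _
  rw [h]
  rfl

variable (R) in
/-- The class of `1` in the cohomology of the complex `R`. -/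
def unitCoh : coh 0 (Q.obj (unitCpx R)) :=
  (cohQEquiv _ 0).symm (homologyClass _ 0 ⟨unitOne R, d_unitOne _⟩)

lemma exists_smul_unitCoh (h : coh 0 (Q.obj (unitCpx R))) : ∃ r : R, h = r • unitCoh R := by
  obtain ⟨⟨x, hx⟩, hx'⟩ := homologyClass_surjective _ 0 (cohQEquiv _ 0 h)
  obtain ⟨r, rfl⟩ := exists_smul_unitOne x
  refine ⟨r, (cohQEquiv _ 0).injective ?_⟩
  rw [← hx', unitCoh, map_smul, LinearEquiv.apply_symm_apply, ← map_smul]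
  rfl

lemma smul_unitCoh_eq_zero {r : R} (h : r • unitCoh R = 0) : r = 0 := by
  rw [unitCoh, ← map_smul, ← map_smul, LinearEquiv.map_eq_zero_iff,
    homologyClass_eq_zero_iff] at h
  obtain ⟨y, hy⟩ := h
  have hd : (unitCpx R).d (0 - 1) 0 = 0 := HomologicalComplex.single_obj_d _ _ _ _ _
  rw [hd] at hy
  let e := (HomologicalComplex.singleObjXSelf (ComplexShape.up ℤ) 0 (ModuleCat.of R R))
  have h1 : e.hom.hom (unitOne R) = (1 : R) := congr($(e.inv_hom_id) (1 : R))
  have h2 : e.hom.hom (r • unitOne R) = r • (1 : R) := by rw [map_smul, h1]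
  have h3 : r • unitOne R = 0 := hy.symm
  rw [h3, map_zero] at h2
  simpa using h2.symm

lemma isZero_coh_unitCpx {i : ℤ} (hi : i ≠ 0) : Limits.IsZero (coh i (Q.obj (unitCpx R))) :=
  Limits.IsZero.of_iso (HomologicalComplex.isZero_single_obj_homology _ _ _ _ hi)
    ((homologyFunctorFactors (ModuleCat.{u} R) i).app (unitCpx R))

lemma finiteCoh_unitCpx [IsNoetherianRing R] : FiniteCoh (Q.obj (unitCpx R)) := by
  refine ⟨⟨0, ?_⟩, ⟨0, ?_⟩, fun i => ?_⟩
  · exact (DerivedCategory.isGE_iff _ _).2 fun i hi => isZero_coh_unitCpx (by lia)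
  · exact (DerivedCategory.isLE_iff _ _).2 fun i hi => isZero_coh_unitCpx (by lia)
  · by_cases hi : i = 0
    · subst hi
      refine Module.Finite.of_surjective (LinearMap.toSpanSingleton R _ (unitCoh R)) fun h => ?_
      obtain ⟨r, rfl⟩ := exists_smul_unitCoh h
      exact ⟨r, rfl⟩
    · have := ModuleCat.isZero_iff_subsingleton.1 (isZero_coh_unitCpx (R := R) hi)
      infer_instance

/-- The image of `1` under the homothety morphism, as a morphism `A → A⟦0⟧` in `D(R)`. -/
def homothetyOne {A : Cpx R} (P : Resolution A) : Q.obj A ⟶ (Q.obj A)⟦(0 : ℤ)⟧ :=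
  cohRHomEquiv P A 0 ((homologyFunctor _ 0).map P.homothety (unitCoh R))

lemma cohRHomEquiv_smul_unitCoh {A : Cpx R} (P : Resolution A) (r : R) :
    cohRHomEquiv P A 0 ((homologyFunctor _ 0).map P.homothety (r • unitCoh R)) =
      r • homothetyOne P := by
  rw [homothetyOne, map_smul, map_smul]

instance isIso_homothetyOne {A : Cpx R} (P : Resolution A) : IsIso (homothetyOne P) := by
  have := P.isKProjective
  have h0 : δ 0 (0 + 1) (Cochain.ofHom (𝟙 A)) = 0 := δ_ofHom _
  have := isIso_cocycleToDerived_id A h0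
  let c : LinearMap.ker ((homCpx P.P A).d 0 (0 + 1)).hom :=
    ⟨((homCpxPrecomp P.π A).f 0).hom (Cochain.ofHom (𝟙 A) : Cochain A A 0), d_map_eq_zero _ h0⟩
  have e₁ : cohQEquiv (homCpx P.P A) 0 ((homologyFunctor _ 0).map P.homothety (unitCoh R)) =
      homologyClass (homCpx P.P A) 0 c := by
    refine (cohQEquiv_map (scalarMap P.π) 0 (unitCoh R)).trans ?_
    rw [unitCoh, LinearEquiv.apply_symm_apply,
      homologyMap_homologyClass _ _ _ (d_map_eq_zero (scalarMap P.π) (d_unitOne _))]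
    congr 2
    refine (scalarMap_unitOne P.π).trans ((homCpxPrecomp_apply P.π A 0 _).trans ?_).symm
    exact Cochain.comp_id _
  have e₂ : homothetyOne P = inv (Q.map P.π) ≫ (Q.map P.π ≫
      cocycleToDerived A A 0 ⟨Cochain.ofHom (𝟙 A), h0⟩) ≫ (Q.commShiftIso 0).hom.app A := by
    rw [homothetyOne, cohRHomEquiv_apply, e₁, homCpxHomologyEquiv_homologyClass]
    rw [← cocycleToDerived_precomp P.π A 0 ⟨Cochain.ofHom (𝟙 A), h0⟩]
  rw [e₂]
  infer_instance

end CohomologyOfComplexes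

/-! ### Objects which are semidualizing on a factor of the ring -/

section Dualizing

open DerivedCategory Pretriangulated

attribute [local instance] HasDerivedCategory.standard

variable {R : Type u} [CommRing R]

/-- The idempotent `e` cuts out the factor of `R` over which `X` is "semidualizing": `X` is
annihilated by `1 - e`, and the homothety `R → RHom_R(X, X)` identifies `RHom_R(X, X)` with the
direct factor `R e` of `R`. This is expressed through the morphisms `X → X⟦n⟧` in `D(R)`, so that no
resolution of `X` is needed. -/
structure IsDualizingOn (e : R) (X : Der R) : Prop where
  /-- `e` is idempotent -/
  idem : e * e = e
  /-- the complementary factor of `R` acts as zero -/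
  compl : (1 - e) • 𝟙 X = 0
  /-- all endomorphisms are homotheties -/
  scalar : ∀ f : X ⟶ X, ∃ r : R, f = r • 𝟙 X
  /-- the factor `R e` acts faithfully -/
  faithful : ∀ r : R, r • 𝟙 X = 0 → r * e = 0
  /-- there are no self-extensions in degrees other than `0` -/
  ext : ∀ n : ℤ, n ≠ 0 → ∀ f : X ⟶ X⟦n⟧, f = 0

lemma IsDualizingOn.of_iso {X Y : Der R} {e : R} (h : IsDualizingOn e X) (i : X ≅ Y) :
    IsDualizingOn e Y where
  idem := h.idem
  compl := smul_id_eq_zero_of_iso i h.compl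
  scalar f := by
    obtain ⟨r, hr⟩ := h.scalar (i.hom ≫ f ≫ i.inv)
    exact ⟨r, by rw [← cancel_epi i.hom, ← cancel_mono i.inv, Category.assoc, hr]; simp⟩
  faithful r hr := h.faithful r (smul_id_eq_zero_of_iso i.symm hr)
  ext n hn f := by
    rw [← cancel_epi i.hom, ← cancel_mono (i.inv⟦n⟧'), Category.assoc,
      h.ext n hn (i.hom ≫ f ≫ i.inv⟦n⟧')]
    simp

lemma IsDualizingOn.isZero_iff {X : Der R} {e : R} (h : IsDualizingOn e X) :
    Limits.IsZero X ↔ e = 0 := by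
  rw [Limits.IsZero.iff_id_eq_zero]
  constructor
  · intro h0
    simpa using h.faithful 1 (by rw [h0, smul_zero])
  · intro h0
    simpa [h0] using h.compl

/-- The idempotent is determined by `X`; in particular a semidualizing complex is dualizing on no proper
factor of `R`. -/
lemma IsDualizingOn.eq_one {X : Der R} {e : R} (h : IsDualizingOn e X) (h₁ : IsDualizingOn 1 X) :
    e = 1 := by
  have := h₁.faithful _ h.compl
  rw [mul_one, sub_eq_zero] at this
  exact this.symm

/-- `A` satisfies the condition on the homothety morphism in the definition of a semidualizing complex if
and only if it is dualizing on all of `R`. -/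
lemma isIso_homothety_iff {A : Cpx R} (P : Resolution A) :
    IsIso P.homothety ↔ IsDualizingOn 1 (Q.obj A) := by
  rw [isIso_iff_coh_bijective]
  have h0 (r : R) (f : Q.obj A ⟶ Q.obj A) : cohRHomEquiv P A 0 ((homologyFunctor _ 0).map
      P.homothety (r • unitCoh R)) = f ≫ homothetyOne P ↔ f = r • 𝟙 _ := by
    rw [cohRHomEquiv_smul_unitCoh, ← cancel_mono (homothetyOne P), Linear.smul_comp,
      Category.id_comp]
    exact eq_comm
  constructor
  · intro h
    refine ⟨one_mul 1, by simp, fun f => ?_, fun r hr => ?_, fun n hn f => ?_⟩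
    · obtain ⟨x, hx⟩ := (h 0).2 ((cohRHomEquiv P A 0).symm (f ≫ homothetyOne P))
      obtain ⟨r, rfl⟩ := exists_smul_unitCoh x
      exact ⟨r, (h0 r f).1 (((cohRHomEquiv P A 0).symm_apply_eq).1 hx.symm).symm⟩
    · rw [mul_one]
      refine smul_unitCoh_eq_zero ((h 0).1 ((cohRHomEquiv P A 0).injective ?_))
      refine ((h0 r 0).2 hr.symm).trans ?_
      rw [Limits.zero_comp, map_zero, map_zero]
    · refine (cohRHomEquiv P A n).symm.injective ?_
      obtain ⟨x, hx⟩ := (h n).2 ((cohRHomEquiv P A n).symm f)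
      have := ModuleCat.isZero_iff_subsingleton.1 (isZero_coh_unitCpx (R := R) hn)
      rw [map_zero]
      refine hx.symm.trans ?_
      rw [Subsingleton.elim x 0, map_zero]
  · intro h i
    by_cases hi : i = 0
    · subst hi
      constructor
      · refine (injective_iff_map_eq_zero _).2 fun x hx => ?_
        obtain ⟨r, rfl⟩ := exists_smul_unitCoh x
        have := (h0 r 0).1 ((congrArg _ hx).trans (by rw [Limits.zero_comp, map_zero]))
        have := h.faithful r this.symm
        rw [mul_one] at this
        rw [this, zero_smul]
      · intro y
        obtain ⟨r, hr⟩ := h.scalar (cohRHomEquiv P A 0 y ≫ inv (homothetyOne P))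
        have := (h0 r _).2 hr
        rw [Category.assoc, IsIso.inv_hom_id, Category.comp_id] at this
        exact ⟨_, (cohRHomEquiv P A 0).injective this⟩
    · have h₁ := ModuleCat.isZero_iff_subsingleton.1 (isZero_coh_unitCpx (R := R) hi)
      have h₂ : Subsingleton (coh i (Q.obj (P.rHom A))) :=
        ⟨fun x y => (cohRHomEquiv P A i).injective
          ((h.ext i hi _).trans (h.ext i hi _).symm)⟩
      exact ⟨fun x y _ => h₁.elim x y, fun y => ⟨0, h₂.elim _ _⟩⟩

/-- If the cohomology of the cone of the homothety morphism is annihilated by `a` and `A` itself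
by `1 - a`, then `a` is the idempotent cutting out the support of `A`. -/
theorem isDualizingOn_of_distTriang {A : Cpx R} (P : Resolution A) {C : Der R}
    {g : Q.obj (P.rHom A) ⟶ C} {h : C ⟶ (Q.obj (unitCpx R))⟦(1 : ℤ)⟧}
    (hT : Triangle.mk P.homothety g h ∈ distTriang _) {a b : R} (hab : a + b = 1)
    (ha : a ∈ annCoh C) (hb : b • 𝟙 (Q.obj A) = 0) : IsDualizingOn a (Q.obj A) := by
  have hb' (n : ℤ) (f : Q.obj A ⟶ (Q.obj A)⟦n⟧) : b • f = 0 := by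
    rw [← Category.id_comp f, ← Linear.smul_comp, hb, Limits.zero_comp]
  -- If `r` kills `A`, then `r` lies in the kernel of `R → H^0(RHom_R(A, A))`, which is the image of
  -- `H^{-1}(C)` and therefore killed by `a`.
  have hfaith (r : R) (hr : r • 𝟙 (Q.obj A) = 0) : r * a = 0 := by
    have e : (homologyFunctor _ 0).map P.homothety (r • unitCoh R) = 0 := by
      refine (cohRHomEquiv P A 0).injective ((cohRHomEquiv_smul_unitCoh P r).trans ?_)
      rw [map_zero, ← Category.id_comp (homothetyOne P), ← Linear.smul_comp, hr, Limits.zero_comp]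
    obtain ⟨k, hk⟩ := coh_exact₁ hT (-1) (r • unitCoh R) e
    have := mem_annCoh.1 ha (-1) k
    refine smul_unitCoh_eq_zero (R := R) ?_
    rw [mul_comm, mul_smul]
    let δ := HomologySequence.δ (Triangle.mk P.homothety g h) (-1) (-1 + 1) rfl
    exact (congrArg (a • ·) hk.symm).trans ((map_smul δ.hom a k).symm.trans
      ((congrArg δ.hom this).trans (map_zero δ.hom)))
  -- In particular `b a = 0`, so that `a` and `b` are complementary idempotents.
  have hba : b * a = 0 := hfaith b hb
  -- The cohomology of `RHom_R(A, A)` is killed by `b` and that of `C` by `a`, so the map between them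
  -- is zero.
  have hga (i : ℤ) (x : coh i (Q.obj (P.rHom A))) : (homologyFunctor _ i).map g x = 0 := by
    have hbx : b • x = 0 := (cohRHomEquiv P A i).injective (by rw [map_smul, hb', map_zero])
    have hx : x = a • x := by
      conv_lhs => rw [← one_smul R x, ← hab, add_smul, hbx, add_zero]
    rw [hx, map_smul, mem_annCoh.1 ha]
  have hb1 : 1 - a = b := by rw [← hab]; ring
  refine ⟨?_, by rw [hb1, hb], fun f => ?_, hfaith, fun n hn f => ?_⟩
  · have : a * (a + b) = a := by rw [hab, mul_one]
    rwa [mul_add, mul_comm a b, hba, add_zero] at this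
  · obtain ⟨k, hk⟩ := coh_exact₂ hT 0 ((cohRHomEquiv P A 0).symm (f ≫ homothetyOne P)) (hga _ _)
    obtain ⟨r, rfl⟩ := exists_smul_unitCoh k
    have := (LinearEquiv.symm_apply_eq _).1 hk.symm
    rw [← Triangle.mk_mor₁ P.homothety g h] at this
    refine ⟨r, ?_⟩
    rw [← cancel_mono (homothetyOne P), Linear.smul_comp, Category.id_comp]
    exact this.trans (cohRHomEquiv_smul_unitCoh P r)
  · obtain ⟨k, hk⟩ := coh_exact₂ hT n ((cohRHomEquiv P A n).symm f) (hga _ _)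
    refine (cohRHomEquiv P A n).symm.injective ?_
    have := ModuleCat.isZero_iff_subsingleton.1 (isZero_coh_unitCpx (R := R) hn)
    have h0 : k = 0 := this.elim _ _
    rw [map_zero, ← hk, h0]
    exact map_zero _

end Dualizing

/-! ### Derived reflexivity -/

section Reflexivity

open DerivedCategory Pretriangulated

attribute [local instance] HasDerivedCategory.standard

variable {R : Type u} [CommRing R]

/-- If `Hom_R(l, A)` is a quasi-isomorphism, then `l` becomes invertible after applying the functors
`Hom(-, A⟦n⟧)` of `D(R)`. -/
lemma bijective_precomp_of_quasiIso {T S : Cpx R} [T.IsKProjective] [S.IsKProjective] (l : T ⟶ S)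
    (A : Cpx R) (h : QuasiIso (homCpxPrecomp l A)) (n : ℤ) :
    Function.Bijective fun f : Q.obj S ⟶ (Q.obj A)⟦n⟧ => Q.map l ≫ f := by
  have h := (quasiIso_homCpxPrecomp_iff l A).1 h n
  let e := (Q.commShiftIso n).app A
  constructor
  · intro f g hfg
    rw [← cancel_mono e.inv]
    apply h.1
    simpa using hfg
  · intro g
    obtain ⟨f, hf⟩ := h.2 (g ≫ e.inv)
    refine ⟨f ≫ e.hom, ?_⟩
    dsimp only at hf ⊢
    rw [← Category.assoc, hf, Category.assoc, Iso.inv_hom_id, Category.comp_id]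

lemma isIso_biduality_iff {N : Cpx R} (P : Resolution N) (A : Cpx R)
    (S : Resolution (P.rHom A)) : IsIso (P.biduality A S) ↔ QuasiIso (homSwap S.π) := by
  rw [← isIso_Q_map_iff_quasiIso]
  let i : Q.obj N ⟶ Q.obj P.P := inv (Q.map P.π)
  have hi : IsIso i := inferInstance
  exact ⟨fun h => @IsIso.of_isIso_comp_left _ _ _ _ _ i (Q.map (homSwap S.π)) hi h,
    fun h => hi.comp_isIso' h⟩

lemma quasiIso_homSwap_homSwap {T P A : Cpx R} (g : T ⟶ homCpx P A) [h : QuasiIso g] :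
    QuasiIso (homSwap (homSwap g)) := by
  rwa [homSwap_homSwap]

/-- A chain map `g : F → Hom(P, A)` whose transpose is a quasi-isomorphism factors in `D(R)`,
through any resolution of the target, as a map inducing an isomorphism on `RHom_R(-, A)`. -/
lemma exists_lift_quasiIso_precomp {F P A : Cpx R} [F.IsKProjective] (g : F ⟶ homCpx P A)
    (hg : QuasiIso (homSwap g)) (S : Resolution (homCpx P A)) (hS : QuasiIso (homSwap S.π)) :
    ∃ l : F ⟶ S.P, Q.map l ≫ Q.map S.π = Q.map g ∧ QuasiIso (homCpxPrecomp l A) := by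
  obtain ⟨l, hl⟩ := Q_map_surjective_of_isKProjective (Q.map g ≫ inv (Q.map S.π))
  have hl' : Q.map l ≫ Q.map S.π = Q.map g := by simp [hl]
  refine ⟨l, hl', ?_⟩
  obtain ⟨H⟩ := (Q_map_eq_iff_of_isKProjective (l ≫ S.π) g).1 (by rw [Functor.map_comp, hl'])
  have h := (quasiIso_homSwap_congr H).2 hg
  rw [homSwap_comp] at h
  exact quasiIso_of_comp_left (homSwap S.π) (homCpxPrecomp l A)

lemma isZero_of_one_mem_annCoh {X : Der R} (h : FiniteCoh X) (h1 : 1 ∈ annCoh X) :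
    Limits.IsZero X := by
  obtain ⟨n, hn⟩ := exists_pow_smul_id_eq_zero h.ge h.le h1
  rw [Limits.IsZero.iff_id_eq_zero]
  simpa using hn

/-- Homologically finite objects with `RHom_R(X, Y) = 0` are separated by a partition of `1`. -/
lemma Orthogonal.exists_add_eq_one [IsNoetherianRing R] {X Y : Der R} (h : Orthogonal X Y)
    (hX : FiniteCoh X) (hY : FiniteCoh Y) :
    ∃ a b : R, a + b = 1 ∧ a ∈ annCoh X ∧ b • 𝟙 Y = 0 := by
  have h1 := h.annCoh_sup_eq_top hX hY
  rw [Ideal.eq_top_iff_one, Submodule.mem_sup] at h1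
  obtain ⟨a, ha, b, hb, hab⟩ := h1
  obtain ⟨n, hn⟩ := exists_pow_smul_id_eq_zero hY.ge hY.le hb
  obtain ⟨u, v, huv⟩ : IsCoprime a (b ^ n) := IsCoprime.pow_right ⟨1, 1, by simpa using hab⟩
  exact ⟨u * a, v * b ^ n, huv, Ideal.mul_mem_left _ _ ha, by rw [mul_smul, hn, smul_zero]⟩

/-- If `RHom_R(-, A)` turns the homothety morphism into an isomorphism, then `A` is dualizing on
a factor of `R`. -/
theorem exists_isDualizingOn [IsNoetherianRing R] {A : Cpx R} (P : Resolution A)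
    (hA : HomologicallyFinite A) (hE : HomologicallyFinite (P.rHom A))
    (h : ∀ n : ℤ, Function.Bijective
      fun f : Q.obj (P.rHom A) ⟶ (Q.obj A)⟦n⟧ => P.homothety ≫ f) :
    ∃ e, IsDualizingOn e (Q.obj A) := by
  rw [homologicallyFinite_iff] at hA hE
  obtain ⟨C, g, k, hT⟩ := distinguished_cocone_triangle P.homothety
  have hC : Orthogonal C (Q.obj A) := orthogonal_obj₃_of_bijective hT h
  have hCf : FiniteCoh C := FiniteCoh.obj₃ hT finiteCoh_unitCpx hE
  -- The cone `C` of the homothety morphism is orthogonal to `A`, hence has support disjoint from `A`.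
  obtain ⟨a, b, hab, ha, hb⟩ := hC.exists_add_eq_one hCf hA
  exact ⟨a, isDualizingOn_of_distTriang P hT hab ha hb⟩

/-- If `A` is derived `A`-reflexive, then it is dualizing on a factor of `R`: reflexivity says that
`RHom_R(-, A)` turns the homothety morphism into an isomorphism. -/
theorem IsDerivedReflexive.exists_isDualizingOn [IsNoetherianRing R] {A : Cpx R}
    (h : IsDerivedReflexive A A) : ∃ e, IsDualizingOn e (Q.obj A) := by
  obtain ⟨hA, P, hE, S, hS⟩ := h
  rw [isIso_biduality_iff] at hS
  have := P.isKProjective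
  have := S.isKProjective
  obtain ⟨l, hl, hl'⟩ := exists_lift_quasiIso_precomp (scalarMap P.π)
    (quasiIso_homSwap_scalarMap P.π) S hS
  refine RComplex.exists_isDualizingOn P hA hE fun n => ?_
  have hb := bijective_precomp_of_quasiIso l A hl' n
  have e (f : Q.obj (P.rHom A) ⟶ (Q.obj A)⟦n⟧) : P.homothety ≫ f = Q.map l ≫ Q.map S.π ≫ f := by
    rw [← Category.assoc]
    exact congrArg (· ≫ f) hl.symm
  constructor
  · intro f g hfg
    dsimp only at hfg
    rw [e, e] at hfg
    exact (cancel_epi (Q.map S.π)).1 (hb.1 hfg)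
  · intro g
    obtain ⟨f, hf⟩ := hb.2 g
    refine ⟨inv (Q.map S.π) ≫ f, ?_⟩
    dsimp only
    rw [e, IsIso.hom_inv_id_assoc]
    exact hf

/-- If `A` is derived `A`-reflexive, then so is `RHom_R(A, A)`. The biduality morphism of `A`, which
is an isomorphism, can be used to resolve `RHom_R(RHom_R(A, A), A)`; with this choice the biduality
morphism of `RHom_R(A, A)` is the original resolution, as exchanging arguments is an involution. -/
theorem IsDerivedReflexive.rHom {A : Cpx R} (h : IsDerivedReflexive A A) :
    ∃ P : Resolution A, IsDerivedReflexive A (P.rHom A) := by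
  obtain ⟨hA, P, hE, S, hS⟩ := h
  rw [isIso_biduality_iff] at hS
  refine ⟨P, hE, S, ?_, ⟨P.P, homSwap S.π, P.isKProjective, hS⟩, ?_⟩
  · rw [homologicallyFinite_iff] at hA ⊢
    have := (isIso_Q_map_iff_quasiIso _ _).2 hS
    exact (hA.of_iso (asIso (Q.map P.π)).symm).of_iso (@asIso _ _ _ _ _ this)
  · rw [isIso_biduality_iff]
    exact quasiIso_homSwap_homSwap (P := P.P) (h := S.quasiIso)

/-- If `RHom_R(A, A)` is derived `A`-reflexive, then so is `A`: the biduality morphism of `A` has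
a cone which is orthogonal to `A` and annihilated by a power of the annihilator of `A`. -/
theorem isDerivedReflexive_of_rHom [IsNoetherianRing R] {A : Cpx R} (hA : HomologicallyFinite A)
    (P : Resolution A) (h : IsDerivedReflexive A (P.rHom A)) : IsDerivedReflexive A A := by
  obtain ⟨hE, T, hB, S, hS⟩ := h
  rw [isIso_biduality_iff] at hS
  refine ⟨hA, P, hE, T, ?_⟩
  rw [isIso_biduality_iff]
  have := P.isKProjective
  have := S.isKProjective
  obtain ⟨l, hl, hl'⟩ := exists_lift_quasiIso_precomp (homSwap T.π)
    (quasiIso_homSwap_homSwap (P := P.P) (h := T.quasiIso)) S hS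
  obtain ⟨D, g, k, hT⟩ := distinguished_cocone_triangle (Q.map l)
  have hD : Orthogonal D (Q.obj A) :=
    orthogonal_obj₃_of_bijective hT (bijective_precomp_of_quasiIso l A hl')
  rw [homologicallyFinite_iff] at hA hB
  have hDf : FiniteCoh D := FiniteCoh.obj₃ hT (hA.of_iso (asIso (Q.map P.π)).symm)
    (hB.of_iso (asIso (Q.map S.π)).symm)
  obtain ⟨a, b, hab, ha, hb⟩ := hD.exists_add_eq_one hDf hA
  have hbP : b ∈ annCoh (Q.obj P.P) :=
    annCoh_le_of_iso (asIso (Q.map P.π)).symm (mem_annCoh_of_smul_id_eq_zero hb)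
  have hbS : b ∈ annCoh (Q.obj S.P) := by
    refine annCoh_le_of_iso (asIso (Q.map S.π)).symm (mem_annCoh.2 fun i x => ?_)
    refine (cohRHomEquiv T A i).injective ?_
    rw [map_smul, map_zero, ← Category.comp_id (cohRHomEquiv T A i x),
      ← CategoryTheory.Functor.map_id, ← Linear.comp_smul, ← Functor.map_smul, hb,
      Functor.map_zero, Limits.comp_zero]
  have hbD : b * b ∈ annCoh D := mul_mem_annCoh_obj₃ hT hbP hbS
  have h1 : 1 ∈ annCoh D := by
    -- this is `1 = (a + b) ^ 2`
    have : (1 : R) = (a + 2 * b) * a + b * b := by rw [← one_mul (1 : R), ← hab]; ring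
    rw [this]
    exact add_mem (Ideal.mul_mem_left _ _ ha) hbD
  have : IsIso (Q.map l) :=
    (Triangle.isZero₃_iff_isIso₁ _ hT).1 (isZero_of_one_mem_annCoh hDf h1)
  rw [← isIso_Q_map_iff_quasiIso]
  exact hl ▸ IsIso.comp_isIso' this (inferInstanceAs (IsIso (Q.map S.π)))

end Reflexivity

/-! ### The homothety morphism as a projection onto a factor of the ring -/

section FactorOfTheRing

open DerivedCategory Pretriangulated

attribute [local instance] HasDerivedCategory.standard

variable {R : Type u} [CommRing R]

/-- A module, viewed as a complex concentrated in degree `0`. -/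
abbrev moduleCpx (M : ModuleCat.{u} R) : Cpx R :=
  (HomologicalComplex.single (ModuleCat.{u} R) (ComplexShape.up ℤ) 0).obj M

lemma isKProjective_moduleCpx (M : ModuleCat.{u} R) [hM : Projective M] :
    (moduleCpx M).IsKProjective :=
  have (n : ℤ) : Projective ((moduleCpx M).X n) := by
    by_cases hn : n = 0
    · subst hn
      exact Projective.of_iso (HomologicalComplex.singleObjXSelf _ _ _).symm hM
    · exact (HomologicalComplex.isZero_single_obj_X _ _ _ _ hn).projective
  have : (moduleCpx M).IsStrictlyLE 0 := by
    rw [CochainComplex.isStrictlyLE_iff]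
    intro i hi
    exact HomologicalComplex.isZero_single_obj_X _ _ _ _ (by lia)
  CochainComplex.isKProjective_of_projective _ 0

lemma isZero_coh_moduleCpx (M : ModuleCat.{u} R) {i : ℤ} (hi : i ≠ 0) :
    Limits.IsZero (coh i (Q.obj (moduleCpx M))) :=
  Limits.IsZero.of_iso (HomologicalComplex.isZero_single_obj_homology _ _ _ _ hi)
    ((homologyFunctorFactors (ModuleCat.{u} R) i).app (moduleCpx M))

/-- The ideal `R e`. -/
abbrev factorModule (e : R) : ModuleCat.{u} R := ModuleCat.of R (Ideal.span {e})

/-- The inclusion of `R e` in `R`. -/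
def factorIncl (e : R) : factorModule e ⟶ ModuleCat.of R R :=
  ModuleCat.ofHom (Ideal.span {e}).subtype

/-- The projection `r ↦ r e` of `R` onto `R e`. -/
def factorProj (e : R) : ModuleCat.of R R ⟶ factorModule e :=
  ModuleCat.ofHom (LinearMap.toSpanSingleton R (Ideal.span {e})
    ⟨e, Ideal.mem_span_singleton_self e⟩)

lemma factorIncl_factorProj {e : R} (he : e * e = e) : factorIncl e ≫ factorProj e = 𝟙 _ := by
  ext ⟨x, hx⟩
  obtain ⟨r, rfl⟩ := Ideal.mem_span_singleton'.1 hx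
  change r * e * e = r * e
  rw [mul_assoc, he]

lemma factorProj_factorIncl (e : R) : factorProj e ≫ factorIncl e = e • 𝟙 _ := by
  ext
  change (1 : R) * e = e * 1
  ring

lemma projective_factorModule {e : R} (he : e * e = e) : Projective (factorModule e) :=
  Retract.projective ⟨factorIncl e, factorProj e, factorIncl_factorProj he⟩

variable {e : R} {A : Cpx R}

lemma IsDualizingOn.smul_hom {X Y : Der R} (h : IsDualizingOn e X) (f : Y ⟶ X) : e • f = f := by
  have : (1 - e) • f = 0 := by
    rw [← Category.comp_id f, ← Linear.comp_smul, h.compl, Limits.comp_zero]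
  rw [sub_smul, one_smul, sub_eq_zero] at this
  exact this.symm

lemma IsDualizingOn.smul_hom_shift {X Y : Der R} (h : IsDualizingOn e X) (n : ℤ) (f : Y ⟶ X⟦n⟧) :
    e • f = f := by
  have : (1 - e) • f = 0 := by
    rw [← Category.comp_id f, ← CategoryTheory.Functor.map_id, ← Linear.comp_smul,
      ← Functor.map_smul, h.compl, Functor.map_zero, Limits.comp_zero]
  rw [sub_smul, one_smul, sub_eq_zero] at this
  exact this.symm

lemma IsDualizingOn.exists_smul_unitCoh (h : IsDualizingOn e (Q.obj A)) (P : Resolution A)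
    (y : coh 0 (Q.obj (P.rHom A))) :
    ∃ r : R, (homologyFunctor _ 0).map P.homothety (r • unitCoh R) = y := by
  obtain ⟨r, hr⟩ := h.scalar (cohRHomEquiv P A 0 y ≫ inv (homothetyOne P))
  refine ⟨r, (cohRHomEquiv P A 0).injective ?_⟩
  rw [cohRHomEquiv_smul_unitCoh, ← Category.id_comp (homothetyOne P), ← Linear.smul_comp, ← hr]
  simp

lemma IsDualizingOn.isZero_coh_rHom (h : IsDualizingOn e (Q.obj A)) (P : Resolution A) {i : ℤ}
    (hi : i ≠ 0) : Limits.IsZero (coh i (Q.obj (P.rHom A))) := by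
  rw [ModuleCat.isZero_iff_subsingleton]
  exact ⟨fun x y => (cohRHomEquiv P A i).injective ((h.ext i hi _).trans (h.ext i hi _).symm)⟩

lemma IsDualizingOn.finiteCoh_rHom (h : IsDualizingOn e (Q.obj A)) (P : Resolution A) :
    FiniteCoh (Q.obj (P.rHom A)) := by
  refine ⟨⟨0, ?_⟩, ⟨0, ?_⟩, fun i => ?_⟩
  · exact (isGE_iff _ _).2 fun i hi => h.isZero_coh_rHom P (by lia)
  · exact (isLE_iff _ _).2 fun i hi => h.isZero_coh_rHom P (by lia)
  · by_cases hi : i = 0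
    · subst hi
      refine Module.Finite.of_surjective (((homologyFunctor _ 0).map P.homothety).hom.comp
        (LinearMap.toSpanSingleton R _ (unitCoh R))) fun y => ?_
      obtain ⟨r, hr⟩ := h.exists_smul_unitCoh P y
      exact ⟨r, hr⟩
    · have := ModuleCat.isZero_iff_subsingleton.1 (h.isZero_coh_rHom P hi)
      infer_instance

/-- The homothety morphism, restricted to the factor `R e`. -/
def factorHomothety (e : R) (P : Resolution A) : moduleCpx (factorModule e) ⟶ homCpx P.P A :=
  (HomologicalComplex.single (ModuleCat.{u} R) (ComplexShape.up ℤ) 0).map (factorIncl e) ≫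
    scalarMap P.π

lemma Q_map_factorHomothety (e : R) (P : Resolution A) :
    Q.map (factorHomothety e P) =
      Q.map ((HomologicalComplex.single (ModuleCat.{u} R) (ComplexShape.up ℤ) 0).map
        (factorIncl e)) ≫ P.homothety := Functor.map_comp _ _ _

lemma Q_map_factorIncl_factorProj (he : e * e = e) :
    Q.map ((HomologicalComplex.single (ModuleCat.{u} R) (ComplexShape.up ℤ) 0).map (factorIncl e)) ≫
      Q.map ((HomologicalComplex.single (ModuleCat.{u} R) (ComplexShape.up ℤ) 0).map
        (factorProj e)) = 𝟙 _ := by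
  rw [← Functor.map_comp, ← Functor.map_comp, factorIncl_factorProj he]
  simp

lemma single_map_smul_id (r : R) :
    (HomologicalComplex.single (ModuleCat.{u} R) (ComplexShape.up ℤ) 0).map
      (r • 𝟙 (ModuleCat.of R R)) = r • 𝟙 (unitCpx R) := by
  apply unitCpx_hom_ext
  have h : ((HomologicalComplex.single (ModuleCat.{u} R) (ComplexShape.up ℤ) 0).map
      (r • 𝟙 (ModuleCat.of R R))).f 0 = r • 𝟙 _ := by
    rw [HomologicalComplex.single_map_f_self, Linear.smul_comp, Linear.comp_smul]
    simp
  rw [h]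
  rfl

lemma smul_id_comp_scalarMap {F G : Cpx R} (φ : F ⟶ G) (r : R) :
    (r • 𝟙 (unitCpx R)) ≫ scalarMap φ = scalarMap (r • φ) := by
  apply unitCpx_hom_ext
  rw [scalarMap_unitOne]
  exact (scalarMap_smul_unitOne φ r).trans (CochainComplex.HomComplex.Cochain.ext₀ _ _
    fun p => by simp)

lemma Q_map_factorProj_factorIncl (e : R) :
    Q.map ((HomologicalComplex.single (ModuleCat.{u} R) (ComplexShape.up ℤ) 0).map (factorProj e)) ≫
      Q.map ((HomologicalComplex.single (ModuleCat.{u} R) (ComplexShape.up ℤ) 0).map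
        (factorIncl e)) = e • 𝟙 _ := by
  rw [← Functor.map_comp, ← Functor.map_comp, factorProj_factorIncl, single_map_smul_id,
    Functor.map_smul, CategoryTheory.Functor.map_id]

/-- `RHom_R(A, A)` is the factor `R e` of `R`. -/
lemma IsDualizingOn.quasiIso_factorHomothety (h : IsDualizingOn e (Q.obj A)) (P : Resolution A) :
    QuasiIso (factorHomothety e P) := by
  rw [← isIso_Q_map_iff_quasiIso, isIso_iff_coh_bijective, Q_map_factorHomothety]
  have hip := Q_map_factorIncl_factorProj h.idem
  have hpi := Q_map_factorProj_factorIncl e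
  set ι := Q.map ((HomologicalComplex.single (ModuleCat.{u} R) (ComplexShape.up ℤ) 0).map
    (factorIncl e))
  set p := Q.map ((HomologicalComplex.single (ModuleCat.{u} R) (ComplexShape.up ℤ) 0).map
    (factorProj e))
  intro i
  let H := homologyFunctor (ModuleCat.{u} R) i
  have hip' (x : coh i (Q.obj (moduleCpx (factorModule e)))) : H.map p (H.map ι x) = x := by
    rw [← ModuleCat.comp_apply, ← Functor.map_comp, hip, CategoryTheory.Functor.map_id]
    rfl
  have hpi' (x : coh i (Q.obj (unitCpx R))) : H.map ι (H.map p x) = e • x := by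
    rw [← ModuleCat.comp_apply, ← Functor.map_comp, hpi, coh_map_smul_id]
  by_cases hi : i = 0
  · subst hi
    constructor
    · refine (injective_iff_map_eq_zero _).2 fun x hx => ?_
      obtain ⟨r, hr⟩ := RComplex.exists_smul_unitCoh (H.map ι x)
      have hx' : H.map P.homothety (r • unitCoh R) = 0 := by
        rw [← hr]
        exact congr($(H.map_comp ι P.homothety) x).symm.trans hx
      have hr0 : r • 𝟙 (Q.obj A) = 0 := by
        have := (cohRHomEquiv_smul_unitCoh P r).symm.trans (congrArg _ hx')
        rw [map_zero] at this
        rw [← cancel_mono (homothetyOne P), Linear.smul_comp, Category.id_comp, this,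
          Limits.zero_comp]
      have h1 : H.map ι x = e • H.map ι x := by rw [← hpi', hip']
      rw [hr, smul_smul, mul_comm, h.faithful r hr0, zero_smul] at h1
      rw [← hip' x, hr, h1, map_zero]
    · intro y
      obtain ⟨r, rfl⟩ := h.exists_smul_unitCoh P y
      refine ⟨H.map p (r • unitCoh R), ?_⟩
      refine congr($(H.map_comp ι P.homothety) (H.map p (r • unitCoh R))).trans ?_
      refine (congrArg (H.map P.homothety) (hpi' (r • unitCoh R))).trans
        ((cohRHomEquiv P A 0).injective ?_)
      rw [map_smul, map_smul, h.smul_hom_shift]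
  · have h₁ := ModuleCat.isZero_iff_subsingleton.1 (isZero_coh_moduleCpx (factorModule e) hi)
    have h₂ := ModuleCat.isZero_iff_subsingleton.1 (h.isZero_coh_rHom P hi)
    exact ⟨fun x y _ => h₁.elim x y, fun y => ⟨0, h₂.elim _ _⟩⟩

/-- The homothety morphism has a section in `D(R)`, given by the inclusion of `R e` in `R`. -/
lemma IsDualizingOn.exists_section (h : IsDualizingOn e (Q.obj A)) (P : Resolution A) :
    ∃ s : Q.obj (P.rHom A) ⟶ Q.obj (unitCpx R), s ≫ P.homothety = 𝟙 _ := by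
  have hi : IsIso (Q.map (factorHomothety e P)) :=
    (isIso_Q_map_iff_quasiIso _ _).2 (h.quasiIso_factorHomothety P)
  let i : Q.obj (moduleCpx (factorModule e)) ≅ Q.obj (P.rHom A) := @asIso _ _ _ _ _ hi
  refine ⟨i.inv ≫ Q.map ((HomologicalComplex.single (ModuleCat.{u} R)
    (ComplexShape.up ℤ) 0).map (factorIncl e)), ?_⟩
  rw [Category.assoc, ← Q_map_factorHomothety]
  exact i.inv_hom_id

/-- If `A` is dualizing on a factor of `R`, then `A` is derived `A`-reflexive: the ideal `R e` is a
projective resolution of `RHom_R(A, A)`, and `RHom_R(R e, A) ≃ e A ≃ A`. -/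
theorem IsDualizingOn.isDerivedReflexive (h : IsDualizingOn e (Q.obj A))
    (hA : HomologicallyFinite A) (P : Resolution A) : IsDerivedReflexive A A := by
  have := projective_factorModule h.idem
  have hK := isKProjective_moduleCpx (factorModule e)
  refine ⟨hA, P, (homologicallyFinite_iff _).2 (h.finiteCoh_rHom P),
    ⟨_, factorHomothety e P, hK, h.quasiIso_factorHomothety P⟩, ?_⟩
  rw [isIso_biduality_iff]
  -- The biduality morphism is computed after composing with the isomorphism `RHom_R(R e, A) ≃
  -- RHom_R(R, A)` induced by the projection `R → R e`, where it becomes `e • π` up to `A ≅ Hom_R(R, A)`.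
  let l : unitCpx R ⟶ moduleCpx (factorModule e) :=
    (HomologicalComplex.single (ModuleCat.{u} R) (ComplexShape.up ℤ) 0).map (factorProj e)
  have hl : l ≫ factorHomothety e P = scalarMap (e • P.π) := by
    rw [factorHomothety, ← Category.assoc, ← Functor.map_comp, factorProj_factorIncl,
      single_map_smul_id, smul_id_comp_scalarMap]
  have h₁ : QuasiIso (homCpxPrecomp l A) := by
    rw [quasiIso_homCpxPrecomp_iff]
    intro n
    constructor
    · intro f g hfg
      dsimp only at hfg
      rw [← Category.id_comp f, ← Category.id_comp g, ← Q_map_factorIncl_factorProj h.idem,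
        Category.assoc, Category.assoc, hfg]
    · intro g
      refine ⟨Q.map ((HomologicalComplex.single (ModuleCat.{u} R) (ComplexShape.up ℤ) 0).map
        (factorIncl e)) ≫ g, ?_⟩
      dsimp only
      rw [← Category.assoc, Q_map_factorProj_factorIncl, Linear.smul_comp, Category.id_comp,
        ← cancel_mono ((Q.commShiftIso n).hom.app A), Linear.smul_comp]
      exact h.smul_hom_shift n _
  have h₂ : QuasiIso (homSwap (scalarMap (e • P.π))) := by
    have : QuasiIso (e • P.π) := by
      rw [← isIso_Q_map_iff_quasiIso, Functor.map_smul, h.smul_hom]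
      infer_instance
    exact quasiIso_homSwap_scalarMap _
  rw [← hl, homSwap_comp] at h₂
  exact quasiIso_of_comp_right _ (homCpxPrecomp l A)

end FactorOfTheRing

/-! ### Homotopies and K-injectivity of Hom complexes -/

section Homotopies

open CochainComplex CochainComplex.HomComplex

variable {R : Type u} [CommRing R]

/-- Homotopies are preserved by `Hom_R(F, -)`. -/
lemma nonempty_homotopy_postcomp (F : Cpx R) {G G' : Cpx R} {φ ψ : G ⟶ G'} (h : Homotopy φ ψ) :
    Nonempty (Homotopy (homCpxPostcomp F φ) (homCpxPostcomp F ψ)) := by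
  obtain ⟨s, hs⟩ := Cochain.equivHomotopy _ _ h
  let S : Cochain (homCpx F G) (homCpx F G') (-1) := Cochain.mk fun p q hpq => ModuleCat.ofHom
    { toFun := fun z : Cochain F G p => z.comp s hpq
      map_add' := fun z w => Cochain.add_comp z w _ _
      map_smul' := fun r z => Cochain.smul_comp r z _ _ }
  refine ⟨(Cochain.equivHomotopy _ _).symm ⟨S, Cochain.ext₀ _ _ fun p =>
    ModuleCat.hom_ext (LinearMap.ext fun (z : Cochain F G p) => ?_)⟩⟩
  rw [Cochain.ofHom_v, Cochain.add_v, Cochain.ofHom_v,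
    δ_v (-1) 0 (by lia) S p p (by lia) (p - 1) (p + 1) rfl rfl]
  change z.comp (Cochain.ofHom φ) (add_zero p) = (δ (p - 1) p (z.comp s (by lia)) +
    Int.negOnePow 0 • (δ p (p + 1) z).comp s (by lia)) + z.comp (Cochain.ofHom ψ) (add_zero p)
  rw [hs, δ_comp z s (by lia) (p + 1) 0 p (by lia) (by lia) (by lia), Cochain.comp_add]
  simp

/-- Homotopies are preserved by `Hom_R(-, G)`. -/
lemma nonempty_homotopy_precomp {F' F : Cpx R} {φ ψ : F' ⟶ F} (h : Homotopy φ ψ) (G : Cpx R) :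
    Nonempty (Homotopy (homCpxPrecomp φ G) (homCpxPrecomp ψ G)) := by
  obtain ⟨s, hs⟩ := Cochain.equivHomotopy _ _ h
  let S : Cochain (homCpx F G) (homCpx F' G) (-1) := Cochain.mk fun p q hpq => ModuleCat.ofHom
    { toFun := fun z : Cochain F G p => p.negOnePow • s.comp z (show -1 + p = q by lia)
      map_add' := fun z w => by rw [Cochain.comp_add, smul_add]
      map_smul' := fun r z => by rw [Cochain.comp_smul, smul_comm]; rfl }
  refine ⟨(Cochain.equivHomotopy _ _).symm ⟨S, Cochain.ext₀ _ _ fun p =>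
    ModuleCat.hom_ext (LinearMap.ext fun (z : Cochain F G p) => ?_)⟩⟩
  rw [Cochain.ofHom_v, Cochain.add_v, Cochain.ofHom_v,
    δ_v (-1) 0 (by lia) S p p (by lia) (p - 1) (p + 1) rfl rfl]
  change (Cochain.ofHom φ).comp z (zero_add p) =
    (δ (p - 1) p (p.negOnePow • s.comp z (show -1 + p = p - 1 by lia)) +
    Int.negOnePow 0 • (p + 1).negOnePow • s.comp (δ p (p + 1) z) (show -1 + (p + 1) = p by lia)) +
      (Cochain.ofHom ψ).comp z (zero_add p)
  rw [hs, δ_units_smul, δ_comp s z (by lia) 0 (p + 1) p (by lia) (by lia) (by lia),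
    Cochain.add_comp, Int.negOnePow_succ, smul_add, smul_smul, Int.units_mul_self]
  simp

/-- If `P` is K-projective and `J` is K-injective, then `Hom_R(P, J)` is K-injective. -/
lemma isKInjective_homCpx (P J : Cpx R) [P.IsKProjective] [J.IsKInjective] :
    (homCpx P J).IsKInjective where
  nonempty_homotopy_zero {X} g hX := by
    -- Exchanging arguments turns `g : X → Hom_R(P, J)` into a map `P → Hom_R(X, J)` with acyclic target.
    have hac : (homCpx X J).Acyclic := by
      rw [acyclic_iff_forall]
      intro n (z : Cochain X J n) hz
      obtain ⟨w, hw⟩ := IsKInjective.eq_δ_of_cocycle (Cocycle.mk z (n + 1) rfl hz) hX (n - 1)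
        (by lia)
      exact ⟨w, hw⟩
    obtain ⟨H⟩ := IsKProjective.nonempty_homotopy_zero (homSwap g) hac
    obtain ⟨H'⟩ := nonempty_homotopy_precomp H J
    have e : bidualityMap X J ≫ homCpxPrecomp (homSwap g) J = g := homSwap_homSwap g
    have e' : homCpxPrecomp (0 : P ⟶ homCpx X J) J = 0 := by
      ext n z
      change (Cochain.ofHom 0).comp z (zero_add n) = 0
      rw [Cochain.ofHom_zero]
      exact Cochain.zero_comp _ _
    exact ⟨(Homotopy.ofEq e.symm).trans ((H'.compLeft (bidualityMap X J)).trans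
      (Homotopy.ofEq (by rw [e', Limits.comp_zero])))⟩

end Homotopies

/-! ### The adjunction between tensor product and Hom of complexes -/

section TensorHom

open CochainComplex CochainComplex.HomComplex TensorProduct

variable {R : Type u} [CommRing R]

lemma map_units_smul_right {M N : ModuleCat.{u} R} (f : M →ₗ[R] N) (ε : ℤˣ) (x : M) :
    f (ε • x) = ε • f x := by
  rw [Units.smul_def, Units.smul_def, map_zsmul]

/-- The pure tensor `x ⊗ t` in the tensor product of two complexes. -/
def tensorMk (P X : Cpx R) (p q n : ℤ) (h : p + q = n) :
    P.X p →ₗ[R] X.X q →ₗ[R] (HomologicalComplex.tensorObj P X).X n :=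
  (TensorProduct.mk R (P.X p) (X.X q)).compr₂ (HomologicalComplex.ιTensorObj P X p q n h).hom

lemma tensorObj_hom_ext {P X : Cpx R} {n : ℤ} {M : ModuleCat.{u} R}
    {f g : (HomologicalComplex.tensorObj P X).X n ⟶ M}
    (h : ∀ (p q : ℤ) (hpq : p + q = n) (x : P.X p) (t : X.X q),
      f.hom (tensorMk P X p q n hpq x t) = g.hom (tensorMk P X p q n hpq x t)) : f = g := by
  apply HomologicalComplex.mapBifunctor.hom_ext
  intro p q hpq
  exact ModuleCat.MonoidalCategory.tensor_ext fun x t => h p q hpq x t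

lemma d_tensorMk (P X : Cpx R) (p q n p' q' n' : ℤ) (h : p + q = n) (hp : p + 1 = p')
    (hq : q + 1 = q') (hn : n + 1 = n') (x : P.X p) (t : X.X q) :
    ((HomologicalComplex.tensorObj P X).d n n').hom (tensorMk P X p q n h x t) =
      tensorMk P X p' q n' (by lia) ((P.d p p').hom x) t +
        p.negOnePow • tensorMk P X p q' n' (by lia) x ((X.d q q').hom t) := by
  subst hp hq
  have e : HomologicalComplex.ιTensorObj P X p q n h ≫ (HomologicalComplex.tensorObj P X).d n n' =
      (1 : ℤˣ) • ((((MonoidalCategory.curriedTensor (ModuleCat.{u} R)).map (P.d p (p + 1))).app _) ≫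
        HomologicalComplex.ιTensorObj P X (p + 1) q n' (by lia)) +
      p.negOnePow • ((((MonoidalCategory.curriedTensor (ModuleCat.{u} R)).obj (P.X p)).map
        (X.d q (q + 1))) ≫ HomologicalComplex.ιTensorObj P X p (q + 1) n' (by lia)) := by
    rw [HomologicalComplex.mapBifunctor.d_eq]
    simp only [Preadditive.comp_add, HomologicalComplex.mapBifunctor.ι_D₁,
      HomologicalComplex.mapBifunctor.ι_D₂]
    rw [HomologicalComplex.mapBifunctor.d₁_eq P X _ _ (i₁ := p) (i₁' := p + 1) rfl q n'
        (show p + 1 + q = n' by lia),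
      HomologicalComplex.mapBifunctor.d₂_eq P X _ _ p (i₂ := q) (i₂' := q + 1) rfl n'
        (show p + (q + 1) = n' by lia)]
    rfl
  have := congr($e (x ⊗ₜ t))
  rw [one_smul] at this
  exact this

lemma evaluationMap_tensorMk (F G : Cpx R) (p q n : ℤ) (h : p + q = n) (x : F.X p)
    (f : Cochain F G q) :
    ((evaluationMap F G).f n).hom (tensorMk F (homCpx F G) p q n h x f) =
      signedEval F G p q n h x f := by
  have e := HomologicalComplex.ι_mapBifunctorDesc (K₁ := F) (K₂ := homCpx F G)
    (F := MonoidalCategory.curriedTensor (ModuleCat.{u} R)) (c := ComplexShape.up ℤ)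
    (fun p q (h : p + q = n) => ModuleCat.ofHom (TensorProduct.lift (signedEval F G p q n h)))
    p q h
  exact congr($e (x ⊗ₜ f))

/-- The chain map `P ⊗_R X → P ⊗_R Y` induced by a chain map `X → Y`. -/
def tensorLeft (P : Cpx R) {X Y : Cpx R} (g : X ⟶ Y) :
    HomologicalComplex.tensorObj P X ⟶ HomologicalComplex.tensorObj P Y :=
  HomologicalComplex.tensorHom (𝟙 P) g

lemma tensorLeft_tensorMk (P : Cpx R) {X Y : Cpx R} (g : X ⟶ Y) (p q n : ℤ) (h : p + q = n)
    (x : P.X p) (t : X.X q) :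
    ((tensorLeft P g).f n).hom (tensorMk P X p q n h x t) =
      tensorMk P Y p q n h x ((g.f q).hom t) := by
  have e := HomologicalComplex.ι_mapBifunctorMap (𝟙 P) g
    (MonoidalCategory.curriedTensor (ModuleCat.{u} R)) (ComplexShape.up ℤ) p q n h
  exact congr($e (x ⊗ₜ t))

/-- The coevaluation chain map `X → Hom_R(P, P ⊗_R X)`, which sends `t` to
`x ↦ (-1) ^ (|x| |t|) x ⊗ t`. -/
def coevaluationMap (P X : Cpx R) : X ⟶ homCpx P (HomologicalComplex.tensorObj P X) where
  f q := ModuleCat.ofHom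
    { toFun := fun t => (Cochain.mk fun p n h => (p * q).negOnePow •
        ModuleCat.ofHom ((tensorMk P X p q n h).flip t) :
          Cochain P (HomologicalComplex.tensorObj P X) q)
      map_add' := fun s t => Cochain.ext _ _ fun p n h => by
        ext x
        simp
      map_smul' := fun r t => Cochain.ext _ _ fun p n h => by
        ext x
        simp [smul_comm r] }
  comm' q q' hq := by
    have hq : q + 1 = q' := hq
    refine ModuleCat.hom_ext (LinearMap.ext fun t => Cochain.ext _ _ fun p n' h =>
      ModuleCat.hom_ext (LinearMap.ext fun x => ?_))
    let z (q : ℤ) (t : X.X q) : Cochain P (HomologicalComplex.tensorObj P X) q :=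
      Cochain.mk fun p n h => (p * q).negOnePow • ModuleCat.ofHom ((tensorMk P X p q n h).flip t)
    change ((δ q q' (z q t)).v p n' h).hom x = ((z q' ((X.d q q').hom t)).v p n' h).hom x
    rw [δ_v q q' hq (z q t) p n' h (p + q) (p + 1) (by lia) rfl]
    change ((HomologicalComplex.tensorObj P X).d (p + q) n').hom
        ((p * q).negOnePow • tensorMk P X p q (p + q) rfl x t) +
      q'.negOnePow • (((p + 1) * q).negOnePow • tensorMk P X (p + 1) q n' (by lia)
        ((P.d p (p + 1)).hom x) t) =
      (p * q').negOnePow • tensorMk P X p q' n' h x ((X.d q q').hom t)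
    rw [map_units_smul_right, d_tensorMk P X p q (p + q) (p + 1) q' n' rfl rfl hq (by lia)]
    have h₁ : ((p + 1) * q).negOnePow = (p * q).negOnePow * q.negOnePow := by
      rw [add_mul, one_mul, Int.negOnePow_add]
    have h₂ : (p * q').negOnePow = (p * q).negOnePow * p.negOnePow := by
      rw [← hq, mul_add, mul_one, Int.negOnePow_add]
    have h₃ : q'.negOnePow = -q.negOnePow := by rw [← hq, Int.negOnePow_succ]
    rw [h₁, h₂, h₃, smul_add, smul_smul, smul_smul, neg_mul,
      mul_comm _ q.negOnePow, ← mul_assoc, Int.units_mul_self, one_mul, Units.neg_smul]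
    abel

variable {P X J : Cpx R}

/-- The adjunction between `P ⊗_R -` and `Hom_R(P, -)`, from the tensor product. -/
def tensorCurry (h : HomologicalComplex.tensorObj P X ⟶ J) : X ⟶ homCpx P J :=
  coevaluationMap P X ≫ homCpxPostcomp P h

/-- The adjunction between `P ⊗_R -` and `Hom_R(P, -)`, to the tensor product. -/
def tensorUncurry (g : X ⟶ homCpx P J) : HomologicalComplex.tensorObj P X ⟶ J :=
  tensorLeft P g ≫ evaluationMap P J

lemma tensorCurry_v (h : HomologicalComplex.tensorObj P X ⟶ J) (p q n : ℤ) (hpq : p + q = n)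
    (x : P.X p) (t : X.X q) :
    (Cochain.v (((tensorCurry h).f q).hom t : Cochain P J q) p n hpq).hom x =
      (p * q).negOnePow • (h.f n).hom (tensorMk P X p q n hpq x t) := by
  let z : Cochain P (HomologicalComplex.tensorObj P X) q := ((coevaluationMap P X).f q).hom t
  change (Cochain.v (z.comp (Cochain.ofHom h) (add_zero q)) p n hpq).hom x = _
  rw [Cochain.comp_zero_cochain_v, Cochain.ofHom_v]
  exact map_units_smul_right (h.f n).hom _ _

lemma tensorUncurry_tensorMk (g : X ⟶ homCpx P J) (p q n : ℤ) (hpq : p + q = n)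
    (x : P.X p) (t : X.X q) :
    ((tensorUncurry g).f n).hom (tensorMk P X p q n hpq x t) =
      (p * q).negOnePow • (Cochain.v ((g.f q).hom t : Cochain P J q) p n hpq).hom x := by
  change ((evaluationMap P J).f n).hom (((tensorLeft P g).f n).hom _) = _
  rw [tensorLeft_tensorMk]
  exact evaluationMap_tensorMk P J p q n hpq x _

lemma tensorCurry_tensorUncurry (g : X ⟶ homCpx P J) : tensorCurry (tensorUncurry g) = g := by
  refine HomologicalComplex.hom_ext _ _ fun q => ModuleCat.hom_ext (LinearMap.ext fun t =>
    Cochain.ext _ _ fun p n h => ModuleCat.hom_ext (LinearMap.ext fun x => ?_))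
  rw [tensorCurry_v, tensorUncurry_tensorMk, smul_smul, Int.units_mul_self, one_smul]

lemma tensorUncurry_tensorCurry (h : HomologicalComplex.tensorObj P X ⟶ J) :
    tensorUncurry (tensorCurry h) = h := by
  refine HomologicalComplex.hom_ext _ _ fun n => tensorObj_hom_ext fun p q hpq x t => ?_
  rw [tensorUncurry_tensorMk, tensorCurry_v, smul_smul, Int.units_mul_self, one_smul]

lemma tensorUncurry_id : tensorUncurry (𝟙 (homCpx P J)) = evaluationMap P J := by
  refine HomologicalComplex.hom_ext _ _ fun n => tensorObj_hom_ext fun p q hpq x f => ?_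
  rw [tensorUncurry_tensorMk]
  exact (evaluationMap_tensorMk P J p q n hpq x f).symm

lemma tensorCurry_evaluationMap : tensorCurry (evaluationMap P J) = 𝟙 (homCpx P J) := by
  rw [← tensorUncurry_id, tensorCurry_tensorUncurry]

lemma tensorCurry_comp {J' : Cpx R} (h : HomologicalComplex.tensorObj P X ⟶ J) (f : J ⟶ J') :
    tensorCurry (h ≫ f) = tensorCurry h ≫ homCpxPostcomp P f := by
  refine HomologicalComplex.hom_ext _ _ fun q => ModuleCat.hom_ext (LinearMap.ext fun t =>
    Cochain.ext _ _ fun p n hpq => ModuleCat.hom_ext (LinearMap.ext fun x => ?_))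
  rw [tensorCurry_v]
  let z : Cochain P J q := ((tensorCurry h).f q).hom t
  change _ = (Cochain.v (z.comp (Cochain.ofHom f) (add_zero q)) p n hpq).hom x
  rw [Cochain.comp_zero_cochain_v, Cochain.ofHom_v]
  refine .trans ?_ (congrArg (f.f n).hom (tensorCurry_v h p q n hpq x t)).symm
  exact (map_units_smul_right (f.f n).hom _ _).symm

lemma nonempty_homotopy_tensorCurry {h h' : HomologicalComplex.tensorObj P X ⟶ J}
    (H : Homotopy h h') : Nonempty (Homotopy (tensorCurry h) (tensorCurry h')) := by
  obtain ⟨H'⟩ := nonempty_homotopy_postcomp P H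
  exact ⟨H'.compLeft _⟩

lemma nonempty_homotopy_tensorUncurry {g g' : X ⟶ homCpx P J}
    (H : Homotopy g g') : Nonempty (Homotopy (tensorUncurry g) (tensorUncurry g')) :=
  ⟨(HomologicalComplex.mapBifunctorMapHomotopy₂ (𝟙 P) H _ _).compRight _⟩

end TensorHom

/-! ### Chain maps `F → G` as chain maps `R → Hom_R(F, G)` -/

section ScalarMap

open CochainComplex CochainComplex.HomComplex DerivedCategory

attribute [local instance] HasDerivedCategory.standard

variable {R : Type u} [CommRing R]

lemma scalarMap_comp {F G G' : Cpx R} (φ : F ⟶ G) (ψ : G ⟶ G') :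
    scalarMap (φ ≫ ψ) = scalarMap φ ≫ homCpxPostcomp F ψ := by
  apply unitCpx_hom_ext
  refine (scalarMap_unitOne _).trans ((Cochain.ofHom_comp _ _).trans ?_)
  exact (congrArg (((homCpxPostcomp F ψ).f 0).hom) (scalarMap_unitOne φ)).symm

lemma scalarMap_injective {F G : Cpx R} {φ ψ : F ⟶ G} (h : scalarMap φ = scalarMap ψ) : φ = ψ := by
  apply Cochain.ofHom_injective
  exact (scalarMap_unitOne φ).symm.trans ((congr(($h).f 0 |>.hom (unitOne R))).trans
    (scalarMap_unitOne ψ))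

lemma exists_eq_scalarMap {F G : Cpx R} (g : unitCpx R ⟶ homCpx F G) :
    ∃ φ : F ⟶ G, scalarMap φ = g := by
  let z : Cochain F G 0 := (g.f 0).hom (unitOne R)
  have hz : δ 0 1 z = 0 := d_map_eq_zero g (d_unitOne 1)
  refine ⟨Cocycle.homOf (Cocycle.mk z 1 (by lia) hz), unitCpx_hom_ext ?_⟩
  refine (scalarMap_unitOne _).trans ?_
  rw [Cocycle.cochain_ofHom_homOf_eq_coe]
  rfl

lemma nonempty_homotopy_scalarMap {F G : Cpx R} {φ ψ : F ⟶ G} (h : Homotopy φ ψ) :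
    Nonempty (Homotopy (scalarMap φ) (scalarMap ψ)) := by
  obtain ⟨H⟩ := nonempty_homotopy_postcomp F h
  rw [← Category.id_comp φ, ← Category.id_comp ψ, scalarMap_comp, scalarMap_comp]
  exact ⟨H.compLeft _⟩

lemma nonempty_homotopy_of_scalarMap {F G : Cpx R} {φ : F ⟶ G}
    (h : Homotopy (scalarMap φ) 0) : Nonempty (Homotopy φ 0) := by
  obtain ⟨s, hs⟩ := Cochain.equivHomotopy _ _ h
  let t : Cochain F G (-1) := (s.v 0 (-1) (by lia)).hom (unitOne R)
  refine ⟨(Cochain.equivHomotopy _ _).symm ⟨t, ?_⟩⟩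
  have e := Cochain.congr_v hs 0 0 (by lia)
  rw [Cochain.ofHom_v, Cochain.add_v, Cochain.ofHom_zero, Cochain.zero_v, add_zero,
    δ_v (-1) 0 (by lia) s 0 0 (by lia) (-1) 1 rfl rfl] at e
  have hd : (unitCpx R).d 0 1 = 0 := HomologicalComplex.single_obj_d _ _ _ _ _
  rw [hd, Limits.zero_comp, smul_zero, add_zero] at e
  rw [Cochain.ofHom_zero, add_zero]
  exact (scalarMap_unitOne φ).symm.trans congr($e (unitOne R))

lemma Q_map_scalarMap_eq_zero_iff {F G : Cpx R} (φ : F ⟶ G) :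
    Q.map (scalarMap φ) = 0 ↔ Nonempty (Homotopy φ 0) := by
  rw [← Functor.map_zero, Q_map_eq_iff_of_isKProjective]
  constructor
  · rintro ⟨h⟩
    exact nonempty_homotopy_of_scalarMap h
  · rintro ⟨h⟩
    obtain ⟨H⟩ := nonempty_homotopy_scalarMap h
    exact ⟨H.trans (Homotopy.ofEq (unitCpx_hom_ext (by
      refine (scalarMap_unitOne _).trans ?_
      rw [Cochain.ofHom_zero]
      rfl)))⟩

/-- The isomorphism `Hom_R(F, G⟦n⟧) ≅ Hom_R(F, G)⟦n⟧`. -/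
def homCpxShiftIso (F G : Cpx R) (n : ℤ) : homCpx F (G⟦n⟧) ≅ (homCpx F G)⟦n⟧ :=
  HomologicalComplex.Hom.isoOfComponents
    (fun m => LinearEquiv.toModuleIso
      { toFun := fun z : Cochain F (G⟦n⟧) m => (z.rightUnshift (m + n) rfl : Cochain F G (m + n))
        invFun := fun z : Cochain F G (m + n) => z.rightShift n m rfl
        map_add' := fun z w => Cochain.rightUnshift_add _ _ _ _
        map_smul' := fun r z => Cochain.rightUnshift_smul _ _ _ _
        left_inv := fun z => Cochain.rightShift_rightUnshift _ _ _
        right_inv := fun z => Cochain.rightUnshift_rightShift _ _ _ _ })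
    (fun i j hij => ModuleCat.hom_ext (LinearMap.ext fun (z : Cochain F (G⟦n⟧) i) => by
      have hij : i + 1 = j := hij
      change n.negOnePow • δ (i + n) (j + n) (z.rightUnshift (i + n) rfl) =
        (δ i j z).rightUnshift (j + n) rfl
      rw [Cochain.δ_rightUnshift z (i + n) rfl (j + n) j rfl, smul_smul, Int.units_mul_self,
        one_smul]))

end ScalarMap

/-! ### The Bass class -/

section BassClass

open DerivedCategory Pretriangulated

attribute [local instance] HasDerivedCategory.standard

variable {R : Type u} [CommRing R]

/-- A complex with left bounded homology has a K-injective resolution. -/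
lemma exists_quasiIso_isKInjective (A : Cpx R) (hA : ∃ a, (Q.obj A).IsGE a) :
    ∃ (J : Cpx R) (j : A ⟶ J), QuasiIso j ∧ J.IsKInjective := by
  obtain ⟨a, ha⟩ := hA
  rw [DerivedCategory.isGE_Q_obj_iff] at ha
  obtain ⟨J, j, hj, hJ, _⟩ :=
    CochainComplex.Plus.modelCategoryQuillen.exists_quasiIso_injective (A.truncGE a) a
  exact ⟨J, A.πTruncGE a ≫ j, inferInstance, CochainComplex.isKInjective_of_injective J a⟩

/-- If the evaluation morphism of `A` is an isomorphism, then `RHom_R(-, RHom_R(A, J))` turns the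
homothety morphism into an isomorphism. -/
lemma bijective_homothety_comp_of_isIso_evaluation {A : Cpx R} (P : Resolution A)
    (h : IsIso (Q.map (evaluationMap P.P A))) (J : Cpx R) [J.IsKInjective] :
    Function.Bijective fun f : Q.obj (homCpx P.P A) ⟶ Q.obj (homCpx P.P J) =>
      Q.map (scalarMap P.π) ≫ f := by
  have := P.isKProjective
  have := isKInjective_homCpx P.P J
  constructor
  -- By adjunction a map `g : Hom_R(P, A) → Hom_R(P, J)` corresponds to a map `P ⊗ Hom_R(P, A) → J`.
  -- The latter factors through the evaluation, as `ψ : A → J`, so that `g` is `Hom_R(P, ψ)`. If `g`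
  -- vanishes on the image of `1`, then `ψ ∘ π = 0` and `ψ = 0` in `D(R)`.
  · refine (injective_iff_map_eq_zero (Preadditive.leftComp _ (Q.map (scalarMap P.π)))).2
      fun f hf => ?_
    obtain ⟨g, rfl⟩ := Q_map_surjective_of_isKInjective f
    obtain ⟨ψ, hψ⟩ := Q_map_surjective_of_isKInjective
      (inv (Q.map (evaluationMap P.P A)) ≫ Q.map (tensorUncurry g))
    obtain ⟨H⟩ := (Q_map_eq_iff_of_isKInjective (tensorUncurry g) (evaluationMap P.P A ≫ ψ)).1
      (by rw [Functor.map_comp, hψ, IsIso.hom_inv_id_assoc])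
    obtain ⟨H'⟩ := nonempty_homotopy_tensorCurry H
    rw [tensorCurry_tensorUncurry, tensorCurry_comp, tensorCurry_evaluationMap,
      Category.id_comp] at H'
    have e : Q.map g = Q.map (homCpxPostcomp P.P ψ) := Q_map_eq_of_homotopy _ H'
    have hf' : Q.map (scalarMap P.π) ≫ Q.map g = 0 := hf
    rw [e, ← Functor.map_comp, ← scalarMap_comp, Q_map_scalarMap_eq_zero_iff,
      ← Q_map_eq_iff_of_isKInjective, Functor.map_comp, Functor.map_zero] at hf'
    have hψ0 : Q.map ψ = 0 := by
      rw [← cancel_epi (Q.map P.π), hf', Limits.comp_zero]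
    rw [← Functor.map_zero, Q_map_eq_iff_of_isKInjective] at hψ0
    obtain ⟨H₁⟩ := hψ0
    obtain ⟨H₂⟩ := nonempty_homotopy_postcomp P.P H₁
    rw [e, Q_map_eq_of_homotopy _ H₂]
    have : homCpxPostcomp P.P (0 : A ⟶ J) = 0 := by
      ext n z
      change (CochainComplex.HomComplex.Cochain.comp z
        (CochainComplex.HomComplex.Cochain.ofHom 0) (add_zero n)) = 0
      rw [CochainComplex.HomComplex.Cochain.ofHom_zero]
      exact CochainComplex.HomComplex.Cochain.comp_zero _ _
    rw [this, Functor.map_zero]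
  -- A map `R → Hom_R(P, J)` is given by some `φ : P → J`, which factors as `ψ ∘ π` in `D(R)`.
  · intro f
    obtain ⟨g, rfl⟩ := Q_map_surjective_of_isKProjective f
    obtain ⟨φ, rfl⟩ := exists_eq_scalarMap g
    obtain ⟨ψ, hψ⟩ := Q_map_surjective_of_isKInjective (inv (Q.map P.π) ≫ Q.map φ)
    obtain ⟨H⟩ := (Q_map_eq_iff_of_isKInjective (P.π ≫ ψ) φ).1
      (by rw [Functor.map_comp, hψ, IsIso.hom_inv_id_assoc])
    obtain ⟨H'⟩ := nonempty_homotopy_scalarMap H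
    refine ⟨Q.map (homCpxPostcomp P.P ψ), ?_⟩
    dsimp only
    rw [← Functor.map_comp, ← scalarMap_comp, Q_map_eq_of_homotopy _ H']

/-- If `A` belongs to its own Bass class, then it is dualizing on a factor of `R`: the cone of the
homothety morphism is orthogonal to `RHom_R(A, A)`, where the second argument is replaced by a
K-injective resolution. -/
theorem InBassClass.exists_isDualizingOn [IsNoetherianRing R] {A : Cpx R}
    (hA : HomologicallyFinite A) (h : InBassClass A A) : ∃ e, IsDualizingOn e (Q.obj A) := by
  obtain ⟨hb, P, hE, hP⟩ := h
  have := P.isKProjective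
  obtain ⟨J, j, hj, hJ⟩ := exists_quasiIso_isKInjective A hb.isGE
  rw [homologicallyFinite_iff] at hA
  -- `RHom_R(A, A)` is assumed to be bounded only; it is degreewise finite because `A` is homologically
  -- finite.
  have hEf : FiniteCoh (Q.obj (P.rHom A)) :=
    ⟨hE.isGE, hE.isLE, fun n =>
      have : Module.Finite R (Q.obj A ⟶ (Q.obj A)⟦n⟧) := finite_hom_of_iso
        ((shiftFunctorZero (Der R) ℤ).app (Q.obj A)) (Iso.refl _) (hA.finiteHoms hA 0 n)
      Module.Finite.equiv (cohRHomEquiv P A n).symm⟩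
  obtain ⟨C, g, k, hT⟩ := distinguished_cocone_triangle P.homothety
  have hC : Orthogonal C (Q.obj (P.rHom A)) := by
    refine orthogonal_obj₃_of_bijective hT fun n => ?_
    have := quasiIso_homCpxPostcomp P.P j
    let i : (Q.obj (homCpx P.P A))⟦n⟧ ≅ Q.obj (homCpx P.P (J⟦n⟧)) :=
      (shiftFunctor (Der R) n).mapIso (asIso (Q.map (homCpxPostcomp P.P j))) ≪≫
        ((Q.commShiftIso n).app (homCpx P.P J)).symm ≪≫ Q.mapIso (homCpxShiftIso P.P J n).symm
    have hb := bijective_homothety_comp_of_isIso_evaluation P hP (J⟦n⟧)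
    constructor
    · intro f g hfg
      refine (Iso.cancel_iso_hom_right f g i).1 (hb.1 ?_)
      have := congrArg (· ≫ i.hom) hfg
      exact (Category.assoc _ _ _).symm.trans (this.trans (Category.assoc _ _ _))
    · intro f
      obtain ⟨g, hg⟩ := hb.2 (f ≫ i.hom)
      refine ⟨g ≫ i.inv, ?_⟩
      refine (Category.assoc _ _ _).symm.trans ((congrArg (· ≫ i.inv) hg).trans ?_)
      exact (Category.assoc _ _ _).trans ((congrArg (f ≫ ·) i.hom_inv_id).trans (Category.comp_id _))
  obtain ⟨a, b, hab, ha, hb⟩ := hC.exists_add_eq_one (FiniteCoh.obj₃ hT finiteCoh_unitCpx hEf) hEf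
  refine ⟨a, isDualizingOn_of_distTriang P hT hab ha ?_⟩
  -- An element annihilating `RHom_R(A, A)` annihilates the identity of `A`.
  have h0 := mem_annCoh.1 (mem_annCoh_of_smul_id_eq_zero hb) 0
    ((cohRHomEquiv P A 0).symm (homothetyOne P))
  rw [← map_smul, LinearEquiv.map_eq_zero_iff] at h0
  rw [← cancel_mono (homothetyOne P), Linear.smul_comp, Category.id_comp, h0, Limits.zero_comp]

/-- Morphisms into K-injective complexes detect whether a morphism is zero on cohomology. -/
lemma coh_map_eq_zero_of_forall {Y : Der R} {X : Cpx R} (w : Y ⟶ Q.obj X)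
    (h : ∀ (J : Cpx R) [J.IsKInjective] (f : Q.obj X ⟶ Q.obj J), w ≫ f = 0) (n : ℤ) :
    (homologyFunctor _ n).map w = 0 := by
  -- The cohomology of `X` in degree `n` embeds in `X.opcycles n`, hence in an injective module `I`, and
  -- the resulting map comes from a chain map to `I`, placed in degree `n`.
  let I := Injective.under (X.opcycles n)
  let J : Cpx R := (HomologicalComplex.single (ModuleCat.{u} R) (ComplexShape.up ℤ) n).obj I
  have hI (m : ℤ) : Injective (J.X m) := by
    by_cases hm : m = n
    · subst hm
      exact Injective.of_iso (HomologicalComplex.singleObjXSelf _ _ _).symm inferInstance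
    · exact (HomologicalComplex.isZero_single_obj_X _ _ _ _ hm).injective
  have : J.IsStrictlyGE n := by
    rw [CochainComplex.isStrictlyGE_iff]
    intro i hi
    exact HomologicalComplex.isZero_single_obj_X _ _ _ _ (by lia)
  have := CochainComplex.isKInjective_of_injective J n
  let f : X ⟶ J := HomologicalComplex.mkHomToSingle (X.pOpcycles n ≫ Injective.ι _)
    (fun i _ => by simp)
  have hm : Mono (HomologicalComplex.homologyMap f n) := by
    have hd : J.d (n - 1) n = 0 := HomologicalComplex.single_obj_d _ _ _ _ _
    have := J.isIso_pOpcycles (n - 1) n (by simp) hd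
    have e : HomologicalComplex.opcyclesMap f n ≫ inv (J.pOpcycles n) ≫
        (HomologicalComplex.singleObjXSelf _ _ _).hom = Injective.ι _ := by
      rw [← cancel_epi (X.pOpcycles n), HomologicalComplex.p_opcyclesMap_assoc,
        IsIso.hom_inv_id_assoc]
      simp [f]
    have e' : HomologicalComplex.homologyMap f n ≫ J.homologyι n ≫ inv (J.pOpcycles n) ≫
        (HomologicalComplex.singleObjXSelf _ _ _).hom = X.homologyι n ≫ Injective.ι _ := by
      rw [HomologicalComplex.homologyι_naturality_assoc, e]
    exact mono_of_mono_fac e'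
  have hm' : Mono ((homologyFunctor (ModuleCat.{u} R) n).map (Q.map f)) := by
    have : Mono ((Q ⋙ homologyFunctor (ModuleCat.{u} R) n).map f) :=
      ((MorphismProperty.monomorphisms _).arrow_mk_iso_iff
        ((Arrow.isoOfNatIso (homologyFunctorFactors (ModuleCat.{u} R) n) (Arrow.mk f)))).2 hm
    exact this
  rw [← cancel_mono ((homologyFunctor (ModuleCat.{u} R) n).map (Q.map f)), ← Functor.map_comp, h J,
    Functor.map_zero, Limits.zero_comp]

/-- If `A` is dualizing on a factor of `R`, then `A` belongs to its own Bass class. The map `x ↦ x ⊗ π`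
is a section of the evaluation morphism in `D(R)`. By adjunction and because the homothety morphism is
a split epimorphism, morphisms from `P ⊗ Hom_R(P, A)` to K-injective complexes are determined on the
image of this section, so that the section is an inverse on cohomology. -/
theorem IsDualizingOn.inBassClass {A : Cpx R} {e : R} (h : IsDualizingOn e (Q.obj A))
    (hA : HomologicallyFinite A) (P : Resolution A) : InBassClass A A := by
  have := P.isKProjective
  refine ⟨hA.1, P, ((homologicallyFinite_iff _).2 (h.finiteCoh_rHom P)).1, ?_⟩
  change IsIso (Q.map (evaluationMap P.P A))
  obtain ⟨s, hs⟩ := h.exists_section P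
  -- `c` sends `x` to `x ⊗ π`
  obtain ⟨c, hc⟩ := exists_eq_scalarMap (scalarMap P.π ≫ coevaluationMap P.P (homCpx P.P A))
  have hc' {J : Cpx R} (g : HomologicalComplex.tensorObj P.P (homCpx P.P A) ⟶ J) :
      scalarMap (c ≫ g) = scalarMap P.π ≫ tensorCurry g := by
    rw [scalarMap_comp, hc, Category.assoc, tensorCurry]
  have hcev : c ≫ evaluationMap P.P A = P.π :=
    scalarMap_injective (by rw [hc', tensorCurry_evaluationMap, Category.comp_id])
  have hQ : Q.map c ≫ Q.map (evaluationMap P.P A) = Q.map P.π := by rw [← Functor.map_comp, hcev]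
  have hzero (J : Cpx R) [J.IsKInjective]
      (f : Q.obj (HomologicalComplex.tensorObj P.P (homCpx P.P A)) ⟶ Q.obj J)
      (hf : Q.map c ≫ f = 0) : f = 0 := by
    have := isKInjective_homCpx P.P J
    obtain ⟨g, rfl⟩ := Q_map_surjective_of_isKInjective f
    rw [← Functor.map_comp, ← Functor.map_zero, Q_map_eq_iff_of_isKInjective,
      ← Q_map_scalarMap_eq_zero_iff, hc', Functor.map_comp] at hf
    have h0 : Q.map (tensorCurry g) = 0 := by
      refine (Category.id_comp _).symm.trans ((congrArg (· ≫ Q.map (tensorCurry g)) hs.symm).trans ?_)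
      exact (Category.assoc _ _ _).trans ((congrArg (s ≫ ·) hf).trans Limits.comp_zero)
    rw [← Functor.map_zero, Q_map_eq_iff_of_isKInjective] at h0
    obtain ⟨H⟩ := h0
    obtain ⟨H'⟩ := nonempty_homotopy_tensorUncurry H
    rw [tensorUncurry_tensorCurry] at H'
    rw [Q_map_eq_of_homotopy _ H']
    have : tensorUncurry (0 : homCpx P.P A ⟶ homCpx P.P J) = 0 := by
      refine HomologicalComplex.hom_ext _ _ fun n => tensorObj_hom_ext fun p q hpq x t => ?_
      rw [tensorUncurry_tensorMk]
      exact smul_zero _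
    rw [this, Functor.map_zero]
  let w := Q.map (evaluationMap P.P A) ≫ inv (Q.map P.π) ≫ Q.map c
  have hw (n : ℤ) : (homologyFunctor _ n).map (w - 𝟙 _) = 0 := by
    refine coh_map_eq_zero_of_forall _ (fun J _ f => hzero J _ ?_) n
    have : Q.map c ≫ w = Q.map c := by
      simp only [w]
      rw [← Category.assoc, hQ, IsIso.hom_inv_id_assoc]
    rw [← Category.assoc, Preadditive.comp_sub, this, Category.comp_id, sub_self, Limits.zero_comp]
  rw [isIso_iff_coh_bijective]
  intro n
  constructor
  · have hw' := hw n
    rw [Functor.map_sub, sub_eq_zero, CategoryTheory.Functor.map_id] at hw'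
    have : Mono ((homologyFunctor _ n).map (Q.map (evaluationMap P.P A))) := by
      have : Mono ((homologyFunctor _ n).map (Q.map (evaluationMap P.P A)) ≫
          (homologyFunctor _ n).map (inv (Q.map P.π) ≫ Q.map c)) := by
        rw [← Functor.map_comp]
        exact hw' ▸ inferInstance
      exact mono_of_mono _ ((homologyFunctor _ n).map (inv (Q.map P.π) ≫ Q.map c))
    exact (ModuleCat.mono_iff_injective _).1 this
  · have : Epi ((homologyFunctor _ n).map (Q.map (evaluationMap P.P A))) := by
      have : Epi ((homologyFunctor _ n).map (Q.map c) ≫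
          (homologyFunctor _ n).map (Q.map (evaluationMap P.P A))) := by
        rw [← Functor.map_comp, hQ]
        infer_instance
      exact epi_of_epi ((homologyFunctor _ n).map (Q.map c)) _
    exact (ModuleCat.epi_iff_surjective _).1 this

end BassClass

/-! ### Restriction of scalars -/

section Restriction

open DerivedCategory

attribute [local instance] HasDerivedCategory.standard

variable {R R₁ : Type u} [CommRing R] [CommRing R₁]

/-- For a K-projective complex, being dualizing on a factor of `R` can be expressed in terms of
chain maps up to homotopy. -/
lemma isDualizingOn_iff_of_isKProjective (e : R) (P : Cpx R) [P.IsKProjective] :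
    IsDualizingOn e (Q.obj P) ↔ e * e = e ∧ Nonempty (Homotopy ((1 - e) • 𝟙 P) 0) ∧
      (∀ f : P ⟶ P, ∃ r : R, Nonempty (Homotopy f (r • 𝟙 P))) ∧
      (∀ r : R, Nonempty (Homotopy (r • 𝟙 P) 0) → r * e = 0) ∧
      ∀ n : ℤ, n ≠ 0 → ∀ f : P ⟶ P⟦n⟧, Nonempty (Homotopy f 0) := by
  have h0 (r : R) : Nonempty (Homotopy (r • 𝟙 P) 0) ↔ r • 𝟙 (Q.obj P) = 0 := by
    rw [← Q_map_eq_iff_of_isKProjective, Functor.map_smul, CategoryTheory.Functor.map_id,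
      Functor.map_zero]
  constructor
  · intro h
    refine ⟨h.idem, (h0 _).2 h.compl, fun f => ?_, fun r hr => h.faithful r ((h0 r).1 hr),
      fun n hn f => ?_⟩
    · obtain ⟨r, hr⟩ := h.scalar (Q.map f)
      refine ⟨r, ?_⟩
      rw [← Q_map_eq_iff_of_isKProjective, hr, Functor.map_smul, CategoryTheory.Functor.map_id]
    · rw [← Q_map_eq_iff_of_isKProjective, Functor.map_zero,
        ← cancel_mono ((Q.commShiftIso n).hom.app P), Limits.zero_comp]
      exact h.ext n hn _
  · rintro ⟨h₁, h₂, h₃, h₄, h₅⟩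
    refine ⟨h₁, (h0 _).1 h₂, fun f => ?_, fun r hr => h₄ r ((h0 r).2 hr), fun n hn f => ?_⟩
    · obtain ⟨g, rfl⟩ := Q_map_surjective_of_isKProjective f
      obtain ⟨r, hr⟩ := h₃ g
      refine ⟨r, ?_⟩
      rw [← Q_map_eq_iff_of_isKProjective, Functor.map_smul, CategoryTheory.Functor.map_id] at hr
      exact hr
    · obtain ⟨g, hg⟩ := Q_map_surjective_of_isKProjective
        (f ≫ (Q.commShiftIso n).inv.app P)
      have := h₅ n hn g
      rw [← Q_map_eq_iff_of_isKProjective, Functor.map_zero, hg] at this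
      rw [← cancel_mono ((Q.commShiftIso n).inv.app P), this, Limits.zero_comp]

variable (φ : R →+* R₁)

lemma full_restrictScalars (hφ : Function.Surjective φ) :
    (ModuleCat.restrictScalars.{u} φ).Full where
  map_surjective {M N} f := ⟨ModuleCat.ofHom
    { toFun := fun x : M => (f.hom x : N)
      map_add' := fun x y => map_add f.hom x y
      map_smul' := fun s x => by
        obtain ⟨r, rfl⟩ := hφ s
        exact f.hom.map_smul r (show (ModuleCat.restrictScalars.{u} φ).obj M from x) }, rfl⟩

/-- Restriction of scalars for complexes, as a functor; by definition its value at `X` is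
`restrictCpx φ X`. -/
abbrev restrictFunctor : Cpx R₁ ⥤ Cpx R :=
  (ModuleCat.restrictScalars.{u} φ).mapHomologicalComplex (ComplexShape.up ℤ)

lemma nonempty_homotopy_restrict_iff (hφ : Function.Surjective φ) {X Y : Cpx R₁} (f g : X ⟶ Y) :
    Nonempty (Homotopy ((restrictFunctor φ).map f) ((restrictFunctor φ).map g)) ↔
      Nonempty (Homotopy f g) := by
  have := full_restrictScalars φ hφ
  exact ⟨fun ⟨H⟩ => ⟨Functor.preimageHomotopy _ H⟩, fun ⟨H⟩ => ⟨Functor.mapHomotopy _ H⟩⟩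

lemma restrictFunctor_map_surjective (hφ : Function.Surjective φ) {X Y : Cpx R₁}
    (f : (restrictFunctor φ).obj X ⟶ (restrictFunctor φ).obj Y) : ∃ g, (restrictFunctor φ).map g = f := by
  have := full_restrictScalars φ hφ
  exact (restrictFunctor φ).map_surjective f

lemma restrictFunctor_map_smul {X Y : Cpx R₁} (f : X ⟶ Y) (r : R) :
    (restrictFunctor φ).map (φ r • f) = r • (restrictFunctor φ).map f := by
  ext
  rfl

/-- Restriction along `R → R₁`, where `R₁` is the factor of `R` belonging to the idempotent `e`,
turns a complex which is dualizing on all of `R₁` into one which is dualizing on `e`. -/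
lemma isDualizingOn_restrictCpx_iff (hφ : Function.Surjective φ) {e : R} (he : e * e = e)
    (he₁ : φ e = 1) (hker : ∀ r, φ r = 0 ↔ r * e = 0) (P : Cpx R₁) [P.IsKProjective]
    [((restrictFunctor φ).obj P).IsKProjective] :
    IsDualizingOn e (Q.obj ((restrictFunctor φ).obj P)) ↔ IsDualizingOn 1 (Q.obj P) := by
  have hsmul (r : R) : r • 𝟙 ((restrictFunctor φ).obj P) = (restrictFunctor φ).map (φ r • 𝟙 P) := by
    rw [restrictFunctor_map_smul, CategoryTheory.Functor.map_id]
  have h0 (r : R) : Nonempty (Homotopy (r • 𝟙 ((restrictFunctor φ).obj P)) 0) ↔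
      Nonempty (Homotopy (φ r • 𝟙 P) 0) := by
    rw [hsmul, ← nonempty_homotopy_restrict_iff φ hφ, Functor.map_zero]
  rw [isDualizingOn_iff_of_isKProjective, isDualizingOn_iff_of_isKProjective]
  have hcompl : Nonempty (Homotopy ((1 - e) • 𝟙 ((restrictFunctor φ).obj P)) 0) ↔
      Nonempty (Homotopy ((1 - (1 : R₁)) • 𝟙 P) 0) := by
    rw [h0, map_sub, map_one, he₁]
  have hscalar : (∀ f : (restrictFunctor φ).obj P ⟶ (restrictFunctor φ).obj P, ∃ r : R,
      Nonempty (Homotopy f (r • 𝟙 ((restrictFunctor φ).obj P)))) ↔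
      ∀ f : P ⟶ P, ∃ r : R₁, Nonempty (Homotopy f (r • 𝟙 P)) := by
    constructor
    · intro h f
      obtain ⟨r, hr⟩ := h ((restrictFunctor φ).map f)
      refine ⟨φ r, (nonempty_homotopy_restrict_iff φ hφ _ _).1 ?_⟩
      rw [← hsmul]
      exact hr
    · intro h f
      obtain ⟨g, rfl⟩ := restrictFunctor_map_surjective φ hφ f
      obtain ⟨s, hs⟩ := h g
      obtain ⟨r, rfl⟩ := hφ s
      refine ⟨r, ?_⟩
      rw [hsmul]
      exact (nonempty_homotopy_restrict_iff φ hφ _ _).2 hs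
  have hfaith : (∀ r : R, Nonempty (Homotopy (r • 𝟙 ((restrictFunctor φ).obj P)) 0) → r * e = 0) ↔
      ∀ r : R₁, Nonempty (Homotopy (r • 𝟙 P) 0) → r * 1 = 0 := by
    simp only [h0, ← hker, mul_one]
    exact ⟨fun h s => by obtain ⟨r, rfl⟩ := hφ s; exact h r, fun h r => h (φ r)⟩
  have hext : (∀ n : ℤ, n ≠ 0 → ∀ f : (restrictFunctor φ).obj P ⟶ ((restrictFunctor φ).obj P)⟦n⟧,
      Nonempty (Homotopy f 0)) ↔
      ∀ n : ℤ, n ≠ 0 → ∀ f : P ⟶ P⟦n⟧, Nonempty (Homotopy f 0) := by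
    refine forall_congr' fun n => forall_congr' fun _ => ?_
    -- restriction of scalars commutes with the shift
    let i : (restrictFunctor φ).obj (P⟦n⟧) ≅ ((restrictFunctor φ).obj P)⟦n⟧ :=
      ((restrictFunctor φ).commShiftIso n).app P
    constructor
    · intro h f
      obtain ⟨H⟩ := h ((restrictFunctor φ).map f ≫ i.hom)
      refine (nonempty_homotopy_restrict_iff φ hφ _ _).1
        ⟨(Homotopy.ofEq ?_).trans ((H.compRight i.inv).trans (Homotopy.ofEq ?_))⟩
      · rw [Category.assoc, Iso.hom_inv_id, Category.comp_id]
      · rw [Limits.zero_comp, Functor.map_zero]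
    · intro h f
      obtain ⟨g, hg⟩ := restrictFunctor_map_surjective φ hφ (f ≫ i.inv)
      obtain ⟨H⟩ := (nonempty_homotopy_restrict_iff φ hφ _ _).2 (h g)
      refine ⟨(Homotopy.ofEq ?_).trans ((H.compRight i.hom).trans (Homotopy.ofEq ?_))⟩
      · rw [hg, Category.assoc, Iso.inv_hom_id, Category.comp_id]
      · rw [Functor.map_zero, Limits.zero_comp]
  rw [hcompl, hscalar, hfaith, hext, he, mul_one]
  simp only [true_and]

/-- Homology commutes with restriction of scalars. -/
def restrictHomologyIso (X : Cpx R₁) (i : ℤ) :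
    ((restrictFunctor φ).obj X).homology i ≅ (ModuleCat.restrictScalars.{u} φ).obj (X.homology i) :=
  (X.sc i).mapHomologyIso (ModuleCat.restrictScalars.{u} φ)

lemma isZero_homology_restrictCpx_iff (X : Cpx R₁) (i : ℤ) :
    Limits.IsZero (((restrictFunctor φ).obj X).homology i) ↔ Limits.IsZero (X.homology i) := by
  rw [(restrictHomologyIso φ X i).isZero_iff, ModuleCat.isZero_iff_subsingleton,
    ModuleCat.isZero_iff_subsingleton]
  rfl

lemma acyclic_restrictCpx_iff (X : Cpx R₁) : ((restrictFunctor φ).obj X).Acyclic ↔ X.Acyclic := by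
  simp only [HomologicalComplex.acyclic_iff, HomologicalComplex.exactAt_iff_isZero_homology,
    isZero_homology_restrictCpx_iff]

lemma quasiIso_restrictFunctor_map {X Y : Cpx R₁} (f : X ⟶ Y) [QuasiIso f] :
    QuasiIso ((restrictFunctor φ).map f) := inferInstance

lemma HomologicallyFinite.of_restrictCpx {X : Cpx R₁}
    (h : HomologicallyFinite ((restrictFunctor φ).obj X)) : HomologicallyFinite X := by
  obtain ⟨h₁, h₂⟩ := h
  refine ⟨?_, fun i => ?_⟩
  · simpa only [HomologicallyBounded, isZero_homology_restrictCpx_iff] using h₁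
  · have := h₂ i
    have : Module.Finite R ((ModuleCat.restrictScalars.{u} φ).obj (X.homology i)) :=
      .equiv (restrictHomologyIso φ X i).toLinearEquiv
    let := φ.toAlgebra
    let : Module R (X.homology i) := Module.compHom _ φ
    have : IsScalarTower R R₁ (X.homology i) := ⟨fun r s x => mul_smul (φ r) s x⟩
    have : Module.Finite R (X.homology i) := ‹Module.Finite R (ModuleCat.restrictScalars.{u} φ |>.obj _)›
    exact Module.Finite.of_restrictScalars_finite R R₁ _

end Restriction

/-! ### The summand of a complex belonging to a factor of the ring -/

section Corner

variable {R R₁ R₂ : Type u} [CommRing R] [CommRing R₁] [CommRing R₂] (e : R ≃+* R₁ × R₂)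

/-- The projection of `R ≅ R₁ × R₂` onto the first factor. -/
abbrev fstHom : R →+* R₁ := (RingHom.fst R₁ R₂).comp e.toRingHom

/-- The idempotent of `R ≅ R₁ × R₂` which belongs to the first factor. -/
def fstIdem : R := e.symm (1, 0)

lemma fstHom_surjective : Function.Surjective (fstHom e) := fun s => ⟨e.symm (s, 0), by simp⟩

lemma fstIdem_mul_self : fstIdem e * fstIdem e = fstIdem e := by
  simp [fstIdem, ← map_mul]

lemma fstHom_fstIdem : fstHom e (fstIdem e) = 1 := by simp [fstIdem]

lemma mul_fstIdem (r : R) : r * fstIdem e = e.symm (fstHom e r, 0) := by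
  apply e.injective
  simp [fstIdem, Prod.ext_iff]

lemma fstHom_eq_zero_iff (r : R) : fstHom e r = 0 ↔ r * fstIdem e = 0 := by
  rw [mul_fstIdem, e.symm.map_eq_zero_iff, Prod.mk_eq_zero]
  simp

/-- The direct summand of an `R`-module `M` on which the first factor of `R ≅ R₁ × R₂` acts, defined
as the image of multiplication by the idempotent. It is a type of its own, because it carries an
`R₁`-module structure in addition to that of a submodule; an element `s` of `R₁` acts as the element
of `R` corresponding to `(s, 0)`. -/
def Corner (M : ModuleCat.{u} R) : Type u :=
  LinearMap.range (LinearMap.lsmul R M (fstIdem e))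

namespace Corner

variable (M : ModuleCat.{u} R)

instance : AddCommGroup (Corner e M) :=
  inferInstanceAs (AddCommGroup (LinearMap.range (LinearMap.lsmul R M (fstIdem e))))

instance : Module R (Corner e M) :=
  inferInstanceAs (Module R (LinearMap.range (LinearMap.lsmul R M (fstIdem e))))

/-- The inclusion of the summand. -/
def incl : Corner e M →ₗ[R] M := Submodule.subtype _

/-- The projection onto the summand. -/
def proj : M →ₗ[R] Corner e M := LinearMap.rangeRestrict _

lemma incl_proj (x : M) : incl e M (proj e M x) = fstIdem e • x := rfl

lemma incl_injective : Function.Injective (incl e M) := Subtype.val_injective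

lemma smul_incl (x : Corner e M) : fstIdem e • incl e M x = incl e M x := by
  obtain ⟨_, y, rfl⟩ := x
  change fstIdem e • fstIdem e • y = fstIdem e • y
  rw [smul_smul, fstIdem_mul_self]

lemma proj_incl (x : Corner e M) : proj e M (incl e M x) = x :=
  incl_injective e M (smul_incl e M x)

lemma fstIdem_smul (x : Corner e M) : fstIdem e • x = x := proj_incl e M x

instance : Module R₁ (Corner e M) where
  smul s x := e.symm (s, 0) • x
  one_smul x := fstIdem_smul e M x
  mul_smul s t x := by
    change e.symm (s * t, 0) • x = e.symm (s, 0) • e.symm (t, 0) • x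
    rw [smul_smul, ← map_mul, Prod.mk_mul_mk, mul_zero]
  smul_zero s := smul_zero (e.symm (s, 0))
  smul_add s x y := smul_add (e.symm (s, 0)) x y
  add_smul s t x := by
    change e.symm (s + t, 0) • x = e.symm (s, 0) • x + e.symm (t, 0) • x
    rw [← add_smul, ← map_add, Prod.mk_add_mk, add_zero]
  zero_smul x := by
    change e.symm (0, 0) • x = 0
    rw [← Prod.zero_eq_mk, map_zero, zero_smul]

lemma smul_def (s : R₁) (x : Corner e M) : s • x = e.symm (s, 0) • x := rfl

lemma fstHom_smul (r : R) (x : Corner e M) : fstHom e r • x = r • x := by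
  rw [smul_def, ← mul_fstIdem, mul_smul, fstIdem_smul]

end Corner

/-- The functor sending an `R`-module to the summand on which the first factor of `R ≅ R₁ × R₂`
acts. -/
def cornerFunctor : ModuleCat.{u} R ⥤ ModuleCat.{u} R₁ where
  obj M := ModuleCat.of R₁ (Corner e M)
  map {M N} f := ModuleCat.ofHom
    { toFun := fun x => Corner.proj e N (f.hom (Corner.incl e M x))
      map_add' := fun x y => by simp only [map_add]
      map_smul' := fun s x => by
        simp only [RingHom.id_apply, Corner.smul_def, map_smul] }
  map_id M := ModuleCat.hom_ext (LinearMap.ext fun x => Corner.proj_incl e M x)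
  map_comp {L M N} f g := ModuleCat.hom_ext (LinearMap.ext fun x => by
    refine congrArg (fun y => Corner.proj e N (g.hom y)) ?_
    change f.hom (Corner.incl e L x) = fstIdem e • f.hom (Corner.incl e L x)
    rw [← map_smul, Corner.smul_incl])

instance : (cornerFunctor e).Additive where
  map_add {_ N _ _} := ModuleCat.hom_ext (LinearMap.ext fun _ => map_add (Corner.proj e N) _ _)

/-- The inclusion of the summand, as a natural transformation. -/
def cornerIncl : cornerFunctor e ⋙ ModuleCat.restrictScalars.{u} (fstHom e) ⟶ 𝟭 _ where
  app M := ModuleCat.ofHom (X := (ModuleCat.restrictScalars.{u} (fstHom e)).obj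
      ((cornerFunctor e).obj M))
    { toFun := fun x : Corner e M => Corner.incl e M x
      map_add' := fun x y => map_add (Corner.incl e M) x y
      map_smul' := fun r x => (congrArg (Corner.incl e M) (Corner.fstHom_smul e M r x)).trans
        ((Corner.incl e M).map_smul r (show Corner e M from x)) }
  naturality M N f := ModuleCat.hom_ext (LinearMap.ext fun (x : Corner e M) => by
    change fstIdem e • f.hom (Corner.incl e M x) = f.hom (Corner.incl e M x)
    rw [← map_smul, Corner.smul_incl])

/-- The projection onto the summand, as a natural transformation. -/
def cornerProj : 𝟭 _ ⟶ cornerFunctor e ⋙ ModuleCat.restrictScalars.{u} (fstHom e) where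
  app M := ModuleCat.ofHom (Y := (ModuleCat.restrictScalars.{u} (fstHom e)).obj
      ((cornerFunctor e).obj M))
    { toFun := fun x : M => (Corner.proj e M x : Corner e M)
      map_add' := fun x y => map_add (Corner.proj e M) x y
      map_smul' := fun r x => (map_smul (Corner.proj e M) r x).trans
        (Corner.fstHom_smul e M r _).symm }
  naturality M N f := ModuleCat.hom_ext (LinearMap.ext fun (x : M) =>
    Corner.incl_injective e N (by
      change fstIdem e • f.hom x = fstIdem e • f.hom (fstIdem e • x)
      rw [map_smul, smul_smul, fstIdem_mul_self]))

/-- The complex of summands on which the first factor of `R ≅ R₁ × R₂` acts. -/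
abbrev cornerCpx (X : Cpx R) : Cpx R₁ :=
  ((cornerFunctor e).mapHomologicalComplex (ComplexShape.up ℤ)).obj X

/-- The inclusion of the complex of summands. -/
def cornerCpxIncl (X : Cpx R) : (restrictFunctor (fstHom e)).obj (cornerCpx e X) ⟶ X where
  f n := (cornerIncl e).app (X.X n)
  comm' i j _ := ((cornerIncl e).naturality (X.d i j)).symm

/-- The projection onto the complex of summands. -/
def cornerCpxProj (X : Cpx R) : X ⟶ (restrictFunctor (fstHom e)).obj (cornerCpx e X) where
  f n := (cornerProj e).app (X.X n)
  comm' i j _ := ((cornerProj e).naturality (X.d i j)).symm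

lemma cornerCpxIncl_proj (X : Cpx R) : cornerCpxIncl e X ≫ cornerCpxProj e X = 𝟙 _ := by
  ext n : 1
  exact ModuleCat.hom_ext (LinearMap.ext fun x : Corner e (X.X n) => Corner.proj_incl e (X.X n) x)

lemma cornerCpxProj_incl (X : Cpx R) : cornerCpxProj e X ≫ cornerCpxIncl e X =
    fstIdem e • 𝟙 X := by
  ext n : 1
  exact ModuleCat.hom_ext (LinearMap.ext fun x => Corner.incl_proj e (X.X n) x)

lemma acyclic_cornerCpx {X : Cpx R} (hX : X.Acyclic) : (cornerCpx e X).Acyclic := by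
  rw [← acyclic_restrictCpx_iff (fstHom e)]
  intro n
  rw [HomologicalComplex.exactAt_iff_isZero_homology]
  have h := (HomologicalComplex.exactAt_iff_isZero_homology _ _).1 (hX n)
  have hr : HomologicalComplex.homologyMap (cornerCpxIncl e X) n ≫
      HomologicalComplex.homologyMap (cornerCpxProj e X) n = 𝟙 _ := by
    rw [← HomologicalComplex.homologyMap_comp, cornerCpxIncl_proj,
      HomologicalComplex.homologyMap_id]
  rw [Limits.IsZero.iff_id_eq_zero, ← hr, h.eq_zero_of_tgt (HomologicalComplex.homologyMap _ n), Limits.zero_comp]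

lemma fstIdem_smul_restrict_id (X : Cpx R₁) :
    fstIdem e • 𝟙 ((restrictFunctor (fstHom e)).obj X) = 𝟙 _ := by
  have := restrictFunctor_map_smul (fstHom e) (𝟙 X) (fstIdem e)
  rw [fstHom_fstIdem, one_smul, CategoryTheory.Functor.map_id] at this
  exact this.symm

/-- Every chain map from a complex of `R₁`-modules lands in the summand on which `R₁` acts. -/
lemma comp_cornerCpxProj_incl {X : Cpx R₁} {Y : Cpx R}
    (f : (restrictFunctor (fstHom e)).obj X ⟶ Y) :
    f ≫ cornerCpxProj e Y ≫ cornerCpxIncl e Y = f := by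
  rw [cornerCpxProj_incl, Linear.comp_smul, Category.comp_id, ← Category.id_comp f,
    ← Linear.smul_comp, fstIdem_smul_restrict_id]

/-- Restriction of scalars to `R` preserves K-projectivity, as it is left adjoint to the exact functor
`X ↦ cornerCpx e X`. -/
instance isKProjective_restrict (P : Cpx R₁) [P.IsKProjective] :
    ((restrictFunctor (fstHom e)).obj P).IsKProjective where
  nonempty_homotopy_zero {Y} f hY := by
    obtain ⟨g, hg⟩ := restrictFunctor_map_surjective (fstHom e) (fstHom_surjective e)
      (f ≫ cornerCpxProj e Y)
    obtain ⟨H⟩ := (nonempty_homotopy_restrict_iff (fstHom e) (fstHom_surjective e) _ _).2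
      ⟨CochainComplex.IsKProjective.homotopyZero g (acyclic_cornerCpx e hY)⟩
    refine ⟨(Homotopy.ofEq ?_).trans ((H.compRight (cornerCpxIncl e Y)).trans (Homotopy.ofEq ?_))⟩
    · rw [hg, Category.assoc, comp_cornerCpxProj_incl]
    · rw [Functor.map_zero, Limits.zero_comp]

/-- Taking the summand belonging to `R₁` preserves K-projectivity, as it is left adjoint to
restriction of scalars. -/
instance isKProjective_cornerCpx (P : Cpx R) [P.IsKProjective] :
    (cornerCpx e P).IsKProjective where
  nonempty_homotopy_zero {Y} g hY := by
    rw [← nonempty_homotopy_restrict_iff (fstHom e) (fstHom_surjective e)]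
    have H := CochainComplex.IsKProjective.homotopyZero
      (cornerCpxProj e P ≫ (restrictFunctor (fstHom e)).map g)
      ((acyclic_restrictCpx_iff (fstHom e) Y).2 hY)
    refine ⟨(Homotopy.ofEq ?_).trans ((H.compLeft (cornerCpxIncl e P)).trans (Homotopy.ofEq ?_))⟩
    · rw [← Category.assoc, cornerCpxIncl_proj, Category.id_comp]
    · rw [Functor.map_zero, Limits.comp_zero]

end Corner

/-! ### Semidualizing complexes over a factor of the ring -/

section Factor

open DerivedCategory

attribute [local instance] HasDerivedCategory.standard

variable {R R₁ R₂ : Type u} [CommRing R] [CommRing R₁] [CommRing R₂] (e : R ≃+* R₁ × R₂)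

lemma isDualizingOn_fstIdem_iff (P : Cpx R₁) [P.IsKProjective] :
    IsDualizingOn (fstIdem e) (Q.obj ((restrictFunctor (fstHom e)).obj P)) ↔
      IsDualizingOn 1 (Q.obj P) :=
  isDualizingOn_restrictCpx_iff _ (fstHom_surjective e) (fstIdem_mul_self e) (fstHom_fstIdem e)
    (fstHom_eq_zero_iff e) P

/-- The complex `X₁ × 0` is the restriction of scalars of `X₁`. -/
def prodCpxZeroIso (X₁ : Cpx R₁) :
    (restrictFunctor (fstHom e)).obj X₁ ≅ prodCpx e X₁ (0 : Cpx R₂) :=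
  Limits.isoBiprodZero (((ModuleCat.restrictScalars.{u} ((RingHom.snd R₁ R₂).comp
    e.toRingHom)).mapHomologicalComplex (ComplexShape.up ℤ)).map_isZero
      (Limits.isZero_zero (Cpx R₂)))

lemma fstIdem_ne_zero [Nontrivial R₁] : fstIdem e ≠ 0 := fun h =>
  one_ne_zero (α := R₁) (by rw [← fstHom_fstIdem e, h, map_zero])

lemma fstIdem_ne_one [Nontrivial R₂] : fstIdem e ≠ 1 := fun h => by
  have := congrArg (fun r => (e r).2) h
  simp [fstIdem] at this

/-- A complex which is isomorphic in `D(R)` to `A₁ × 0`, for a semidualizing `R₁`-complex `A₁`, is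
dualizing on the factor `R₁`. -/
theorem IsSemidualizing.isDualizingOn_fstIdem {A₁ : Cpx R₁} (h : IsSemidualizing A₁) {A : Cpx R}
    (hA : DerivedIso A (prodCpx e A₁ (0 : Cpx R₂))) :
    Nonempty (Resolution A) ∧ IsDualizingOn (fstIdem e) (Q.obj A) := by
  obtain ⟨_, P₁, hP₁⟩ := h
  obtain ⟨i⟩ := hA
  have := P₁.isKProjective
  have := (isIso_Q_map_iff_quasiIso _ P₁.π).2 P₁.quasiIso
  have := (isIso_Q_map_iff_quasiIso _ _).2 (quasiIso_restrictFunctor_map (fstHom e) P₁.π)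
  have h₁ : IsDualizingOn 1 (Q.obj P₁.P) :=
    ((isIso_homothety_iff P₁).1 hP₁).of_iso (asIso (Q.map P₁.π)).symm
  have hε := (isDualizingOn_fstIdem_iff e P₁.P).2 h₁
  let j : Q.obj ((restrictFunctor (fstHom e)).obj P₁.P) ≅ Q.obj A :=
    asIso (Q.map ((restrictFunctor (fstHom e)).map P₁.π)) ≪≫
      Q.mapIso (prodCpxZeroIso e A₁) ≪≫ i.symm
  obtain ⟨π, hπ⟩ := Q_map_surjective_of_isKProjective j.hom
  refine ⟨⟨⟨_, π, inferInstance, (isIso_Q_map_iff_quasiIso _ π).1 ?_⟩⟩, hε.of_iso j⟩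
  rw [hπ]
  infer_instance

/-- A complex which is dualizing on the factor `R₁` of `R ≅ R₁ × R₂` is isomorphic in `D(R)` to
`A₁ × 0` for a semidualizing `R₁`-complex `A₁`. -/
theorem IsDualizingOn.exists_isSemidualizing {A : Cpx R} (h : IsDualizingOn (fstIdem e) (Q.obj A))
    (hA : HomologicallyFinite A) (P : Resolution A) :
    ∃ A₁ : Cpx R₁, IsSemidualizing A₁ ∧ DerivedIso A (prodCpx e A₁ (0 : Cpx R₂)) := by
  have := P.isKProjective
  have := (isIso_Q_map_iff_quasiIso _ P.π).2 P.quasiIso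
  have hε : fstIdem e • 𝟙 (Q.obj P.P) = 𝟙 _ := by
    have := (h.of_iso (asIso (Q.map P.π)).symm).compl
    rw [sub_smul, one_smul, sub_eq_zero] at this
    exact this.symm
  -- `A₁` is the summand of the resolution on which `R₁` acts; it is everything up to isomorphism
  -- in `D(R)`, because the idempotent acts as the identity there.
  let i : Q.obj P.P ≅ Q.obj ((restrictFunctor (fstHom e)).obj (cornerCpx e P.P)) :=
    { hom := Q.map (cornerCpxProj e P.P)
      inv := Q.map (cornerCpxIncl e P.P)
      hom_inv_id := by
        rw [← Functor.map_comp, cornerCpxProj_incl, Functor.map_smul,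
          CategoryTheory.Functor.map_id, hε]
      inv_hom_id := by
        rw [← Functor.map_comp, cornerCpxIncl_proj, CategoryTheory.Functor.map_id] }
  let j : Q.obj A ≅ Q.obj ((restrictFunctor (fstHom e)).obj (cornerCpx e P.P)) :=
    (asIso (Q.map P.π)).symm ≪≫ i
  let P₁ : Resolution (cornerCpx e P.P) := ⟨_, 𝟙 _, inferInstance, inferInstance⟩
  refine ⟨cornerCpx e P.P, ⟨HomologicallyFinite.of_restrictCpx (fstHom e) ?_, P₁, ?_⟩,
    ⟨j ≪≫ Q.mapIso (prodCpxZeroIso e _)⟩⟩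
  · exact (homologicallyFinite_iff _).2 (((homologicallyFinite_iff A).1 hA).of_iso j)
  · rw [isIso_homothety_iff, ← isDualizingOn_fstIdem_iff e]
    exact h.of_iso j

/-- An idempotent of `R` splits `R` into a product of two rings. -/
lemma exists_ringEquiv_prod {ε : R} (hε : ε * ε = ε) :
    ∃ f : R ≃+* (R ⧸ Ideal.span {1 - ε}) × (R ⧸ Ideal.span {ε}), fstIdem f = ε := by
  have hb := RingHom.prod_bijective_of_isIdempotentElem (e := 1 - ε) (f := ε)
    (IsIdempotentElem.one_sub hε) hε (sub_add_cancel _ _) (by rw [sub_mul, hε, one_mul, sub_self])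
  refine ⟨RingEquiv.ofBijective _ hb, ?_⟩
  rw [fstIdem, RingEquiv.symm_apply_eq]
  have h₁ : Ideal.Quotient.mk (Ideal.span {1 - ε}) ε = 1 := by
    rw [← map_one (Ideal.Quotient.mk _), eq_comm, Ideal.Quotient.eq]
    exact Ideal.mem_span_singleton_self _
  have h₂ : Ideal.Quotient.mk (Ideal.span {ε}) ε = 0 :=
    Ideal.Quotient.eq_zero_iff_mem.2 (Ideal.mem_span_singleton_self _)
  exact (Prod.ext h₁ h₂).symm

lemma nontrivial_quotient_span_of_isIdempotentElem {ε : R} (hε : ε * ε = ε) (h : ε ≠ 1) :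
    Nontrivial (R ⧸ Ideal.span {ε}) := by
  refine Ideal.Quotient.nontrivial_iff.2 fun ht => h ?_
  exact (IsIdempotentElem.iff_eq_one_of_isUnit (Ideal.span_singleton_eq_top.1 ht)).1 hε

lemma not_connectedSpace_of_idempotent {ε : R} (hε : ε * ε = ε) (h₀ : ε ≠ 0) (h₁ : ε ≠ 1) :
    ¬ ConnectedSpace (PrimeSpectrum R) := fun _ => by
  have h := PrimeSpectrum.isClopen_iff.2 ⟨ε, hε, rfl⟩
  rcases isClopen_iff.1 h with h | h
  · exact h₀ (PrimeSpectrum.basicOpen_injOn_isIdempotentElem hε IsIdempotentElem.zero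
      (TopologicalSpace.Opens.ext (by simpa using h)))
  · exact h₁ (PrimeSpectrum.basicOpen_injOn_isIdempotentElem hε IsIdempotentElem.one
      (TopologicalSpace.Opens.ext (by simpa using h)))

lemma isSemidualizing_iff {A : Cpx R} (hA : HomologicallyFinite A) (P : Resolution A) :
    IsSemidualizing A ↔ IsDualizingOn 1 (Q.obj A) :=
  ⟨fun ⟨_, P, hP⟩ => (isIso_homothety_iff P).1 hP,
    fun h => ⟨hA, P, (isIso_homothety_iff P).2 h⟩⟩

/-- A complex which is dualizing on the factor of `R` belonging to `e` is neither semidualizing nor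
zero if and only if this factor is proper. -/
lemma IsDualizingOn.not_isSemidualizing_and_not_derivedZero_iff {A : Cpx R} {e : R}
    (h : IsDualizingOn e (Q.obj A)) (hA : HomologicallyFinite A) (P : Resolution A) :
    ¬ IsSemidualizing A ∧ ¬ DerivedZero A ↔ e ≠ 1 ∧ e ≠ 0 := by
  rw [isSemidualizing_iff hA P]
  exact and_congr (not_congr ⟨h.eq_one, fun h₁ => h₁ ▸ h⟩) (not_congr h.isZero_iff)

end Factor

end RComplex

end

theorem theorem3p6 {R : Type u} [CommRing R] [IsNoetherianRing R] [Nontrivial R]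
    (A : RComplex.Cpx R) (hA : RComplex.HomologicallyFinite A) :
    List.TFAE
      [∃ (R₁ R₂ : Type u) (_ : CommRing R₁) (_ : CommRing R₂)
          (_ : IsNoetherianRing R₁) (_ : IsNoetherianRing R₂)
          (_ : Nontrivial R₁) (_ : Nontrivial R₂)
          (e : R ≃+* R₁ × R₂) (A₁ : RComplex.Cpx R₁),
          RComplex.IsSemidualizing A₁ ∧ RComplex.DerivedIso A (RComplex.prodCpx e A₁ 0),
        RComplex.IsDerivedReflexive A A ∧ ¬ RComplex.IsSemidualizing A ∧
          ¬ RComplex.DerivedZero A,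
        (∃ P : RComplex.Resolution A, RComplex.IsDerivedReflexive A (P.rHom A)) ∧
          ¬ RComplex.IsSemidualizing A ∧ ¬ RComplex.DerivedZero A,
        ¬ RComplex.DerivedZero A ∧ RComplex.InBassClass A A ∧
          ¬ RComplex.IsSemidualizing A] ∧
    (RComplex.IsDerivedReflexive A A ∧ ¬ RComplex.IsSemidualizing A ∧ ¬ RComplex.DerivedZero A →
      ¬ ConnectedSpace (PrimeSpectrum R)) := by
  constructor
  · tfae_have 2 ↔ 3 := by
      refine and_congr_left fun _ => ⟨RComplex.IsDerivedReflexive.rHom, fun ⟨P, hP⟩ => ?_⟩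
      exact RComplex.isDerivedReflexive_of_rHom hA P hP
    tfae_have 1 → 2 := by
      rintro ⟨R₁, R₂, _, _, _, _, _, _, e, A₁, hA₁, hi⟩
      obtain ⟨⟨P⟩, h⟩ := hA₁.isDualizingOn_fstIdem e hi
      exact ⟨h.isDerivedReflexive hA P,
        (h.not_isSemidualizing_and_not_derivedZero_iff hA P).2
          ⟨RComplex.fstIdem_ne_one e, RComplex.fstIdem_ne_zero e⟩⟩
    tfae_have 2 → 4 := by
      rintro ⟨hr, hs, h₀⟩
      obtain ⟨ε, h⟩ := hr.exists_isDualizingOn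
      obtain ⟨_, P, _⟩ := hr
      exact ⟨h₀, h.inBassClass hA P, hs⟩
    tfae_have 4 → 1 := by
      rintro ⟨h₀, hb, hs⟩
      obtain ⟨ε, h⟩ := hb.exists_isDualizingOn hA
      obtain ⟨_, P, _⟩ := hb
      obtain ⟨h₁, h₀⟩ := (h.not_isSemidualizing_and_not_derivedZero_iff hA P).1 ⟨hs, h₀⟩
      obtain ⟨e, he⟩ := RComplex.exists_ringEquiv_prod h.idem
      exact ⟨_, _, inferInstance, inferInstance, inferInstance, inferInstance,
        RComplex.nontrivial_quotient_span_of_isIdempotentElem (IsIdempotentElem.one_sub h.idem)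
          (fun h => h₀ (by simpa using h)),
        RComplex.nontrivial_quotient_span_of_isIdempotentElem h.idem h₁, e,
        (he.symm ▸ h : RComplex.IsDualizingOn (RComplex.fstIdem e) _).exists_isSemidualizing e hA P⟩
    tfae_finish
  · rintro ⟨hr, hs⟩
    obtain ⟨ε, h⟩ := hr.exists_isDualizingOn
    obtain ⟨_, P, _⟩ := hr
    obtain ⟨h₁, h₀⟩ := (h.not_isSemidualizing_and_not_derivedZero_iff hA P).1 hs
    exact RComplex.not_connectedSpace_of_idempotent h.idem h₀ h₁
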